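/- Let $(\alpha_n)_{n\ge 1}$ be a sequence with $0<\alpha_n<1$. Put $C_0=[0,1]$ and, for $n\ge 1$, let $C_n$ be obtained from $C_{n-1}$ by removing from each of the closed intervals $[a,b]$ that make up $C_{n-1}$ the open interval with the same midpoint and length $\alpha_n(b-a)$. The set $C=\bigcap_{n\ge1}C_n$ is called a generalized Cantor set. Write $m$ for Lebesgue measure on $\mathbb R$. For a Borel set $M\subset[0,1]$ let $K_M(x,y)=\widehat{\chi_M}(x-y)$, $x,y\in\mathbb R$, where $\chi_M$ is the indicator function of $M$ and $\widehat g(\xi)=\int_{\mathbb R}g(x)e^{-2\pi i x\xi}\,dx$. A configuration on $\mathbb R$ is a countable sum $X=\sum_i\delta_{x_i}$ of unit point masses that is finite on compact sets; $\#_B(X)=X(B)$; a point process is a probability measure on the space of configurations, equipped with the $\sigma$-algebra generated by all $\#_B$, $B$ Borel (equivalently, the Borel $\sigma$-algebra of the vague topology). A point process $\mathbb P$ is determinantal with kernel $K$ (with respect to Lebesgue measure) if $\mathbb P$-almost every $X$ has no multiple points and, for every $n\ge1$ and every bounded, compactly supported, measurable $\varphi:\mathbb R^n\to\mathbb C$,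 $$\mathbb E_{\mathbb P}\Big[\sum_{x_1,\dots,x_n\in X\ \text{distinct}}\varphi(x_1,\dots,x_n)\Big]=\int_{\mathbb R^n}\varphi(x_1,\dots,x_n)\det[K(x_i,x_j)]_{1\le i,j\le n}\,dx_1\cdots dx_n,$$ with both sides absolutely convergent. A point process $\mathbb P$ is number rigid if for every compact $B\subset\mathbb R$ the random variable $\#_B$ is measurable with respect to the $\mathbb P$-completion (the $\sigma$-algebra generated together with all $\mathbb P$-null sets) of $\sigma(\#_A: A\subset\mathbb R\setminus B\text{ Borel})$. **Theorem.** For every $\theta\in[0,1)$ there is a generalized Cantor set $C$ with $m(C)=\theta$ such that, with $I=[0,1]\setminus C$, determinantal point processes $\mathbb P_{K_C}$ with kernel $K_C$ and $\mathbb P_{K_I}$ with kernel $K_I$ exist, and every determinantal point process with kernel $K_C$ or $K_I$ is number rigid. -/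

import Mathlib

open MeasureTheory Set
open scoped FourierTransform ENNReal

noncomputable section

/-! ### Configurations and point processes -/

section PointProcesses

variable {E : Type*} [TopologicalSpace E] [MeasurableSpace E]

/-- A locally finite configuration on `E`: a measure `X = ∑ᵢ δ_{xᵢ}` (a countable sum of unit point
masses, repetitions allowed) that is finite on every compact set. -/
def IsConfiguration (X : Measure E) : Prop :=
  (∃ (ι : Type) (_ : Countable ι) (x : ι → E), X = Measure.sum fun i => Measure.dirac (x i)) ∧
    ∀ Δ : Set E, IsCompact Δ → X Δ < ∞

variable (E) in
/-- The space `Conf(E)` of locally finite configurations. As a subtype of `Measure E` it carries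
the σ-algebra generated by all counting maps `X ↦ X B` with `B ⊆ E` measurable, which on a locally
compact Polish space is the Borel σ-algebra of the vague topology. -/
abbrev Conf : Type _ := {X : Measure E // IsConfiguration X}

variable (E) in
/-- A point process on `E`: a probability measure on `Conf(E)`. -/
abbrev PointProcess : Type _ := ProbabilityMeasure (Conf E)

/-- The counting variable `#_B(X)`, the number of points of `X` in `B`, with multiplicity. -/
def numPoints (B : Set E) (X : Conf E) : ℝ≥0∞ := X.1 B

/-- The set of points of a configuration. -/
def Conf.points (X : Conf E) : Set E := {x | X.1 {x} ≠ 0}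

/-- A configuration is simple if no point has multiplicity greater than one. -/
def Conf.IsSimple (X : Conf E) : Prop := ∀ x : E, X.1 {x} ≤ 1

/-- The sum of `φ (x₁, …, xₙ)` over all `n`-tuples of distinct points of `X`. -/
def Conf.sumDistinct (X : Conf E) (n : ℕ) (φ : (Fin n → E) → ℂ) : ℂ :=
  ∑' x : {x : Fin n → E // Function.Injective x ∧ ∀ i, x i ∈ X.points}, φ x.1

/-- `P` is a determinantal point process with correlation kernel `K` with respect to the reference
measure `μ`: it is simple, and for every `n ≥ 1` and every bounded, compactly supported, measurable
`φ : Eⁿ → ℂ`, the expectation of `∑ φ(x₁, …, xₙ)` over distinct points equals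
`∫ φ(x₁, …, xₙ) det [K(xᵢ, xⱼ)] dμ(x₁) ⋯ dμ(xₙ)`, both integrals being absolutely convergent. -/
structure IsDeterminantal (μ : Measure E) (K : E → E → ℂ) (P : PointProcess E) : Prop where
  simple : ∀ᵐ X ∂(P : Measure (Conf E)), X.IsSimple
  correlation : ∀ n : ℕ, 1 ≤ n → ∀ φ : (Fin n → E) → ℂ,
    Measurable φ → HasCompactSupport φ → (∃ c : ℝ, ∀ x, ‖φ x‖ ≤ c) →
      Integrable (fun X : Conf E => X.sumDistinct n φ) (P : Measure (Conf E)) ∧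
      Integrable (fun x : Fin n → E => φ x * (Matrix.of fun i j => K (x i) (x j)).det)
        (Measure.pi fun _ => μ) ∧
      ∫ X : Conf E, X.sumDistinct n φ ∂(P : Measure (Conf E)) =
        ∫ x : Fin n → E, φ x * (Matrix.of fun i j => K (x i) (x j)).det ∂(Measure.pi fun _ => μ)

/-- The σ-algebra `ℱ_S` on `Conf(E)` generated by the counting variables `#_B`, where `B` runs over
the measurable subsets of `S`. -/
@[reducible] def sigmaAlgebraOn (S : Set E) : MeasurableSpace (Conf E) :=
  ⨆ (B : Set E) (_ : MeasurableSet B) (_ : B ⊆ S),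
    MeasurableSpace.comap (numPoints B) inferInstance

/-- The completion `ℱ_S^P`: all sets that differ from a member of `ℱ_S` by a `P`-null set, that
is, the σ-algebra generated by `ℱ_S` and the `P`-null sets. -/
@[reducible] def completedSigmaAlgebraOn (P : PointProcess E) (S : Set E) : MeasurableSpace (Conf E) :=
  eventuallyMeasurableSpace (sigmaAlgebraOn S) (ae (P : Measure (Conf E)))

/-- A point process `P` is number rigid if for every compact `B ⊆ E` the counting variable `#_B`
is `ℱ_{E∖B}^P`-measurable. -/
def NumberRigid (P : PointProcess E) : Prop :=
  ∀ B : Set E, IsCompact B → Measurable[completedSigmaAlgebraOn P Bᶜ] (numPoints B)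

end PointProcesses

/-! ### Generalized Cantor sets -/

/-- The (endpoints of the) closed intervals that make up the `n`-th stage `Cₙ`: start with `[0, 1]`,
and in step `n + 1` remove from every interval `[a, b]` of stage `n` the open interval with the same
midpoint and length `α (n + 1) * (b - a)`. The value `α 0` is not used. -/
def cantorIntervals (α : ℕ → ℝ) : ℕ → Set (ℝ × ℝ)
  | 0 => {(0, 1)}
  | n + 1 => ⋃ p ∈ cantorIntervals α n,
      {(p.1, (p.1 + p.2) / 2 - α (n + 1) * (p.2 - p.1) / 2),
       ((p.1 + p.2) / 2 + α (n + 1) * (p.2 - p.1) / 2, p.2)}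

/-- The `n`-th stage `Cₙ` of the construction. -/
def cantorStage (α : ℕ → ℝ) (n : ℕ) : Set ℝ :=
  ⋃ p ∈ cantorIntervals α n, Icc p.1 p.2

/-- The set `⋂ₙ Cₙ` with ratios `α 1, α 2, …`. -/
def generalizedCantorSet (α : ℕ → ℝ) : Set ℝ :=
  ⋂ n : ℕ, cantorStage α n

/-- `C` is a generalized Cantor set: it arises from some ratios `0 < αₙ < 1`, `n ≥ 1`. -/
def IsGeneralizedCantorSet (C : Set ℝ) : Prop :=
  ∃ α : ℕ → ℝ, (∀ n, 1 ≤ n → 0 < α n ∧ α n < 1) ∧ C = generalizedCantorSet α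

/-! ### Translation-invariant kernels -/

/-- The kernel `K_M(x, y) = χ̂_M(x - y)`, with `ĝ(ξ) = ∫ g(x) e^{-2πixξ} dx`. -/
def fourierKernel (M : Set ℝ) (x y : ℝ) : ℂ :=
  𝓕 (M.indicator (fun _ => (1 : ℂ))) (x - y)

end

/-! ### Gluing a consistent sequence of laws -/

section Gluing

open ProbabilityTheory Preorder

/-! Rigidity comes from linear statistics. If φ = 1 on an interval containing B, then #_B is ∑ φ
over all points minus a quantity that only sees the points outside B. So if there are such φ_n,
equal to 1 on [-n, n], with summable variances of ∑ φ_n, the centred statistics tend to 0 almost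
surely and #_B is almost surely a limit of functions of the configuration outside B
(`numberRigid_of_tendsto`).

For the kernel K_M the variance is ∫ |χ̂_M(u)|² E_φ(u) du with E_φ(u) = ½ ∫ (φ(x) - φ(x - u))² dx
(`integral_linearStatistic_sub_sq`). Where χ̂_M is bounded by A/|u|, this is at most A² times the
H^{1/2} energy ∫ E_φ(u)/u² du. That energy is scale invariant, and cutoffs at well separated scales
are nearly orthogonal for it, so the average of m of them has energy O(1/m)
(`integral_shiftEnergy_averagedCutoff_le`). A stage C_n consists of 2^n intervals, which gives A =
2^n. The Fourier transform of C itself need not decay in this way, but by Plancherel it differs from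
that of C_n by a function of squared L² norm m(C_n \ C). Hence the order of choices: first φ_n with
energy so small that it beats 4^n, then the ratios of the Cantor construction, so that m(C_{n+1} \
C) ∫ φ_n² is small (`exists_cantor_volume`). Passing from C to [0,1] \ C adds the transform of one
interval to the bound.

Existence is proved by finite rank approximation. K_M is the Gram kernel of the exponentials in
L²(M), so an orthonormal basis exhibits it as a pointwise limit of kernels of projections of finite
rank d. Each of these is the kernel of d random points with joint density det/d!. On a bounded
window the law of the points is a series in the correlation functions, obtained by
inclusion-exclusion. The correlation functions are bounded by 1 and converge pointwise, so the
window laws are Cauchy in total variation (`IsFiniteRankApprox.exists_limit_windowLaw`). The limits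
on the windows (-k, k] are consistent and are glued to one process by the Ionescu-Tulcea theorem.
Finally the correlation formula passes to the limit, because the factorial moments are bounded
uniformly along the approximation. -/

lemma map_compProd_comap {A S T : Type*} [MeasurableSpace A] [MeasurableSpace S]
    [MeasurableSpace T] (m : Measure A) [SFinite m] (κ : Kernel S T) [IsSFiniteKernel κ]
    {f : A → S} (hf : Measurable f) :
    (m ⊗ₘ κ.comap f hf).map (Prod.map f id) = (m.map f) ⊗ₘ κ := by
  ext s hs
  rw [Measure.map_apply (hf.prodMap measurable_id) hs,
    Measure.compProd_apply (hs.preimage (hf.prodMap measurable_id)), Measure.compProd_apply hs,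
    lintegral_map (Kernel.measurable_kernel_prodMk_left hs) hf]
  rfl

/-- A kernel which samples the next stage given the restriction of that stage. -/
lemma exists_kernel_of_map_standardBorel {S Z : Type*} [MeasurableSpace S] [MeasurableSpace Z]
    [StandardBorelSpace Z] [Nonempty Z] (l : Measure Z) [IsFiniteMeasure l] {g : Z → S}
    (hg : Measurable g) {r : S → S} (hr : Measurable r) :
    ∃ κ : Kernel S S, IsMarkovKernel κ ∧
      ((l.map g).map r) ⊗ₘ κ = (l.map g).map (fun s => (r s, s)) := by
  -- Condition in the standard Borel space `Z`, where regular conditional laws exist, and push the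
  -- result forward by `g`; no regularity of `S` is needed.
  refine ⟨(condDistrib id (r ∘ g) l).map g, Kernel.IsMarkovKernel.map _ hg, ?_⟩
  rw [Measure.map_map hr hg, Measure.compProd_map hg, compProd_map_condDistrib aemeasurable_id,
    Measure.map_map (by fun_prop) (by fun_prop), Measure.map_map (by fun_prop) hg]
  rfl

/-- Ionescu-Tulcea: run a Markov chain from `s₀` whose k-th transition draws stage k + 1
conditionally on its restriction being the current state. By induction the chain has the prescribed
marginals, so each consecutive pair has the joint law of (restriction, stage). -/
theorem exists_measure_of_consistent {S Z : Type*} [MeasurableSpace S] [MeasurableSpace Z]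
    [StandardBorelSpace Z] [Nonempty Z] (l : ℕ → Measure Z) [∀ k, IsProbabilityMeasure (l k)]
    {g : ℕ → Z → S} (hg : ∀ k, Measurable (g k)) {r : ℕ → S → S} (hr : ∀ k, Measurable (r k))
    (hcons : ∀ k, ((l (k + 1)).map (g (k + 1))).map (r k) = (l k).map (g k))
    {s₀ : S} (h0 : (l 0).map (g 0) = Measure.dirac s₀) :
    ∃ μ : Measure (ℕ → S), IsProbabilityMeasure μ ∧
      ∀ k, μ.map (fun x => (x k, x (k + 1))) =
        ((l (k + 1)).map (g (k + 1))).map (fun s => (r k s, s)) := by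
  choose κ hκ hκ' using fun k =>
    exists_kernel_of_map_standardBorel (l (k + 1)) (hg (k + 1)) (hr k)
  -- The transition looks only at the last coordinate of the history.
  let K : (n : ℕ) → Kernel ((i : Finset.Iic n) → (fun _ : ℕ => S) i) S := fun n =>
    (κ n).comap (fun x => x ⟨n, Finset.mem_Iic.2 le_rfl⟩) (measurable_pi_apply _)
  have hK : ∀ n, IsMarkovKernel (K n) := fun n => by
    have := hκ n
    exact Kernel.IsMarkovKernel.comap _ _
  let μ : Measure (ℕ → S) := Kernel.traj (X := fun _ => S) K 0 (fun _ => s₀)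
  have hμ : IsProbabilityMeasure μ := by
    dsimp only [μ]; infer_instance
  have key : ∀ b, μ.map (fun x => (x b, x (b + 1))) = (μ.map (fun x => x b)) ⊗ₘ κ b := by
    intro b
    have h := Kernel.partialTraj_compProd_eq_map_traj (X := fun _ => S) (κ := K) (zero_le (a := b))
      (x₀ := fun _ => s₀)
    have h2 : Kernel.partialTraj (X := fun _ => S) K 0 b (fun _ => s₀) = μ.map (frestrictLe b) :=
      (Kernel.traj_map_frestrictLe_apply (X := fun _ => S) (κ := K) 0 b _).symm
    rw [h2] at h
    have := hκ b
    have h3 := congrArg (Measure.map (Prod.map (fun x : (i : Finset.Iic b) → S =>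
      x ⟨b, Finset.mem_Iic.2 le_rfl⟩) id)) h
    have h4 := map_compProd_comap (μ.map (frestrictLe (π := fun _ => S) b)) (κ b)
      (f := fun x : (i : Finset.Iic b) → S => x ⟨b, Finset.mem_Iic.2 le_rfl⟩)
      (measurable_pi_apply _)
    rw [Measure.map_map (measurable_pi_apply _) (by fun_prop)] at h4
    rw [Measure.map_map (by fun_prop) (by fun_prop)] at h3
    exact h3.symm.trans h4
  refine ⟨μ, hμ, ?_⟩
  have hmarg : ∀ k, μ.map (fun x => x k) = (l k).map (g k) := by
    intro k
    induction k with
    | zero =>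
      rw [h0]
      have h2 := Kernel.traj_map_frestrictLe_apply (X := fun _ => S) (κ := K) 0 0 (fun _ => s₀)
      rw [Kernel.partialTraj_self, Kernel.id_apply] at h2
      have h3 := congrArg (Measure.map (fun x : (i : Finset.Iic 0) → S =>
        x ⟨0, Finset.mem_Iic.2 le_rfl⟩)) h2
      rw [Measure.map_map (measurable_pi_apply _) (by fun_prop),
        Measure.map_dirac' (measurable_pi_apply _)] at h3
      exact h3
    | succ k ih =>
      have h := key k
      rw [ih, ← hcons k, hκ' k] at h
      have h3 := congrArg (Measure.map Prod.snd) h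
      have h4 : Measurable fun s => (r k s, s) := (hr k).prodMk measurable_id
      rw [Measure.map_map (by fun_prop) (by fun_prop), Measure.map_map (by fun_prop) h4] at h3
      have h5 : (Prod.snd ∘ fun s => (r k s, s)) = (id : S → S) := rfl
      rw [h5, Measure.map_id] at h3
      exact h3
  intro k
  rw [key k, hmarg k, ← hcons k, hκ' k]

end Gluing

noncomputable section

/-! ### Determinants of kernels of finite rank -/

section FiniteRank

open scoped ComplexConjugate ComplexOrder

variable {α : Type*}

/-- The determinant `det [K(xᵢ, xⱼ)]`. -/
def kernelDet (K : α → α → ℂ) {n : ℕ} (x : Fin n → α) : ℂ :=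
  (Matrix.of fun i j => K (x i) (x j)).det

/-- The kernel `∑ₖ ψₖ(x) conj (ψₖ(y))`. -/
def finiteKernel {d : ℕ} (ψ : Fin d → α → ℂ) (x y : α) : ℂ :=
  ∑ k, ψ k x * conj (ψ k y)

/-- The Gram factorization, the source both of positivity and of the rank bound. -/
lemma finiteKernel_matrix {d n : ℕ} (ψ : Fin d → α → ℂ) (x : Fin n → α) :
    (Matrix.of fun i j => finiteKernel ψ (x i) (x j)) =
      (Matrix.of fun i k => ψ k (x i)) * (Matrix.of fun i k => ψ k (x i)).conjTranspose := by
  ext i j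
  simp [finiteKernel, Matrix.mul_apply]

lemma posSemidef_finiteKernel {d n : ℕ} (ψ : Fin d → α → ℂ) (x : Fin n → α) :
    (Matrix.of fun i j => finiteKernel ψ (x i) (x j)).PosSemidef := by
  rw [finiteKernel_matrix]
  exact Matrix.posSemidef_self_mul_conjTranspose _

lemma kernelDet_finiteKernel_nonneg {d n : ℕ} (ψ : Fin d → α → ℂ) (x : Fin n → α) :
    0 ≤ kernelDet (finiteKernel ψ) x :=
  (posSemidef_finiteKernel ψ x).det_nonneg

lemma kernelDet_finiteKernel_eq_re {d n : ℕ} (ψ : Fin d → α → ℂ) (x : Fin n → α) :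
    kernelDet (finiteKernel ψ) x = ((kernelDet (finiteKernel ψ) x).re : ℂ) :=
  Complex.eq_re_of_ofReal_le (r := 0) (by simpa using kernelDet_finiteKernel_nonneg ψ x)

/-- A positive semidefinite matrix whose diagonal is at most one has determinant at most one. -/
lemma Matrix.PosSemidef.norm_det_le_one {n : Type*} [Fintype n] [DecidableEq n]
    {A : Matrix n n ℂ} (hA : A.PosSemidef) (h : ∀ i, (A i i).re ≤ 1) : ‖A.det‖ ≤ 1 := by
  rw [hA.isHermitian.det_eq_prod_eigenvalues]
  have htr := congrArg Complex.re hA.isHermitian.trace_eq_sum_eigenvalues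
  simp only [Matrix.trace, Matrix.diag, Complex.re_sum] at htr
  have hs : ∑ i, hA.isHermitian.eigenvalues i ≤ Fintype.card n := by
    have : ∑ i, hA.isHermitian.eigenvalues i = ∑ i, (A i i).re := by
      rw [htr]; exact Finset.sum_congr rfl fun i _ => (Complex.ofReal_re _).symm
    rw [this]
    exact (Finset.sum_le_sum fun i _ => h i).trans (by simp)
  rw [norm_prod]
  -- The inequality λ ≤ exp(λ - 1) turns the product of the eigenvalues into exp(trace - size), and
  -- the trace is at most the size.
  calc ∏ i, ‖((hA.isHermitian.eigenvalues i : ℝ) : ℂ)‖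
      ≤ ∏ i, Real.exp (hA.isHermitian.eigenvalues i - 1) := by
        refine Finset.prod_le_prod (fun _ _ => norm_nonneg _) fun i _ => ?_
        rw [Complex.norm_real, Real.norm_eq_abs, abs_of_nonneg (hA.eigenvalues_nonneg i)]
        linarith [Real.add_one_le_exp (hA.isHermitian.eigenvalues i - 1)]
    _ = Real.exp (∑ i, (hA.isHermitian.eigenvalues i - 1)) := (Real.exp_sum _ _).symm
    _ ≤ 1 := by
        rw [Real.exp_le_one_iff, Finset.sum_sub_distrib]
        simpa using hs

lemma norm_kernelDet_finiteKernel_le {d n : ℕ} {ψ : Fin d → α → ℂ}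
    (h : ∀ x, (finiteKernel ψ x x).re ≤ 1) (x : Fin n → α) :
    ‖kernelDet (finiteKernel ψ) x‖ ≤ 1 :=
  (posSemidef_finiteKernel ψ x).norm_det_le_one fun i => h (x i)

/-- The matrix factors through a space of dimension d. Probabilistically, the process has at most d
points. -/
lemma kernelDet_finiteKernel_eq_zero {d n : ℕ} (ψ : Fin d → α → ℂ) (hn : d < n)
    (x : Fin n → α) : kernelDet (finiteKernel ψ) x = 0 := by
  by_contra h
  have hu : IsUnit (Matrix.of fun i j => finiteKernel ψ (x i) (x j)) :=
    (Matrix.isUnit_iff_isUnit_det _).2 (isUnit_iff_ne_zero.2 h)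
  have h1 := Matrix.rank_of_isUnit _ hu
  rw [finiteKernel_matrix] at h1
  have h2 := Matrix.rank_mul_le_left (Matrix.of fun i k => ψ k (x i))
    (Matrix.of fun i k => ψ k (x i)).conjTranspose
  have h3 := Matrix.rank_le_card_width (Matrix.of fun i k => ψ k (x i))
  simp only [Fintype.card_fin] at h1 h3
  omega

lemma kernelDet_comp_perm (K : α → α → ℂ) {n : ℕ} (x : Fin n → α) (σ : Equiv.Perm (Fin n)) :
    kernelDet K (x ∘ σ) = kernelDet K x := by
  exact Matrix.det_submatrix_equiv_self σ (Matrix.of fun i j => K (x i) (x j))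

/-- Expansion of the determinant in the variable which is put in front. -/
lemma kernelDet_cons (K : α → α → ℂ) {n : ℕ} (x : Fin (n + 1) → α) (y : α) :
    kernelDet K (Fin.cons y x : Fin (n + 2) → α) = K y y * kernelDet K x -
      ∑ j : Fin (n + 1), (-1) ^ (j : ℕ) * ∑ i : Fin (n + 1), (-1) ^ (i : ℕ) *
        (K (x i) y * K y (x j)) *
          (Matrix.of fun a b => K (x (i.succAbove a)) (x (j.succAbove b))).det := by
  rw [kernelDet, Matrix.det_succ_row_zero, Fin.sum_univ_succ, sub_eq_add_neg,
    ← Finset.sum_neg_distrib]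
  congr 1
  · simp only [Fin.val_zero, pow_zero, one_mul]
    rfl
  · refine Finset.sum_congr rfl fun j _ => ?_
    rw [Matrix.det_succ_column_zero, Finset.mul_sum, Finset.mul_sum, ← Finset.sum_neg_distrib]
    refine Finset.sum_congr rfl fun i _ => ?_
    have : ((Matrix.of fun i j => K ((Fin.cons y x : Fin (n + 2) → α) i)
        ((Fin.cons y x : Fin (n + 2) → α) j)).submatrix Fin.succ j.succ.succAbove).submatrix
        i.succAbove Fin.succ =
        (Matrix.of fun a b => K (x (i.succAbove a)) (x (j.succAbove b))) := by
      ext a b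
      simp [Fin.succ_succAbove_succ]
    rw [this]
    simp [pow_succ]
    ring

lemma sum_kernelDet_minors (K : α → α → ℂ) {n : ℕ} (x : Fin (n + 1) → α) (j : Fin (n + 1)) :
    (-1) ^ (j : ℕ) * ∑ i : Fin (n + 1), (-1) ^ (i : ℕ) * K (x i) (x j) *
        (Matrix.of fun a b => K (x (i.succAbove a)) (x (j.succAbove b))).det = kernelDet K x := by
  rw [kernelDet, Matrix.det_succ_column _ j, Finset.mul_sum]
  refine Finset.sum_congr rfl fun i _ => ?_
  rw [pow_add]
  have : (Matrix.of fun i j => K (x i) (x j)).submatrix i.succAbove j.succAbove =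
    (Matrix.of fun a b => K (x (i.succAbove a)) (x (j.succAbove b))) := rfl
  rw [this]
  simp
  ring

variable [MeasurableSpace α] {μ : Measure α}

/-- The reproducing property: the integral operator is an orthogonal projection. -/
lemma integral_finiteKernel_mul {d : ℕ} {ψ : Fin d → α → ℂ}
    (hint : ∀ k l, Integrable (fun y => conj (ψ k y) * ψ l y) μ)
    (hortho : ∀ k l, ∫ y, conj (ψ k y) * ψ l y ∂μ = if k = l then 1 else 0) (x z : α) :
    Integrable (fun y => finiteKernel ψ x y * finiteKernel ψ y z) μ ∧
      ∫ y, finiteKernel ψ x y * finiteKernel ψ y z ∂μ = finiteKernel ψ x z := by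
  have h : ∀ y, finiteKernel ψ x y * finiteKernel ψ y z =
      ∑ k, ∑ l, ψ k x * conj (ψ l z) * (conj (ψ k y) * ψ l y) := by
    intro y
    simp only [finiteKernel, Finset.sum_mul_sum]
    exact Finset.sum_congr rfl fun k _ => Finset.sum_congr rfl fun l _ => by ring
  have hi : ∀ k l, Integrable (fun y => ψ k x * conj (ψ l z) * (conj (ψ k y) * ψ l y)) μ :=
    fun k l => (hint k l).const_mul _
  simp only [h]
  refine ⟨integrable_finsetSum _ fun k _ => integrable_finsetSum _ fun l _ => hi k l, ?_⟩
  rw [integral_finsetSum _ fun k _ => integrable_finsetSum _ fun l _ => hi k l]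
  refine Finset.sum_congr rfl fun k _ => ?_
  rw [integral_finsetSum _ fun l _ => hi k l]
  simp [integral_const_mul, hortho]

lemma integral_finiteKernel_diag {d : ℕ} {ψ : Fin d → α → ℂ}
    (hint : ∀ k l, Integrable (fun y => conj (ψ k y) * ψ l y) μ)
    (hortho : ∀ k l, ∫ y, conj (ψ k y) * ψ l y ∂μ = if k = l then 1 else 0) :
    Integrable (fun y => finiteKernel ψ y y) μ ∧ ∫ y, finiteKernel ψ y y ∂μ = d := by
  have h : ∀ y, finiteKernel ψ y y = ∑ k, conj (ψ k y) * ψ k y := fun y =>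
    Finset.sum_congr rfl fun k _ => mul_comm _ _
  simp only [h]
  refine ⟨integrable_finsetSum _ fun k _ => hint k k, ?_⟩
  rw [integral_finsetSum _ fun k _ => hint k k]
  simp [hortho]

/-- Integrating out one variable. In the expansion along the row and column of y, the diagonal entry
integrates to the trace d. By the reproducing property the terms of each of the n remaining columns
reassemble to a Laplace expansion of the n-point determinant, each with a minus sign. -/
lemma integral_kernelDet_cons {d : ℕ} {ψ : Fin d → α → ℂ}
    (hint : ∀ k l, Integrable (fun y => conj (ψ k y) * ψ l y) μ)
    (hortho : ∀ k l, ∫ y, conj (ψ k y) * ψ l y ∂μ = if k = l then 1 else 0) {n : ℕ}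
    (x : Fin n → α) :
    Integrable (fun y => kernelDet (finiteKernel ψ) (Fin.cons y x : Fin (n + 1) → α)) μ ∧
      ∫ y, kernelDet (finiteKernel ψ) (Fin.cons y x : Fin (n + 1) → α) ∂μ =
        (d - n) * kernelDet (finiteKernel ψ) x := by
  obtain ⟨hd, hd'⟩ := integral_finiteKernel_diag hint hortho
  have hr := integral_finiteKernel_mul hint hortho
  cases n with
  | zero => simpa [kernelDet] using ⟨hd, hd'⟩
  | succ n =>
    simp only [kernelDet_cons]
    have h1 : Integrable (fun y => finiteKernel ψ y y * kernelDet (finiteKernel ψ) x) μ :=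
      hd.mul_const _
    have h2 : ∀ i j : Fin (n + 1), Integrable (fun y => (-1) ^ (i : ℕ) *
        (finiteKernel ψ (x i) y * finiteKernel ψ y (x j)) *
          (Matrix.of fun a b => finiteKernel ψ (x (i.succAbove a))
            (x (j.succAbove b))).det) μ := fun i j =>
      ((hr (x i) (x j)).1.const_mul _).mul_const _
    have h3 : ∀ j : Fin (n + 1), Integrable (fun y => (-1) ^ (j : ℕ) * ∑ i : Fin (n + 1),
        (-1) ^ (i : ℕ) * (finiteKernel ψ (x i) y * finiteKernel ψ y (x j)) *
          (Matrix.of fun a b => finiteKernel ψ (x (i.succAbove a))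
            (x (j.succAbove b))).det) μ := fun j =>
      (integrable_finsetSum _ fun i _ => h2 i j).const_mul _
    refine ⟨h1.sub (integrable_finsetSum _ fun j _ => h3 j), ?_⟩
    rw [integral_sub h1 (integrable_finsetSum _ fun j _ => h3 j),
      integral_finsetSum _ fun j _ => h3 j]
    have h4 : ∀ j : Fin (n + 1), ∫ y, (-1) ^ (j : ℕ) * ∑ i : Fin (n + 1),
        (-1) ^ (i : ℕ) * (finiteKernel ψ (x i) y * finiteKernel ψ y (x j)) *
          (Matrix.of fun a b => finiteKernel ψ (x (i.succAbove a))
            (x (j.succAbove b))).det ∂μ = kernelDet (finiteKernel ψ) x := by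
      intro j
      rw [integral_const_mul, integral_finsetSum _ fun i _ => h2 i j,
        ← sum_kernelDet_minors _ x j]
      congr 1
      refine Finset.sum_congr rfl fun i _ => ?_
      rw [integral_mul_const, integral_const_mul, (hr (x i) (x j)).2]
    simp only [h4, integral_mul_const, hd', Finset.sum_const, Finset.card_univ, Fintype.card_fin]
    push_cast
    simp only [nsmul_eq_mul]
    push_cast
    ring

/-- The correlation function `det [K(xᵢ, xⱼ)]` of a finite rank kernel, as an extended
nonnegative real. -/
def finiteCorr {d : ℕ} (ψ : Fin d → α → ℂ) {n : ℕ} (x : Fin n → α) : ℝ≥0∞ :=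
  ENNReal.ofReal (kernelDet (finiteKernel ψ) x).re

lemma measurable_kernelDet {K : α → α → ℂ} (hK : Measurable (Function.uncurry K)) {n : ℕ} :
    Measurable (fun x : Fin n → α => kernelDet K x) := by
  simp only [kernelDet, Matrix.det_apply]
  refine Finset.measurable_sum _ fun σ _ => Measurable.const_smul
    (Finset.measurable_prod _ fun i _ => ?_) _
  have h : Measurable fun x : Fin n → α => (x (σ i), x i) :=
    (measurable_pi_apply _).prodMk (measurable_pi_apply _)
  exact hK.comp h

lemma measurable_finiteKernel {d : ℕ} {ψ : Fin d → α → ℂ} (hψ : ∀ k, Measurable (ψ k)) :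
    Measurable (Function.uncurry (finiteKernel ψ)) := by
  have : Function.uncurry (finiteKernel ψ) =
      fun p : α × α => ∑ k, ψ k p.1 * conj (ψ k p.2) := rfl
  rw [this]
  refine Finset.measurable_sum _ fun k _ => ?_
  exact ((hψ k).comp measurable_fst).mul
    (Complex.continuous_conj.measurable.comp ((hψ k).comp measurable_snd))

lemma measurable_finiteCorr {d : ℕ} {ψ : Fin d → α → ℂ} (hψ : ∀ k, Measurable (ψ k)) {n : ℕ} :
    Measurable (fun x : Fin n → α => finiteCorr ψ x) :=
  (Complex.measurable_re.comp (measurable_kernelDet (measurable_finiteKernel hψ))).ennreal_ofReal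

lemma lintegral_finiteCorr_cons {d : ℕ} {ψ : Fin d → α → ℂ}
    (hint : ∀ k l, Integrable (fun y => conj (ψ k y) * ψ l y) μ)
    (hortho : ∀ k l, ∫ y, conj (ψ k y) * ψ l y ∂μ = if k = l then 1 else 0) {n : ℕ}
    (hn : n ≤ d) (x : Fin n → α) :
    ∫⁻ y, finiteCorr ψ (Fin.cons y x : Fin (n + 1) → α) ∂μ = (d - n : ℕ) * finiteCorr ψ x := by
  obtain ⟨h1, h2⟩ := integral_kernelDet_cons hint hortho x
  simp only [finiteCorr]
  have h5 : Integrable (fun y =>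
      (kernelDet (finiteKernel ψ) (Fin.cons y x : Fin (n + 1) → α)).re) μ := h1.re
  rw [← ofReal_integral_eq_lintegral_ofReal h5
    (Filter.Eventually.of_forall fun y => (Complex.le_def.1
      (kernelDet_finiteKernel_nonneg ψ _)).1)]
  have h3 : ∫ y, (kernelDet (finiteKernel ψ) (Fin.cons y x : Fin (n + 1) → α)).re ∂μ =
      (d - n : ℕ) * (kernelDet (finiteKernel ψ) x).re := by
    have h4 : ∫ y, (kernelDet (finiteKernel ψ) (Fin.cons y x : Fin (n + 1) → α)).re ∂μ =
        (∫ y, kernelDet (finiteKernel ψ) (Fin.cons y x : Fin (n + 1) → α) ∂μ).re :=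
      integral_re h1
    rw [h4, h2]
    have : ((d : ℂ) - n) = (((d - n : ℕ) : ℝ) : ℂ) := by push_cast [hn]; rfl
    rw [this]
    exact Complex.re_ofReal_mul _ _
  rw [h3, ENNReal.ofReal_mul (by positivity), ENNReal.ofReal_natCast]

end FiniteRank

end

noncomputable section

/-! ### Point processes of finite rank kernels -/

section FiniteLaw

open scoped ComplexConjugate Nat

variable {α : Type*} [MeasurableSpace α] {μ : Measure α} [SigmaFinite μ]

/-- The symmetric law of the `d` points of the determinantal process with kernel
`finiteKernel ψ`. -/
def finiteLaw (μ : Measure α) {d : ℕ} (ψ : Fin d → α → ℂ) : Measure (Fin d → α) :=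
  (d ! : ℝ≥0∞)⁻¹ • (Measure.pi fun _ => μ).withDensity (finiteCorr ψ)

/-- The family `ψ` is measurable and orthonormal in `L²(μ)`. -/
structure IsOrthonormalFamily (μ : Measure α) {d : ℕ} (ψ : Fin d → α → ℂ) : Prop where
  measurable : ∀ k, Measurable (ψ k)
  integrable : ∀ k l, Integrable (fun y => conj (ψ k y) * ψ l y) μ
  integral : ∀ k l, ∫ y, conj (ψ k y) * ψ l y ∂μ = if k = l then 1 else 0

lemma lintegral_pi_succ {n : ℕ} {F : (Fin (n + 1) → α) → ℝ≥0∞} (hF : Measurable F) :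
    ∫⁻ x, F x ∂(Measure.pi fun _ => μ) =
      ∫⁻ x : Fin n → α, ∫⁻ y, F (Fin.cons y x) ∂μ ∂(Measure.pi fun _ => μ) := by
  have h := measurePreserving_piFinSuccAbove (fun _ : Fin (n + 1) => μ) 0
  have h2 := (h.symm (MeasurableEquiv.piFinSuccAbove (fun _ : Fin (n + 1) => α) 0)).lintegral_comp
    hF
  rw [← h2, lintegral_prod_symm]
  · refine lintegral_congr fun x => lintegral_congr fun y => ?_
    congr 1
    simp [MeasurableEquiv.piFinSuccAbove, Fin.insertNthEquiv]
  · exact (hF.comp (MeasurableEquiv.measurable _)).aemeasurable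

variable {d : ℕ} {ψ : Fin d → α → ℂ}

/-- Integrating out k of the d variables one after another gives the factors 1, 2, …, k. Which
coordinates survive is left open here; symmetry of the density later allows any injection. -/
lemma exists_lintegral_comp_finiteCorr (hψ : IsOrthonormalFamily μ ψ) (k : ℕ) :
    ∀ n : ℕ, n + k = d → ∃ e : Fin n → Fin d, Function.Injective e ∧
      ∀ f : (Fin n → α) → ℝ≥0∞, Measurable f →
        ∫⁻ x : Fin d → α, f (x ∘ e) * finiteCorr ψ x ∂(Measure.pi fun _ => μ) =
          (k ! : ℝ≥0∞) * ∫⁻ x, f x * finiteCorr ψ x ∂(Measure.pi fun _ => μ) := by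
  induction k with
  | zero =>
    rintro n rfl
    exact ⟨id, Function.injective_id, fun f _ => by simp⟩
  | succ k ih =>
    intro n hn
    obtain ⟨e, he, h⟩ := ih (n + 1) (by omega)
    refine ⟨e ∘ Fin.succ, he.comp (Fin.succ_injective n), fun f hf => ?_⟩
    have hm : Measurable fun x : Fin (n + 1) → α => f (x ∘ Fin.succ) :=
      hf.comp (measurable_pi_lambda _ fun i => measurable_pi_apply _)
    have h1 := h (fun x => f (x ∘ Fin.succ)) hm
    have h2 : ∀ x : Fin d → α, x ∘ e ∘ Fin.succ = (x ∘ e) ∘ Fin.succ := fun _ => rfl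
    simp only [h2]
    rw [h1, lintegral_pi_succ (F := fun x : Fin (n + 1) → α => f (x ∘ Fin.succ) * finiteCorr ψ x)
      (hm.mul (measurable_finiteCorr hψ.measurable))]
    have h3 : ∀ (x : Fin n → α) (y : α), (Fin.cons y x : Fin (n + 1) → α) ∘ Fin.succ = x :=
      fun x y => by ext i; simp
    simp only [h3]
    have h4 : ∀ x : Fin n → α, ∫⁻ y, f x * finiteCorr ψ (Fin.cons y x : Fin (n + 1) → α) ∂μ =
        ((k + 1 : ℕ) : ℝ≥0∞) * (f x * finiteCorr ψ x) := by
      intro x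
      have hc : Measurable fun y : α => (Fin.cons y x : Fin (n + 1) → α) :=
        measurable_pi_lambda _ fun i => by
          refine Fin.cases ?_ (fun i => ?_) i
          · simpa using measurable_id'
          · simp
      rw [lintegral_const_mul (f := fun y => finiteCorr ψ (Fin.cons y x : Fin (n + 1) → α)) _
        ((measurable_finiteCorr hψ.measurable).comp hc),
        lintegral_finiteCorr_cons hψ.integrable hψ.integral (by omega)]
      have : d - n = k + 1 := by omega
      rw [this]
      ring
    simp only [h4]
    rw [lintegral_const_mul (f := fun x : Fin n → α => f x * finiteCorr ψ x) _
      (hf.mul (measurable_finiteCorr hψ.measurable)), ← mul_assoc,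
      Nat.factorial_succ, Nat.cast_mul, mul_comm ((k ! : ℕ) : ℝ≥0∞)]

lemma finiteCorr_comp_perm {β : Type*} {d : ℕ} {ψ : Fin d → β → ℂ} {n : ℕ} (x : Fin n → β) (σ : Equiv.Perm (Fin n)) :
    finiteCorr ψ (x ∘ σ) = finiteCorr ψ x := by
  rw [finiteCorr, kernelDet_comp_perm, finiteCorr]

lemma exists_perm_comp_eq {n d : ℕ} {e e' : Fin n → Fin d} (he : Function.Injective e)
    (he' : Function.Injective e') : ∃ σ : Equiv.Perm (Fin d), σ ∘ e = e' := by
  classical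
  let f : Fin d → Fin d := fun i => if h : ∃ j, e j = i then e' h.choose else i
  have hf : ∀ j, f (e j) = e' j := fun j => by
    have h : ∃ j', e j' = e j := ⟨j, rfl⟩
    simp only [f, dif_pos h]
    exact congrArg e' (he h.choose_spec)
  have hinj : Set.InjOn f (Set.range e) := by
    rintro _ ⟨a, rfl⟩ _ ⟨b, rfl⟩ h
    rw [hf, hf] at h
    rw [he' h]
  obtain ⟨g, hg⟩ := Set.MapsTo.exists_equiv_extend_of_card_eq (t := Finset.univ)
    (by simp) (s := Set.range e) (f := f) (fun _ _ => by simp) hinj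
  refine ⟨g.trans (Equiv.subtypeUnivEquiv (by simp)), funext fun j => ?_⟩
  exact (hg (e j) ⟨j, rfl⟩).trans (hf j)

/-- Two injections differ by a permutation of the d coordinates, and the density is invariant under
permutations. -/
lemma lintegral_comp_finiteCorr (hψ : IsOrthonormalFamily μ ψ) {n : ℕ} {e : Fin n → Fin d}
    (he : Function.Injective e) {f : (Fin n → α) → ℝ≥0∞} (hf : Measurable f) :
    ∫⁻ x : Fin d → α, f (x ∘ e) * finiteCorr ψ x ∂(Measure.pi fun _ => μ) =
      ((d - n)! : ℝ≥0∞) * ∫⁻ x, f x * finiteCorr ψ x ∂(Measure.pi fun _ => μ) := by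
  have hn : n ≤ d := by simpa using Fintype.card_le_of_injective e he
  obtain ⟨e', he', h⟩ := exists_lintegral_comp_finiteCorr hψ (d - n) n (by omega)
  obtain ⟨σ, hσ⟩ := exists_perm_comp_eq he he'
  rw [← h f hf, ← hσ]
  have h1 := measurePreserving_piCongrLeft (fun _ : Fin d => μ) σ
  have h2 : Measurable fun x : Fin d → α => f (x ∘ e) * finiteCorr ψ x :=
    (hf.comp (measurable_pi_lambda _ fun i => measurable_pi_apply _)).mul
      (measurable_finiteCorr hψ.measurable)
  have h3 : Measurable fun x : Fin d → α => f (x ∘ ⇑σ ∘ e) * finiteCorr ψ x :=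
    (hf.comp (measurable_pi_lambda _ fun i => measurable_pi_apply _)).mul
      (measurable_finiteCorr hψ.measurable)
  rw [← h1.lintegral_comp h3]
  refine lintegral_congr fun x => ?_
  have h4 : ((MeasurableEquiv.piCongrLeft (fun _ => α) σ) x) ∘ σ = x := by
    ext i
    simp [MeasurableEquiv.coe_piCongrLeft]
  rw [← Function.comp_assoc, h4]
  congr 1
  conv_rhs => rw [← finiteCorr_comp_perm _ σ, h4]

lemma map_comp_finiteLaw (hψ : IsOrthonormalFamily μ ψ) {n : ℕ} {e : Fin n → Fin d}
    (he : Function.Injective e) :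
    (finiteLaw μ ψ).map (fun x => x ∘ e) =
      ((d - n)! / d ! : ℝ≥0∞) • (Measure.pi fun _ => μ).withDensity (finiteCorr ψ) := by
  have hm : Measurable fun x : Fin d → α => x ∘ e :=
    measurable_pi_lambda _ fun i => measurable_pi_apply _
  ext s hs
  have h := lintegral_comp_finiteCorr hψ he (measurable_one.indicator hs)
  rw [Measure.map_apply hm hs, finiteLaw, Measure.smul_apply, Measure.smul_apply,
    withDensity_apply _ hs, withDensity_apply _ (hm hs), ← lintegral_indicator hs,
    ← lintegral_indicator (hm hs)]
  have h1 : ∀ x : Fin n → α, s.indicator 1 x * finiteCorr ψ x = s.indicator (finiteCorr ψ) x :=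
    fun x => by by_cases hx : x ∈ s <;> simp [hx]
  have h2 : ∀ x : Fin d → α, s.indicator 1 (x ∘ e) * finiteCorr ψ x =
      ((fun x => x ∘ e) ⁻¹' s).indicator (finiteCorr ψ) x :=
    fun x => by by_cases hx : x ∘ e ∈ s <;> simp [hx]
  simp only [h1, h2] at h
  rw [h, smul_eq_mul, smul_eq_mul, ← mul_assoc, div_eq_mul_inv, mul_comm (((d - n)! : ℕ) : ℝ≥0∞)]

/-- The `n`-th correlation measure of the finite process has density `finiteCorr ψ`. -/
lemma sum_map_finiteLaw (hψ : IsOrthonormalFamily μ ψ) (n : ℕ) :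
    ∑ e : Fin n ↪ Fin d, (finiteLaw μ ψ).map (fun x => x ∘ e) =
      (Measure.pi fun _ => μ).withDensity (finiteCorr ψ) := by
  simp only [fun e : Fin n ↪ Fin d => map_comp_finiteLaw hψ e.injective, Finset.sum_const,
    Finset.card_univ, Fintype.card_embedding_eq, Fintype.card_fin]
  rcases le_or_gt n d with hn | hn
  -- There are d!/(d - n)! injections, and each contributes (d - n)!/d! times the correlation
  -- measure.
  · rw [← Nat.cast_smul_eq_nsmul ℝ≥0∞, smul_smul]
    have h1 : ((d.descFactorial n : ℕ) : ℝ≥0∞) * (((d - n)! : ℕ) / (d ! : ℕ)) = 1 := by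
      rw [← mul_div_assoc, ← Nat.cast_mul, mul_comm, Nat.factorial_mul_descFactorial hn]
      exact ENNReal.div_self (by exact_mod_cast (Nat.factorial_ne_zero d))
        (ENNReal.natCast_ne_top _)
    rw [h1, one_smul]
  -- With more points than the rank, there are no injections and the determinant vanishes.
  · rw [Nat.descFactorial_of_lt hn, zero_smul]
    have : (finiteCorr ψ : (Fin n → α) → ℝ≥0∞) = 0 := by
      ext x
      simp [finiteCorr, kernelDet_finiteKernel_eq_zero ψ hn]
    rw [this, withDensity_zero]

lemma isProbabilityMeasure_finiteLaw (hψ : IsOrthonormalFamily μ ψ) :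
    IsProbabilityMeasure (finiteLaw μ ψ) := by
  -- For n = 0 there is one empty tuple and the empty determinant is 1, so this case reads off the
  -- total mass.
  have h := sum_map_finiteLaw hψ 0
  have h2 := congrArg (fun m : Measure (Fin 0 → α) => m univ) h
  have h3 : Measurable fun x : Fin d → α => (fun i : Fin 0 => x (i.elim0)) :=
    measurable_pi_lambda _ fun i => i.elim0
  have h4 : ∀ e : Fin 0 ↪ Fin d, (finiteLaw μ ψ).map (fun x => x ∘ e) univ =
      finiteLaw μ ψ univ := fun e => by
    rw [Measure.map_apply (measurable_pi_lambda _ fun i => i.elim0) MeasurableSet.univ,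
      preimage_univ]
  constructor
  simp only [Measure.finsetSum_apply, h4] at h2
  simpa [finiteCorr, kernelDet, Measure.pi_of_empty] using h2

end FiniteLaw

end

noncomputable section

/-! ### Operations on configurations -/

section ConfBasics

variable {E : Type*} [TopologicalSpace E] [MeasurableSpace E]

lemma isConfiguration_finset_sum {ι : Type} (x : ι → E) (S : Finset ι) :
    IsConfiguration (∑ i ∈ S, Measure.dirac (x i)) := by
  refine ⟨⟨S, inferInstance, fun i => x i, ?_⟩, fun K _ => ?_⟩
  · rw [Measure.sum_fintype, Finset.sum_coe_sort S fun i => Measure.dirac (x i)]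
  · rw [Measure.finsetSum_apply]
    exact ENNReal.sum_lt_top.2 fun i _ => measure_lt_top _ _

/-- The configuration made up of the points `x i`, `i ∈ S`. -/
def Conf.ofFinset {ι : Type} (x : ι → E) (S : Finset ι) : Conf E :=
  ⟨∑ i ∈ S, Measure.dirac (x i), isConfiguration_finset_sum x S⟩

lemma IsConfiguration.restrict {X : Measure E} (hX : IsConfiguration X) {W : Set E}
    (hW : MeasurableSet W) : IsConfiguration (X.restrict W) := by
  classical
  obtain ⟨⟨ι, hι, x, rfl⟩, hc⟩ := hX
  refine ⟨⟨{i // x i ∈ W}, inferInstance, fun i => x i, ?_⟩, fun K hK =>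
    (Measure.restrict_apply_le _ _).trans_lt (hc K hK)⟩
  rw [Measure.restrict_sum _ hW]
  ext s hs
  rw [Measure.sum_apply _ hs, Measure.sum_apply _ hs]
  have h : ∀ i, (Measure.dirac (x i)).restrict W s =
      {i | x i ∈ W}.indicator (fun i => Measure.dirac (x i) s) i := by
    intro i
    rw [restrict_dirac' hW]
    by_cases hi : x i ∈ W <;> simp [hi]
  simp only [h]
  exact (tsum_subtype {i | x i ∈ W} fun i => Measure.dirac (x i) s).symm

/-- The restriction of a configuration to a measurable set. -/
def Conf.restrict (W : Set E) (hW : MeasurableSet W) (X : Conf E) : Conf E :=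
  ⟨X.1.restrict W, X.2.restrict hW⟩

lemma Conf.measurable_iff {Ω : Type*} [MeasurableSpace Ω] {f : Ω → Conf E} :
    Measurable f ↔ ∀ s, MeasurableSet s → Measurable fun ω => (f ω).1 s := by
  refine ⟨fun h s hs => (Measure.measurable_coe hs).comp (measurable_subtype_coe.comp h),
    fun h => Measurable.subtype_mk (Measure.measurable_of_measurable_coe _ h)⟩

lemma Conf.measurable_apply {s : Set E} (hs : MeasurableSet s) :
    Measurable fun X : Conf E => X.1 s :=
  (Measure.measurable_coe hs).comp measurable_subtype_coe

lemma Conf.measurable_restrict {W : Set E} (hW : MeasurableSet W) :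
    Measurable (Conf.restrict W hW) := by
  refine Conf.measurable_iff.2 fun s hs => ?_
  simp only [Conf.restrict, Measure.restrict_apply hs]
  exact Conf.measurable_apply (hs.inter hW)

lemma Conf.measurable_ofFinset {ι : Type} (S : Finset ι) :
    Measurable fun x : ι → E => Conf.ofFinset x S := by
  refine Conf.measurable_iff.2 fun s hs => ?_
  simp only [Conf.ofFinset, Measure.finsetSum_apply, Measure.dirac_apply' _ hs]
  exact Finset.measurable_sum _ fun i _ =>
    (measurable_one.indicator hs).comp (measurable_pi_apply i)

open Classical in
lemma Conf.restrict_ofFinset {ι : Type} (x : ι → E) (S : Finset ι) {W : Set E}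
    (hW : MeasurableSet W) :
    Conf.restrict W hW (Conf.ofFinset x S) = Conf.ofFinset x (S.filter fun i => x i ∈ W) := by
  refine Subtype.ext (Measure.ext fun s hs => ?_)
  simp only [Conf.restrict, Conf.ofFinset, Measure.restrict_apply hs, Measure.finsetSum_apply,
    Finset.sum_filter]
  refine Finset.sum_congr rfl fun i _ => ?_
  rw [Measure.dirac_apply' _ (hs.inter hW)]
  by_cases h1 : x i ∈ W <;> by_cases h2 : x i ∈ s <;>
    simp [h1, h2, Measure.dirac_apply' _ hs]

lemma Conf.ofFinset_map {ι κ : Type} (x : ι → E) (e : κ ↪ ι) (S : Finset κ) :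
    Conf.ofFinset x (S.map e) = Conf.ofFinset (x ∘ e) S := by
  simp [Conf.ofFinset]

end ConfBasics

/-! ### Inclusion-exclusion for functions of configurations -/

section Inversion

open scoped Nat

/-- Möbius inversion over the finite subsets of a finite type. -/
lemma sum_powerset_sum_powerset_neg_one {ι : Type*} [DecidableEq ι] (f : Finset ι → ℝ)
    (U : Finset ι) :
    ∑ S ∈ U.powerset, ∑ T ∈ S.powerset, (-1 : ℝ) ^ (S.card - T.card) * f T = f U := by
  rw [Finset.sum_sigma' U.powerset (fun S => S.powerset)
    (fun S T => (-1 : ℝ) ^ (S.card - T.card) * f T)]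
  have h1 : ∑ p ∈ U.powerset.sigma (fun S => S.powerset),
      (-1 : ℝ) ^ (p.1.card - p.2.card) * f p.2 =
      ∑ p ∈ U.powerset.sigma (fun T => (U \ T).powerset), (-1 : ℝ) ^ p.2.card * f p.1 := by
    refine Finset.sum_bij' (fun p _ => ⟨p.2, p.1 \ p.2⟩) (fun p _ => ⟨p.1 ∪ p.2, p.1⟩) ?_ ?_ ?_ ?_ ?_
    · rintro ⟨S, T⟩ h
      simp only [Finset.mem_sigma, Finset.mem_powerset] at h ⊢
      exact ⟨h.2.trans h.1, Finset.sdiff_subset_sdiff h.1 le_rfl⟩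
    · rintro ⟨T, D⟩ h
      simp only [Finset.mem_sigma, Finset.mem_powerset] at h ⊢
      exact ⟨Finset.union_subset h.1 (h.2.trans Finset.sdiff_subset), Finset.subset_union_left⟩
    · rintro ⟨S, T⟩ h
      simp only [Finset.mem_sigma, Finset.mem_powerset] at h
      simp [Finset.union_sdiff_of_subset h.2]
    · rintro ⟨T, D⟩ h
      simp only [Finset.mem_sigma, Finset.mem_powerset] at h
      have : (T ∪ D) \ T = D := by
        rw [Finset.union_sdiff_left, Finset.sdiff_eq_self_iff_disjoint]
        exact Finset.disjoint_of_subset_left h.2 Finset.sdiff_disjoint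
      simp [this]
    · rintro ⟨S, T⟩ h
      simp only [Finset.mem_sigma, Finset.mem_powerset] at h
      simp [Finset.card_sdiff_of_subset h.2]
  rw [h1, Finset.sum_sigma, Finset.sum_eq_single U]
  · simp
  · intro T hT hne
    rw [Finset.mem_powerset] at hT
    dsimp only
    rw [← Finset.sum_mul]
    have hne' : (U \ T).Nonempty := Finset.sdiff_nonempty.2 fun h => hne (hT.antisymm h)
    have h2 := Finset.sum_powerset_neg_one_pow_card_of_nonempty hne'
    have h3 : ∑ m ∈ (U \ T).powerset, (-1 : ℝ) ^ m.card = 0 := by exact_mod_cast h2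
    rw [h3, zero_mul]
  · simp

open Classical in
lemma card_embedding_map_eq {ι : Type*} {n : ℕ} (S : Finset ι) (hS : S.card = n)
    [Fintype (Fin n ↪ ι)] :
    (Finset.univ.filter fun e : Fin n ↪ ι => Finset.univ.map e = S).card = n ! := by
  have h1 : Fintype.card (Fin n ≃ S) = n ! := by
    rw [Fintype.card_equiv (Fintype.equivOfCardEq (by simp [hS]))]
    simp
  rw [← h1, ← Finset.card_univ]
  symm
  refine Finset.card_bij (fun e _ => e.toEmbedding.trans (Function.Embedding.subtype _)) ?_ ?_ ?_
  · intro e _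
    rw [Finset.mem_filter]
    refine ⟨Finset.mem_univ _, ?_⟩
    ext i
    simp only [Finset.mem_map, Finset.mem_univ, true_and]
    constructor
    · rintro ⟨a, rfl⟩
      exact (e a).2
    · intro hi
      exact ⟨e.symm ⟨i, hi⟩, by simp⟩
  · intro e _ e' _ h
    ext a
    have := congrArg (fun f => f a) h
    simpa using this
  · intro e he
    rw [Finset.mem_filter] at he
    have hmem : ∀ a, e a ∈ S := fun a => he.2 ▸ Finset.mem_map_of_mem e (Finset.mem_univ a)
    have hinj : Function.Injective fun a => (⟨e a, hmem a⟩ : S) := fun a b h =>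
      e.injective (congrArg Subtype.val h)
    refine ⟨Equiv.ofBijective (fun a => (⟨e a, hmem a⟩ : S))
      ((Fintype.bijective_iff_injective_and_card _).2 ⟨hinj, by simp [hS]⟩), Finset.mem_univ _, ?_⟩
    ext a
    simp

/-- An n-element subset is the image of exactly n! embeddings. -/
lemma sum_finset_eq_sum_embedding {d : ℕ} (g : Finset (Fin d) → ℝ) :
    ∑ S, g S = ∑ n ∈ Finset.range (d + 1), (n ! : ℝ)⁻¹ *
      ∑ e : Fin n ↪ Fin d, g (Finset.univ.map e) := by
  classical
  have h1 : ∀ n, ∑ e : Fin n ↪ Fin d, g (Finset.univ.map e) =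
      n ! * ∑ S with S.card = n, g S := by
    intro n
    rw [← Finset.sum_fiberwise (s := Finset.univ) (g := fun e : Fin n ↪ Fin d =>
      Finset.univ.map e), Finset.sum_filter, Finset.mul_sum]
    refine Finset.sum_congr rfl fun S _ => ?_
    split_ifs with hS
    · rw [Finset.sum_congr rfl (g := fun _ => g S) fun e he => by
        rw [(Finset.mem_filter.1 he).2], Finset.sum_const, nsmul_eq_mul]
      congr 2
      convert card_embedding_map_eq S hS
    · rw [mul_zero, Finset.sum_eq_zero]
      intro e he
      exact absurd (by rw [← (Finset.mem_filter.1 he).2]; simp) hS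
  have h2 : ∀ n : ℕ, ((n ! : ℕ) : ℝ)⁻¹ * ((n ! : ℕ) * ∑ S : Finset (Fin d) with S.card = n, g S) =
      ∑ S with S.card = n, g S := fun n => by
    rw [← mul_assoc, inv_mul_cancel₀ (by exact_mod_cast Nat.factorial_ne_zero n), one_mul]
  simp only [h1, h2]
  rw [Finset.sum_fiberwise_of_maps_to]
  intro S _
  have := Finset.card_le_univ S
  simp only [Fintype.card_fin] at this
  simpa using Nat.lt_succ_of_le this

variable {E : Type*} [TopologicalSpace E] [MeasurableSpace E]

/-- The inclusion-exclusion transform of a function on configurations. -/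
def mobius (F : Conf E → ℝ) {n : ℕ} (x : Fin n → E) : ℝ :=
  ∑ T : Finset (Fin n), (-1) ^ (n - T.card) * F (Conf.ofFinset x T)

lemma abs_mobius_le {F : Conf E → ℝ} (hF : ∀ X, |F X| ≤ 1) {n : ℕ} (x : Fin n → E) :
    |mobius F x| ≤ 2 ^ n := by
  refine (Finset.abs_sum_le_sum_abs _ _).trans ?_
  calc _ ≤ ∑ _T : Finset (Fin n), (1 : ℝ) := Finset.sum_le_sum fun T _ => by
        rw [abs_mul, abs_pow, abs_neg, abs_one, one_pow, one_mul]
        exact hF _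
    _ = 2 ^ n := by simp

lemma measurable_mobius {F : Conf E → ℝ} (hF : Measurable F) (n : ℕ) :
    Measurable fun x : Fin n → E => mobius F x :=
  Finset.measurable_sum _ fun T _ => (hF.comp (Conf.measurable_ofFinset T)).const_mul _

/-- A function of the restriction of a finite configuration as a sum over tuples of points. -/
lemma apply_restrict_ofFinset (F : Conf E → ℝ) {d : ℕ} (x : Fin d → E) {W : Set E}
    (hW : MeasurableSet W) :
    F (Conf.restrict W hW (Conf.ofFinset x Finset.univ)) =
      ∑ n ∈ Finset.range (d + 1), (n ! : ℝ)⁻¹ * ∑ e : Fin n ↪ Fin d,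
        (Set.univ.pi fun _ => W).indicator (mobius F) (x ∘ e) := by
  classical
  -- Möbius inversion on the set of labels whose points lie in `W`. The transform of a label set S
  -- contributes exactly when all its points lie in `W`, which is the indicator in the statement.
  rw [Conf.restrict_ofFinset, ← sum_powerset_sum_powerset_neg_one
    (fun S => F (Conf.ofFinset x S))]
  have h1 : ∀ n, ∀ e : Fin n ↪ Fin d, (Set.univ.pi fun _ => W).indicator (mobius F) (x ∘ e) =
      if Finset.univ.map e ⊆ Finset.univ.filter (fun i => x i ∈ W) then
        ∑ T ∈ (Finset.univ.map e).powerset, (-1 : ℝ) ^ ((Finset.univ.map e).card - T.card) *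
          F (Conf.ofFinset x T) else 0 := by
    intro n e
    have hiff : x ∘ e ∈ (Set.univ.pi fun _ => W) ↔
        Finset.univ.map e ⊆ Finset.univ.filter (fun i => x i ∈ W) := by
      simp [Finset.subset_iff, Set.mem_pi]
    by_cases h : Finset.univ.map e ⊆ Finset.univ.filter (fun i => x i ∈ W)
    · rw [Set.indicator_of_mem (hiff.2 h), if_pos h, mobius]
      refine Finset.sum_bij (fun T _ => T.map e) (fun T _ => ?_) (fun T _ T' _ h => ?_)
        (fun T hT => ?_) (fun T _ => by simp [Conf.ofFinset_map])
      · exact Finset.mem_powerset.2 (Finset.map_subset_map.2 (Finset.subset_univ T))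
      · exact Finset.map_injective e h
      · obtain ⟨u, _, hu⟩ := Finset.subset_map_iff.1 (Finset.mem_powerset.1 hT)
        exact ⟨u, Finset.mem_univ u, hu.symm⟩
    · rw [Set.indicator_of_notMem (mt hiff.1 h), if_neg h]
  simp only [h1]
  rw [← sum_finset_eq_sum_embedding (fun S => if S ⊆ Finset.univ.filter (fun i => x i ∈ W) then
        ∑ T ∈ S.powerset, (-1 : ℝ) ^ (S.card - T.card) * F (Conf.ofFinset x T) else 0),
    ← Finset.sum_filter]
  refine Finset.sum_congr ?_ fun _ _ => rfl
  ext S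
  simp

end Inversion

end

noncomputable section

/-! ### Convergence of the restricted laws in total variation -/

section TotalVariation

open scoped Nat Topology
open Filter

variable {E : Type*} [TopologicalSpace E] [MeasurableSpace E] {μ : Measure E} [SigmaFinite μ]

lemma integral_sum_embedding_finiteLaw {E : Type*} [MeasurableSpace E] {μ : Measure E}
    [SigmaFinite μ] {d : ℕ} {ψ : Fin d → E → ℂ}
    (hψ : IsOrthonormalFamily μ ψ) {n : ℕ} {G : Type*} [NormedAddCommGroup G] [NormedSpace ℝ G]
    {H : (Fin n → E) → G}
    (hm : StronglyMeasurable H) {c : ℝ} (hc : ∀ x, ‖H x‖ ≤ c) :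
    ∫ x, ∑ e : Fin n ↪ Fin d, H (x ∘ e) ∂(finiteLaw μ ψ) =
      ∫ x, (kernelDet (finiteKernel ψ) x).re • H x ∂(Measure.pi fun _ => μ) := by
  have := isProbabilityMeasure_finiteLaw hψ
  have hme : ∀ e : Fin n ↪ Fin d, Measurable fun x : Fin d → E => x ∘ e := fun e =>
    measurable_pi_lambda _ fun i => measurable_pi_apply _
  have hint : ∀ e : Fin n ↪ Fin d, Integrable H ((finiteLaw μ ψ).map fun x => x ∘ e) := fun e => by
    have := Measure.isProbabilityMeasure_map (μ := finiteLaw μ ψ) (hme e).aemeasurable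
    exact Integrable.of_bound hm.aestronglyMeasurable c (ae_of_all _ hc)
  rw [integral_finsetSum]
  · have h1 : ∀ e : Fin n ↪ Fin d, ∫ x, H (x ∘ e) ∂(finiteLaw μ ψ) =
        ∫ x, H x ∂((finiteLaw μ ψ).map fun x => x ∘ e) := fun e =>
      (integral_map (hme e).aemeasurable hm.aestronglyMeasurable).symm
    simp only [h1]
    rw [← integral_finsetSum_measure fun e _ => hint e, sum_map_finiteLaw hψ,
      integral_withDensity_eq_integral_toReal_smul (measurable_finiteCorr hψ.measurable)
        (ae_of_all _ fun x => ENNReal.ofReal_lt_top)]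
    refine integral_congr_ae (ae_of_all _ fun x => ?_)
    dsimp only
    rw [finiteCorr, ENNReal.toReal_ofReal (Complex.le_def.1 (kernelDet_finiteKernel_nonneg ψ x)).1]
  · exact fun e _ => (hint e).comp_measurable (hme e)

/-- The expectation of `F(X|_W)` expressed by the correlation functions `ρ`. -/
def corrSeries (μ : Measure E) (W : Set E) (ρ : ∀ n : ℕ, (Fin n → E) → ℝ) (F : Conf E → ℝ) : ℝ :=
  ∑' n : ℕ, (n ! : ℝ)⁻¹ * ∫ x in univ.pi fun _ => W, ρ n x * mobius F x ∂(Measure.pi fun _ => μ)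

/-- The expectation of `apply_restrict_ofFinset`: sums over tuples of distinct labels become
integrals against the correlation functions. This is how the correlations determine the law on `W`.
-/
lemma integral_apply_restrict_finiteLaw {d : ℕ} {ψ : Fin d → E → ℂ}
    (hψ : IsOrthonormalFamily μ ψ) {W : Set E} (hW : MeasurableSet W) {F : Conf E → ℝ}
    (hF : Measurable F) (hF1 : ∀ X, |F X| ≤ 1) :
    ∫ x, F (Conf.restrict W hW (Conf.ofFinset x Finset.univ)) ∂(finiteLaw μ ψ) =
      corrSeries μ W (fun _ x => (kernelDet (finiteKernel ψ) x).re) F := by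
  have := isProbabilityMeasure_finiteLaw hψ
  have hWn : ∀ n : ℕ, MeasurableSet (univ.pi fun _ : Fin n => W) := fun n =>
    MeasurableSet.univ_pi fun _ => hW
  have hH : ∀ n : ℕ, Measurable ((univ.pi fun _ : Fin n => W).indicator (mobius F)) := fun n =>
    (measurable_mobius hF n).indicator (hWn n)
  have hHb : ∀ n : ℕ, ∀ x, ‖(univ.pi fun _ : Fin n => W).indicator (mobius F) x‖ ≤ 2 ^ n :=
    fun n x => (norm_indicator_le_norm_self _ _).trans (abs_mobius_le hF1 x)
  simp only [apply_restrict_ofFinset F _ hW]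
  rw [integral_finsetSum, corrSeries, tsum_eq_sum (s := Finset.range (d + 1))]
  · refine Finset.sum_congr rfl fun n _ => ?_
    rw [integral_const_mul, integral_sum_embedding_finiteLaw hψ (hH n).stronglyMeasurable (hHb n),
      ← integral_indicator (hWn n)]
    congr 1
    refine integral_congr_ae (ae_of_all _ fun x => ?_)
    by_cases hx : x ∈ univ.pi fun _ : Fin n => W
    · simp only [indicator_of_mem hx, smul_eq_mul]
    · simp only [indicator_of_notMem hx, smul_zero]
  -- The series stops at n = d, since the determinants vanish beyond the rank.
  · intro n hn
    have : d < n := by simpa using hn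
    simp [kernelDet_finiteKernel_eq_zero ψ this]
  · intro n _
    refine (integrable_finsetSum _ fun e _ => ?_).const_mul _
    exact Integrable.of_bound ((hH n).comp
      (measurable_pi_lambda _ fun i => measurable_pi_apply _)).aestronglyMeasurable _
      (ae_of_all _ fun x => hHb n _)

variable {W : Set E}

/-- An upper bound of the total variation distance between two laws on the configurations in `W`
in terms of their correlation functions. -/
def corrDist (μ : Measure E) (W : Set E) (ρ ρ' : ∀ n : ℕ, (Fin n → E) → ℝ) : ℝ :=
  ∑' n : ℕ, (n ! : ℝ)⁻¹ * (2 ^ n *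
    ∫ x in univ.pi fun _ => W, |ρ n x - ρ' n x| ∂(Measure.pi fun _ => μ))

lemma pi_real_univ_pi {E : Type*} [MeasurableSpace E] {μ : Measure E} [SigmaFinite μ]
    {W : Set E} (hWf : μ W ≠ ∞) (n : ℕ) :
    (Measure.pi fun _ : Fin n => μ) (univ.pi fun _ => W) ≠ ∞ ∧
    (Measure.pi fun _ : Fin n => μ).real (univ.pi fun _ => W) = μ.real W ^ n := by
  simp only [Measure.real, Measure.pi_pi, Finset.prod_const, Finset.card_univ, Fintype.card_fin,
    ENNReal.toReal_pow, and_true]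
  exact ENNReal.pow_ne_top hWf

lemma summable_corr_bound (a b : ℝ) :
    Summable fun n : ℕ => (n ! : ℝ)⁻¹ * (2 ^ n * (a * b ^ n)) := by
  have := (Real.summable_pow_div_factorial (2 * b)).mul_left a
  refine this.congr fun n => ?_
  rw [mul_pow]
  ring

lemma norm_setIntegral_corr_le {E : Type*} [MeasurableSpace E] {μ : Measure E} [SigmaFinite μ]
    {W : Set E} (hWf : μ W ≠ ∞) {n : ℕ} {f : (Fin n → E) → ℝ} {c : ℝ} (hf : ∀ x, |f x| ≤ c) :
    ‖∫ x in univ.pi fun _ => W, f x ∂(Measure.pi fun _ => μ)‖ ≤ c * μ.real W ^ n := by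
  rw [← (pi_real_univ_pi hWf n).2]
  exact norm_setIntegral_le_of_norm_le_const (pi_real_univ_pi hWf n).1.lt_top fun x _ => hf x

/-- The transform of any F with |F| ≤ 1 is bounded by 2^n, so the bound does not depend on F; taking
F to be an indicator makes it a total variation bound. -/
lemma abs_corrSeries_sub_le (hWf : μ W ≠ ∞) {ρ ρ' : ∀ n : ℕ, (Fin n → E) → ℝ}
    (hρm : ∀ n, Measurable (ρ n)) (hρ : ∀ n x, |ρ n x| ≤ 1)
    (hρm' : ∀ n, Measurable (ρ' n)) (hρ' : ∀ n x, |ρ' n x| ≤ 1) {F : Conf E → ℝ}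
    (hF : Measurable F) (hF1 : ∀ X, |F X| ≤ 1) :
    |corrSeries μ W ρ F - corrSeries μ W ρ' F| ≤ corrDist μ W ρ ρ' := by
  have hb : ∀ {ρ : ∀ n : ℕ, (Fin n → E) → ℝ}, (∀ n x, |ρ n x| ≤ 1) → ∀ n x,
      |ρ n x * mobius F x| ≤ 2 ^ n := fun h n x => by
    rw [abs_mul]
    exact (mul_le_of_le_one_left (abs_nonneg _) (h n x)).trans (abs_mobius_le hF1 x)
  have hint : ∀ {ρ : ∀ n : ℕ, (Fin n → E) → ℝ}, (∀ n, Measurable (ρ n)) →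
      (∀ n x, |ρ n x| ≤ 1) → ∀ n, IntegrableOn (fun x => ρ n x * mobius F x)
        (univ.pi fun _ => W) (Measure.pi fun _ => μ) := fun hm h n =>
    IntegrableOn.of_bound (pi_real_univ_pi hWf n).1.lt_top
      ((hm n).mul (measurable_mobius hF n)).aestronglyMeasurable _ (ae_of_all _ (hb h n))
  have hsum : ∀ {ρ : ∀ n : ℕ, (Fin n → E) → ℝ}, (∀ n x, |ρ n x| ≤ 1) → Summable fun n : ℕ =>
      (n ! : ℝ)⁻¹ * ∫ x in univ.pi fun _ => W, ρ n x * mobius F x ∂(Measure.pi fun _ => μ) := by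
    intro ρ h
    refine Summable.of_norm_bounded (summable_corr_bound 1 (μ.real W)) fun n => ?_
    rw [norm_mul, Real.norm_of_nonneg (by positivity), one_mul]
    exact mul_le_mul_of_nonneg_left (norm_setIntegral_corr_le hWf (hb h n)) (by positivity)
  have hdiff : Summable fun n : ℕ => (n ! : ℝ)⁻¹ * (2 ^ n *
      ∫ x in univ.pi fun _ => W, |ρ n x - ρ' n x| ∂(Measure.pi fun _ => μ)) := by
    refine Summable.of_norm_bounded (summable_corr_bound 2 (μ.real W)) fun n => ?_
    rw [norm_mul, norm_mul, Real.norm_of_nonneg (by positivity), Real.norm_of_nonneg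
      (show (0 : ℝ) ≤ 2 ^ n by positivity)]
    refine mul_le_mul_of_nonneg_left (mul_le_mul_of_nonneg_left
      (norm_setIntegral_corr_le hWf fun x => ?_) (by positivity)) (by positivity)
    rw [abs_abs]
    exact (abs_sub _ _).trans (by linarith [hρ n x, hρ' n x])
  rw [corrSeries, corrSeries, ← (hsum hρ).tsum_sub (hsum hρ'), ← Real.norm_eq_abs]
  refine tsum_of_norm_bounded hdiff.hasSum fun n => ?_
  rw [← mul_sub, ← integral_sub (hint hρm hρ n) (hint hρm' hρ' n), norm_mul,
    Real.norm_of_nonneg (by positivity), ← integral_const_mul]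
  refine mul_le_mul_of_nonneg_left ((norm_integral_le_integral_norm _).trans
    (integral_mono_of_nonneg (ae_of_all _ fun x => norm_nonneg _) ?_ (ae_of_all _ fun x => ?_)))
    (by positivity)
  · refine Integrable.const_mul ?_ _
    refine IntegrableOn.of_bound (pi_real_univ_pi hWf n).1.lt_top
      ((hρm n).sub (hρm' n)).abs.aestronglyMeasurable 2 (ae_of_all _ fun x => ?_)
    rw [Real.norm_eq_abs, abs_abs]
    exact (abs_sub _ _).trans (by linarith [hρ n x, hρ' n x])
  · dsimp only
    rw [← sub_mul, norm_mul, mul_comm, Real.norm_eq_abs, Real.norm_eq_abs]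
    exact mul_le_mul_of_nonneg_right (abs_mobius_le hF1 x) (abs_nonneg _)

/-- Dominated convergence twice: in each integral with the constant 2 on a set of finite measure,
and in the series with the summable terms 2 (2 μ(W))^n / n!. -/
lemma tendsto_corrDist {E : Type*} [MeasurableSpace E] {μ : Measure E} [SigmaFinite μ]
    {W : Set E} {ρ : ℕ → ∀ n : ℕ, (Fin n → E) → ℝ} {ρ' : ∀ n : ℕ, (Fin n → E) → ℝ}
    (hWf : μ W ≠ ∞) (hρm : ∀ N n, Measurable (ρ N n))
    (hρ : ∀ N n x, |ρ N n x| ≤ 1) (hρm' : ∀ n, Measurable (ρ' n)) (hρ' : ∀ n x, |ρ' n x| ≤ 1)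
    (hlim : ∀ n x, Tendsto (fun N => ρ N n x) atTop (𝓝 (ρ' n x))) :
    Tendsto (fun N => corrDist μ W (ρ N) ρ') atTop (𝓝 0) := by
  have hb : ∀ N n x, |(|ρ N n x - ρ' n x|)| ≤ 2 := fun N n x => by
    rw [abs_abs]
    exact (abs_sub _ _).trans (by linarith [hρ N n x, hρ' n x])
  have h0 : (0 : ℝ) = ∑' _ : ℕ, 0 := by simp
  rw [h0]
  refine tendsto_tsum_of_dominated_convergence (summable_corr_bound 2 (μ.real W)) (fun n => ?_)
    (Eventually.of_forall fun N n => ?_)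
  · have h1 : Tendsto (fun N => ∫ x in univ.pi fun _ => W, |ρ N n x - ρ' n x|
        ∂(Measure.pi fun _ => μ)) atTop (𝓝 (∫ x in univ.pi fun _ => W, (0 : ℝ)
        ∂(Measure.pi fun _ : Fin n => μ))) := by
      refine tendsto_integral_of_dominated_convergence (fun _ => 2)
        (fun N => ((hρm N n).sub (hρm' n)).abs.aestronglyMeasurable)
        (integrableOn_const (pi_real_univ_pi hWf n).1) (fun N => ae_of_all _ fun x => hb N n x)
        (ae_of_all _ fun x => ?_)
      have := ((hlim n x).sub_const (ρ' n x)).abs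
      simpa using this
    have h2 := (h1.const_mul (2 ^ n : ℝ)).const_mul (n ! : ℝ)⁻¹
    simpa using h2
  · rw [norm_mul, norm_mul, Real.norm_of_nonneg (by positivity), Real.norm_of_nonneg
      (show (0 : ℝ) ≤ 2 ^ n by positivity)]
    exact mul_le_mul_of_nonneg_left (mul_le_mul_of_nonneg_left
      (norm_setIntegral_corr_le hWf (hb N n)) (by positivity)) (by positivity)

end TotalVariation

end

noncomputable section

/-! ### Limits in total variation -/

section TotalVariationLimit

open scoped Topology
open Filter

variable {S : Type*} [MeasurableSpace S]

/-- Split according to the sign of the difference of the densities; each half contributes at most c.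
-/
lemma integral_abs_sub_rnDeriv_le {P P' Q : Measure S} [IsFiniteMeasure P] [IsFiniteMeasure P']
    [IsFiniteMeasure Q] (hP : P ≪ Q) (hP' : P' ≪ Q) {c : ℝ}
    (h : ∀ A, MeasurableSet A → |P.real A - P'.real A| ≤ c) :
    ∫ x, |(P.rnDeriv Q x).toReal - (P'.rnDeriv Q x).toReal| ∂Q ≤ 2 * c := by
  set f := fun x => (P.rnDeriv Q x).toReal - (P'.rnDeriv Q x).toReal with hf
  have hi : Integrable f Q :=
    Measure.integrable_toReal_rnDeriv.sub Measure.integrable_toReal_rnDeriv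
  have hfm : Measurable f := (Measure.measurable_rnDeriv _ _).ennreal_toReal.sub
    (Measure.measurable_rnDeriv _ _).ennreal_toReal
  have hA : MeasurableSet {x | 0 ≤ f x} := measurableSet_le measurable_const hfm
  have hset : ∀ A, MeasurableSet A → |∫ x in A, f x ∂Q| ≤ c := by
    intro A hA
    rw [hf, integral_sub Measure.integrable_toReal_rnDeriv.integrableOn
      Measure.integrable_toReal_rnDeriv.integrableOn, Measure.setIntegral_toReal_rnDeriv hP,
      Measure.setIntegral_toReal_rnDeriv hP']
    exact h A hA
  rw [← integral_add_compl hA hi.abs]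
  have h1 : ∫ x in {x | 0 ≤ f x}, |f x| ∂Q = ∫ x in {x | 0 ≤ f x}, f x ∂Q :=
    setIntegral_congr_fun hA fun x hx => abs_of_nonneg hx
  have h2 : ∫ x in {x | 0 ≤ f x}ᶜ, |f x| ∂Q = -∫ x in {x | 0 ≤ f x}ᶜ, f x ∂Q := by
    rw [← integral_neg]
    exact setIntegral_congr_fun hA.compl fun x hx => abs_of_neg (not_le.1 hx)
  rw [h1, h2]
  have h3 := hset _ hA
  have h4 := hset _ hA.compl
  rw [abs_le] at h3 h4
  linarith

/-- Densities with respect to a common dominating measure are Cauchy in L¹, and the limit is the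
density of ν. Absolute continuity with respect to the sum of the `P N` is recorded because it later
represents ν as an image of a measure on a standard Borel space. -/
theorem exists_limit_of_totalVariation {P : ℕ → Measure S} [∀ N, IsProbabilityMeasure (P N)]
    {δ : ℕ → ℝ} (hδ : Tendsto δ atTop (𝓝 0))
    (h : ∀ N M A, MeasurableSet A → |(P N).real A - (P M).real A| ≤ δ N + δ M) :
    ∃ ν : Measure S, IsProbabilityMeasure ν ∧ ν ≪ Measure.sum P ∧
      ∀ F : S → ℂ, Measurable F → (∃ c : ℝ, ∀ x, ‖F x‖ ≤ c) →
        Tendsto (fun N => ∫ x, F x ∂(P N)) atTop (𝓝 (∫ x, F x ∂ν)) := by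
  -- A finite measure with the same null sets as the sum, hence dominating every `P N`.
  set Q := (Measure.sum P).toFinite with hQ
  have hac : ∀ N, P N ≪ Q := fun N =>
    (Measure.absolutelyContinuous_of_le (Measure.le_sum P N)).trans
      (absolutelyContinuous_toFinite _)
  set f : ℕ → S → ℝ := fun N x => ((P N).rnDeriv Q x).toReal with hf
  have hfi : ∀ N, Integrable (f N) Q := fun N => Measure.integrable_toReal_rnDeriv
  have hdist : ∀ N M, dist ((hfi N).toL1 (f N)) ((hfi M).toL1 (f M)) ≤ 2 * (δ N + δ M) := by
    intro N M
    rw [dist_eq_norm, ← Integrable.toL1_sub, L1.norm_of_fun_eq_integral_norm]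
    exact integral_abs_sub_rnDeriv_le (hac N) (hac M) (h N M)
  have hcauchy : CauchySeq fun N => (hfi N).toL1 (f N) := by
    refine Metric.cauchySeq_iff.2 fun ε hε => ?_
    obtain ⟨N₀, hN₀⟩ := eventually_atTop.1 (hδ.eventually_lt_const (show 0 < ε / 4 by positivity))
    refine ⟨N₀, fun N hN M hM => (hdist N M).trans_lt ?_⟩
    linarith [hN₀ N hN, hN₀ M hM]
  obtain ⟨g, hg⟩ := cauchySeq_tendsto_of_complete hcauchy
  have hgi : Integrable g Q := L1.integrable_coeFn g
  have hL1 : Tendsto (fun N => ∫ x, |f N x - g x| ∂Q) atTop (𝓝 0) := by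
    have := tendsto_iff_dist_tendsto_zero.1 hg
    refine this.congr fun N => ?_
    rw [dist_eq_norm, L1.norm_eq_integral_norm]
    refine integral_congr_ae ?_
    filter_upwards [Lp.coeFn_sub ((hfi N).toL1 (f N)) g, (hfi N).coeFn_toL1] with x h1 h2
    rw [h1, Pi.sub_apply, h2, Real.norm_eq_abs]
  have hmul : ∀ {k : S → ℝ}, Integrable k Q → ∀ F : S → ℂ, Measurable F →
      (∃ c : ℝ, ∀ x, ‖F x‖ ≤ c) → Integrable (fun x => k x • F x) Q := by
    rintro k hk F hF ⟨c, hc⟩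
    have := hk.ofReal (𝕜 := ℂ)
    refine (this.mul_bdd hF.aestronglyMeasurable (ae_of_all _ hc)).congr
      (ae_of_all _ fun x => ?_)
    simp
  have hconv : ∀ F : S → ℂ, Measurable F → (∃ c : ℝ, ∀ x, ‖F x‖ ≤ c) →
      Tendsto (fun N => ∫ x, F x ∂(P N)) atTop (𝓝 (∫ x, g x • F x ∂Q)) := by
    rintro F hF ⟨c, hc⟩
    have h1 : ∀ N, ∫ x, F x ∂(P N) = ∫ x, f N x • F x ∂Q := fun N =>
      (integral_rnDeriv_smul (hac N)).symm
    simp only [h1]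
    refine tendsto_iff_norm_sub_tendsto_zero.2 (squeeze_zero (fun N => norm_nonneg _)
      (fun N => ?_) (by simpa using hL1.mul_const c))
    rw [← integral_sub (hmul (hfi N) F hF ⟨c, hc⟩) (hmul hgi F hF ⟨c, hc⟩), ← integral_mul_const]
    refine norm_integral_le_of_norm_le (((hfi N).sub hgi).abs.mul_const c)
      (ae_of_all _ fun x => ?_)
    rw [← sub_smul, norm_smul, Real.norm_eq_abs]
    exact mul_le_mul_of_nonneg_left (hc x) (abs_nonneg _)
  have hset : ∀ A, MeasurableSet A →
      Tendsto (fun N => (P N).real A) atTop (𝓝 (∫ x in A, g x ∂Q)) := by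
    intro A hA
    have h1 : ∀ N, (P N).real A = ∫ x in A, f N x ∂Q := fun N =>
      (Measure.setIntegral_toReal_rnDeriv (hac N) A).symm
    simp only [h1]
    refine tendsto_iff_norm_sub_tendsto_zero.2 (squeeze_zero (fun N => norm_nonneg _)
      (fun N => ?_) hL1)
    rw [← integral_sub (hfi N).integrableOn hgi.integrableOn]
    refine (norm_integral_le_integral_norm _).trans ?_
    exact setIntegral_le_integral ((hfi N).sub hgi).norm (ae_of_all _ fun x => norm_nonneg _)
  -- The integral of g over any measurable set is a limit of probabilities.
  have hg0 : 0 ≤ᵐ[Q] g := ae_nonneg_of_forall_setIntegral_nonneg hgi fun A hA _ =>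
    ge_of_tendsto' (hset A hA) fun N => measureReal_nonneg
  refine ⟨Q.withDensity fun x => ENNReal.ofReal (g x), ⟨?_⟩,
    (withDensity_absolutelyContinuous _ _).trans (toFinite_absolutelyContinuous _), ?_⟩
  · rw [withDensity_apply _ MeasurableSet.univ, Measure.restrict_univ,
      ← ofReal_integral_eq_lintegral_ofReal hgi hg0]
    have h1 := hset univ MeasurableSet.univ
    simp only [probReal_univ, Measure.restrict_univ] at h1
    rw [tendsto_nhds_unique h1 tendsto_const_nhds, ENNReal.ofReal_one]
  · intro F hF hc
    rw [integral_withDensity_eq_integral_toReal_smul₀ hgi.aemeasurable.ennreal_ofReal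
      (ae_of_all _ fun x => ENNReal.ofReal_lt_top)]
    convert hconv F hF hc using 2
    refine integral_congr_ae ?_
    filter_upwards [hg0] with x hx
    rw [ENNReal.toReal_ofReal hx]

/-- A measure which is absolutely continuous with respect to an image measure is an image
measure. -/
lemma exists_eq_map_of_absolutelyContinuous {Z : Type*} [MeasurableSpace Z] {m : Measure Z}
    [SFinite m] {g : Z → S} (hg : Measurable g) {ν : Measure S} [IsProbabilityMeasure ν]
    (h : ν ≪ m.map g) : ∃ l : Measure Z, IsProbabilityMeasure l ∧ ν = l.map g := by
  have h2 : ν ≪ m.toFinite.map g := h.trans ((absolutelyContinuous_toFinite m).map hg)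
  -- Pull the density of ν back along `g`.
  have h3 : (m.toFinite.withDensity fun z => ν.rnDeriv (m.toFinite.map g) (g z)).map g = ν := by
    conv_rhs => rw [← Measure.withDensity_rnDeriv_eq _ _ h2]
    ext s hs
    rw [Measure.map_apply hg hs, withDensity_apply _ (hg hs), withDensity_apply _ hs,
      setLIntegral_map hs (Measure.measurable_rnDeriv _ _) hg]
  refine ⟨_, ⟨?_⟩, h3.symm⟩
  have h4 := congrArg (fun m => m univ) h3
  simp only [Measure.map_apply hg MeasurableSet.univ, preimage_univ, measure_univ] at h4
  exact h4

end TotalVariationLimit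

end

noncomputable section

/-! ### Point processes on the line from consistent laws on windows -/

section Windows

open scoped Topology
open Filter

/-- An exhaustion of the line by bounded intervals. -/
def window (k : ℕ) : Set ℝ := Ioc (-(k : ℝ)) k

lemma measurableSet_window (k : ℕ) : MeasurableSet (window k) := measurableSet_Ioc

lemma window_zero : window 0 = ∅ := by simp [window]

lemma window_mono : Monotone window := fun a b h => by
  have : (a : ℝ) ≤ b := by exact_mod_cast h
  exact Ioc_subset_Ioc (by linarith) this

lemma volume_window_ne_top (k : ℕ) : volume (window k) ≠ ∞ := by
  simp [window]

lemma exists_subset_window {K : Set ℝ} (hK : Bornology.IsBounded K) : ∃ k, K ⊆ window k := by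
  obtain ⟨R, hR⟩ := hK.subset_closedBall 0
  obtain ⟨k, hk⟩ := exists_nat_gt R
  refine ⟨k, fun x hx => ?_⟩
  have := hR hx
  rw [Metric.mem_closedBall, Real.dist_eq, sub_zero, abs_le] at this
  exact ⟨by linarith, by linarith⟩

/-- The restriction of a configuration to a window. -/
def Conf.onWindow (k : ℕ) (X : Conf ℝ) : Conf ℝ :=
  Conf.restrict (window k) (measurableSet_window k) X

lemma Conf.measurable_onWindow (k : ℕ) : Measurable (Conf.onWindow k) :=
  Conf.measurable_restrict (measurableSet_window k)

lemma Conf.onWindow_apply (k : ℕ) (X : Conf ℝ) {s : Set ℝ} (hs : MeasurableSet s) :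
    (X.onWindow k).1 s = X.1 (s ∩ window k) :=
  Measure.restrict_apply hs

lemma Conf.onWindow_onWindow {j k : ℕ} (h : j ≤ k) (X : Conf ℝ) :
    (X.onWindow k).onWindow j = X.onWindow j := by
  refine Subtype.ext (Measure.ext fun s hs => ?_)
  rw [Conf.onWindow_apply _ _ hs, Conf.onWindow_apply _ _ (hs.inter (measurableSet_window j)),
    Conf.onWindow_apply _ _ hs, inter_assoc, inter_eq_self_of_subset_left (window_mono h)]

lemma Conf.ext_rat {X Y : Conf ℝ} (h : ∀ a b : ℚ, X.1 (Ioo a b) = Y.1 (Ioo a b)) : X = Y := by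
  have : IsFiniteMeasureOnCompacts X.1 := ⟨fun K hK => X.2.2 K hK⟩
  exact Subtype.ext (Real.measure_ext_Ioo_rat h)

/-- The annuli between consecutive windows. -/
def annulus (k : ℕ) : Set ℝ := window (k + 1) \ window k

lemma measurableSet_annulus (k : ℕ) : MeasurableSet (annulus k) :=
  (measurableSet_window _).diff (measurableSet_window _)

lemma annulus_eq_disjointed (k : ℕ) : annulus k = disjointed (fun j => window (j + 1)) k := by
  cases k with
  | zero => simp [annulus, window_zero]
  | succ k =>
    rw [Monotone.disjointed_add_one (fun a b h => window_mono (Nat.succ_le_succ h))]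
    rfl

lemma pairwise_disjoint_annulus : Pairwise (Function.onFun Disjoint annulus) := by
  have : annulus = disjointed fun j => window (j + 1) := funext annulus_eq_disjointed
  rw [this]
  exact disjoint_disjointed _

lemma iUnion_annulus : ⋃ k, annulus k = univ := by
  simp only [annulus_eq_disjointed]
  rw [iUnion_disjointed]
  refine eq_univ_of_forall fun x => ?_
  obtain ⟨k, hk⟩ := exists_subset_window (Bornology.isBounded_singleton (x := x))
  exact mem_iUnion.2 ⟨k, window_mono (Nat.le_succ k) (hk rfl)⟩

lemma isConfiguration_glue (ω : ℕ → Conf ℝ) :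
    IsConfiguration (Measure.sum fun k => (ω (k + 1)).1.restrict (annulus k)) := by
  constructor
  · have h := fun k => ((ω (k + 1)).2.restrict (measurableSet_annulus k)).1
    choose ι hι x hx using h
    refine ⟨Σ k, ι k, inferInstance, fun p => x p.1 p.2, ?_⟩
    simp only [hx]
    ext s hs
    simp only [Measure.sum_apply _ hs]
    exact (ENNReal.tsum_sigma' fun p : Σ k, ι k => Measure.dirac (x p.1 p.2) s).symm
  · intro K hK
    obtain ⟨n, hn⟩ := exists_subset_window hK.isBounded
    -- A compact set lies in some window and therefore meets only finitely many annuli.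
    rw [Measure.sum_apply _ hK.measurableSet, tsum_eq_sum (s := Finset.range n)]
    · refine ENNReal.sum_lt_top.2 fun k _ => ?_
      exact (Measure.restrict_apply_le _ _).trans_lt ((ω (k + 1)).2.2 K hK)
    · intro k hk
      have hkn : n ≤ k := by simpa using hk
      rw [Measure.restrict_apply hK.measurableSet]
      have : K ∩ annulus k = ∅ := by
        refine eq_empty_of_forall_notMem fun x hx => hx.2.2 (window_mono hkn (hn hx.1))
      rw [this, measure_empty]

/-- The configuration which agrees with `ω (k + 1)` on the `k`-th annulus. -/
def Conf.glue (ω : ℕ → Conf ℝ) : Conf ℝ :=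
  ⟨Measure.sum fun k => (ω (k + 1)).1.restrict (annulus k), isConfiguration_glue ω⟩

lemma Conf.measurable_glue : Measurable Conf.glue := by
  refine Conf.measurable_iff.2 fun s hs => ?_
  simp only [Conf.glue, Measure.sum_apply _ hs, Measure.restrict_apply hs]
  exact Measurable.tsum fun k =>
    (Conf.measurable_apply (hs.inter (measurableSet_annulus k))).comp (measurable_pi_apply _)

/-- One-step consistency propagates: on the j-th annulus with j < k, the configurations ω (j + 1)
and ω k agree, and the annuli with j ≥ k miss the k-th window. -/
lemma Conf.onWindow_glue {ω : ℕ → Conf ℝ} (h : ∀ k, (ω (k + 1)).onWindow k = ω k) (k : ℕ) :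
    (Conf.glue ω).onWindow k = ω k := by
  have h1 : ∀ j m, (ω (j + m)).onWindow j = ω j := by
    intro j m
    induction m with
    | zero => rw [add_zero, ← h j, Conf.onWindow_onWindow le_rfl]
    | succ m ih =>
      rw [← Conf.onWindow_onWindow (Nat.le_add_right j m), ← Nat.add_assoc, h (j + m), ih]
  refine Subtype.ext (Measure.ext fun s hs => ?_)
  have h2 : (ω k).1 s = ∑' j, (ω k).1 (s ∩ window k ∩ annulus j) := by
    rw [← measure_iUnion, ← inter_iUnion, iUnion_annulus, inter_univ]
    · conv_lhs => rw [← h1 k 0, add_zero]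
      exact Conf.onWindow_apply _ _ hs
    · intro i j hij
      exact (pairwise_disjoint_annulus hij).mono inter_subset_right inter_subset_right
    · exact fun j => (hs.inter (measurableSet_window k)).inter (measurableSet_annulus j)
  rw [Conf.onWindow_apply _ _ hs, h2]
  have hsk := hs.inter (measurableSet_window k)
  rw [Conf.glue, Measure.sum_apply _ hsk]
  refine tsum_congr fun j => ?_
  rw [Measure.restrict_apply hsk]
  rcases lt_or_ge j k with hj | hj
  · obtain ⟨m, rfl⟩ := Nat.exists_eq_add_of_lt hj
    rw [show j + m + 1 = (j + 1) + m by ring]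
    conv_lhs => rw [← h1 (j + 1) m]
    rw [Conf.onWindow_apply _ _ (by
      rw [show j + 1 + m = j + m + 1 by ring]; exact hsk.inter (measurableSet_annulus j))]
    congr 1
    refine inter_eq_self_of_subset_left fun x hx => hx.2.1
  · have : s ∩ window k ∩ annulus j = ∅ :=
      eq_empty_of_forall_notMem fun x hx => hx.2.2 (window_mono hj hx.1.2)
    rw [this, measure_empty, measure_empty]

/-- The random sequence provided by `exists_measure_of_consistent` is almost surely coherent under
restriction, so its glued configuration restricts to the k-th term on the k-th window. -/
theorem exists_measure_of_onWindow {Z : Type*} [MeasurableSpace Z]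
    [StandardBorelSpace Z] [Nonempty Z] (ν : ℕ → Measure (Conf ℝ))
    [∀ k, IsProbabilityMeasure (ν k)] (l : ℕ → Measure Z) [∀ k, IsProbabilityMeasure (l k)]
    {g : ℕ → Z → Conf ℝ} (hg : ∀ k, Measurable (g k)) (hl : ∀ k, ν k = (l k).map (g k))
    (hcons : ∀ k, (ν (k + 1)).map (Conf.onWindow k) = ν k) {X₀ : Conf ℝ}
    (h0 : ν 0 = Measure.dirac X₀) :
    ∃ P : Measure (Conf ℝ), IsProbabilityMeasure P ∧ ∀ k, P.map (Conf.onWindow k) = ν k := by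
  obtain ⟨μ, hμ, h⟩ := exists_measure_of_consistent l hg Conf.measurable_onWindow
    (fun k => by rw [← hl, ← hl, hcons]) (s₀ := X₀) (by rw [← hl, h0])
  have hae : ∀ᵐ ω ∂μ, ∀ k, (ω (k + 1)).onWindow k = ω k := by
    refine ae_all_iff.2 fun k => ?_
    -- Equality of configurations is tested on the countably many intervals with rational endpoints,
    -- which gives measurable events on which the pair law can be evaluated.
    have h1 : ∀ᵐ ω ∂μ, ∀ a b : ℚ, ((ω (k + 1)).onWindow k).1 (Ioo a b) = (ω k).1 (Ioo a b) := by
      refine ae_all_iff.2 fun a => ae_all_iff.2 fun b => ?_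
      have hm : MeasurableSet {p : Conf ℝ × Conf ℝ |
          (p.2.onWindow k).1 (Ioo (a : ℝ) b) = p.1.1 (Ioo (a : ℝ) b)} :=
        measurableSet_eq_fun
          ((Conf.measurable_apply measurableSet_Ioo).comp
            ((Conf.measurable_onWindow k).comp measurable_snd))
          ((Conf.measurable_apply measurableSet_Ioo).comp measurable_fst)
      have h2 : ∀ᵐ p ∂(μ.map fun x => (x k, x (k + 1))),
          (p.2.onWindow k).1 (Ioo (a : ℝ) b) = p.1.1 (Ioo (a : ℝ) b) := by
        rw [h k, ae_map_iff (by
          exact ((Conf.measurable_onWindow k).prodMk measurable_id).aemeasurable) hm]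
        exact ae_of_all _ fun _ => rfl
      exact (ae_map_iff (by fun_prop) hm).1 h2
    filter_upwards [h1] with ω hω using Conf.ext_rat hω
  refine ⟨μ.map Conf.glue, Measure.isProbabilityMeasure_map Conf.measurable_glue.aemeasurable,
    fun k => ?_⟩
  rw [Measure.map_map (Conf.measurable_onWindow k) Conf.measurable_glue]
  have h2 : (Conf.onWindow k ∘ Conf.glue) =ᵐ[μ] fun ω => ω k := by
    filter_upwards [hae] with ω hω using Conf.onWindow_glue hω k
  rw [Measure.map_congr h2]
  have h3 := congrArg (Measure.map Prod.fst) (h k)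
  have h4 : Measurable fun s : Conf ℝ => (Conf.onWindow k s, s) :=
    (Conf.measurable_onWindow k).prodMk measurable_id
  rw [Measure.map_map measurable_fst (by fun_prop), Measure.map_map measurable_fst h4] at h3
  rw [← hcons k, hl (k + 1)]
  exact h3

end Windows

end

noncomputable section

/-! ### The limit of point processes of finite rank kernels -/

section LimitProcess

open scoped Topology
open Filter

/-- The kernel `K` is a limit of kernels of orthogonal projections of finite rank. -/
structure IsFiniteRankApprox {d : ℕ → ℕ} (ψ : ∀ N, Fin (d N) → ℝ → ℂ) (K : ℝ → ℝ → ℂ) :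
    Prop where
  orthonormal : ∀ N, IsOrthonormalFamily volume (ψ N)
  diag_le_one : ∀ N x, (finiteKernel (ψ N) x x).re ≤ 1
  tendsto : ∀ x y, Tendsto (fun N => finiteKernel (ψ N) x y) atTop (𝓝 (K x y))

variable {d : ℕ → ℕ} {ψ : ∀ N, Fin (d N) → ℝ → ℂ} {K : ℝ → ℝ → ℂ}

lemma IsFiniteRankApprox.measurable_kernel (h : IsFiniteRankApprox ψ K) :
    Measurable (Function.uncurry K) :=
  measurable_of_tendsto_metrizable
    (fun N => measurable_finiteKernel (h.orthonormal N).measurable)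
    (tendsto_pi_nhds.2 fun p => h.tendsto p.1 p.2)

lemma IsFiniteRankApprox.tendsto_kernelDet (h : IsFiniteRankApprox ψ K) {n : ℕ}
    (x : Fin n → ℝ) :
    Tendsto (fun N => kernelDet (finiteKernel (ψ N)) x) atTop (𝓝 (kernelDet K x)) := by
  simp only [kernelDet, Matrix.det_apply]
  refine tendsto_finsetSum _ fun σ _ => Tendsto.const_smul
    (tendsto_finsetProd _ fun i _ => ?_) _
  exact h.tendsto _ _

lemma IsFiniteRankApprox.norm_kernelDet_le (h : IsFiniteRankApprox ψ K) {n : ℕ}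
    (x : Fin n → ℝ) : ‖kernelDet K x‖ ≤ 1 :=
  le_of_tendsto' (h.tendsto_kernelDet x).norm fun N =>
    norm_kernelDet_finiteKernel_le (h.diag_le_one N) x

lemma IsFiniteRankApprox.kernelDet_eq_re (h : IsFiniteRankApprox ψ K) {n : ℕ}
    (x : Fin n → ℝ) : ((kernelDet K x).re : ℂ) = kernelDet K x := by
  refine tendsto_nhds_unique
    ((Complex.continuous_ofReal.tendsto _).comp
      ((Complex.continuous_re.tendsto _).comp (h.tendsto_kernelDet x))) ?_
  refine (h.tendsto_kernelDet x).congr fun N => ?_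
  exact kernelDet_finiteKernel_eq_re _ _

/-- The law of the restriction to a window of the process with kernel `finiteKernel ψ`. -/
def windowLaw (k : ℕ) {d : ℕ} (ψ : Fin d → ℝ → ℂ) : Measure (Conf ℝ) :=
  (finiteLaw volume ψ).map fun x => (Conf.ofFinset x Finset.univ).onWindow k

lemma measurable_onWindow_ofFinset (k : ℕ) {d : ℕ} :
    Measurable fun x : Fin d → ℝ => (Conf.ofFinset x Finset.univ).onWindow k :=
  (Conf.measurable_onWindow k).comp (Conf.measurable_ofFinset _)

lemma isProbabilityMeasure_windowLaw (k : ℕ) {d : ℕ} {ψ : Fin d → ℝ → ℂ}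
    (hψ : IsOrthonormalFamily volume ψ) : IsProbabilityMeasure (windowLaw k ψ) := by
  have := isProbabilityMeasure_finiteLaw hψ
  exact Measure.isProbabilityMeasure_map (measurable_onWindow_ofFinset k).aemeasurable

lemma map_onWindow_windowLaw {j k : ℕ} (h : j ≤ k) {d : ℕ} (ψ : Fin d → ℝ → ℂ) :
    (windowLaw k ψ).map (Conf.onWindow j) = windowLaw j ψ := by
  rw [windowLaw, Measure.map_map (Conf.measurable_onWindow j) (measurable_onWindow_ofFinset k)]
  congr 1
  ext x : 1
  exact Conf.onWindow_onWindow h _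

/-- Every approximating law is compared with the same series, formed with the limiting determinants.
That series need not be known to come from a probability measure; it serves as a common centre and
yields the Cauchy property in total variation. -/
lemma IsFiniteRankApprox.exists_limit_windowLaw (h : IsFiniteRankApprox ψ K) (k : ℕ) :
    ∃ ν : Measure (Conf ℝ), IsProbabilityMeasure ν ∧
      ν ≪ Measure.sum (fun N => windowLaw k (ψ N)) ∧
      ∀ F : Conf ℝ → ℂ, Measurable F → (∃ c : ℝ, ∀ x, ‖F x‖ ≤ c) →
        Tendsto (fun N => ∫ X, F X ∂(windowLaw k (ψ N))) atTop (𝓝 (∫ X, F X ∂ν)) := by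
  have hP : ∀ N, IsProbabilityMeasure (windowLaw k (ψ N)) := fun N =>
    isProbabilityMeasure_windowLaw k (h.orthonormal N)
  set ρ : ℕ → ∀ n : ℕ, (Fin n → ℝ) → ℝ := fun N _ x => (kernelDet (finiteKernel (ψ N)) x).re
  set ρ' : ∀ n : ℕ, (Fin n → ℝ) → ℝ := fun _ x => (kernelDet K x).re
  have hρm : ∀ N n, Measurable (ρ N n) := fun N n => Complex.measurable_re.comp
    (measurable_kernelDet (measurable_finiteKernel (h.orthonormal N).measurable))
  have hρm' : ∀ n, Measurable (ρ' n) := fun n => Complex.measurable_re.comp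
    (measurable_kernelDet h.measurable_kernel)
  have hρ : ∀ N n x, |ρ N n x| ≤ 1 := fun N n x => (Complex.abs_re_le_norm _).trans
    (norm_kernelDet_finiteKernel_le (h.diag_le_one N) x)
  have hρ' : ∀ n x, |ρ' n x| ≤ 1 := fun n x => (Complex.abs_re_le_norm _).trans
    (h.norm_kernelDet_le x)
  have hWf := volume_window_ne_top k
  refine exists_limit_of_totalVariation (tendsto_corrDist hWf hρm hρ hρm' hρ' fun n x =>
    (Complex.continuous_re.tendsto _).comp (h.tendsto_kernelDet x)) fun N M A hA => ?_
  have key : ∀ N, |(windowLaw k (ψ N)).real A - corrSeries volume (window k) ρ'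
      (A.indicator 1)| ≤ corrDist volume (window k) (ρ N) ρ' := by
    intro N
    have hF : Measurable (A.indicator (1 : Conf ℝ → ℝ)) := measurable_one.indicator hA
    have hF1 : ∀ X, |A.indicator (1 : Conf ℝ → ℝ) X| ≤ 1 := fun X => by
      by_cases hX : X ∈ A <;> simp [hX]
    have h1 : (windowLaw k (ψ N)).real A = corrSeries volume (window k) (ρ N) (A.indicator 1) := by
      rw [← integral_indicator_one hA, windowLaw, integral_map
        (measurable_onWindow_ofFinset k).aemeasurable hF.aestronglyMeasurable]
      exact integral_apply_restrict_finiteLaw (h.orthonormal N) (measurableSet_window k) hF hF1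
    rw [h1]
    exact abs_corrSeries_sub_le hWf (hρm N) (hρ N) hρm' hρ' hF hF1
  have h1 := key N
  have h2 := key M
  rw [abs_le] at h1 h2 ⊢
  constructor <;> linarith

/-- A standard Borel parametrization of the laws `windowLaw k (ψ N)`. -/
def windowParam (d : ℕ → ℕ) (k : ℕ) (z : ℕ × (ℕ → ℝ)) : Conf ℝ :=
  (Conf.ofFinset (fun i : Fin (d z.1) => z.2 i) Finset.univ).onWindow k

lemma measurable_windowParam (d : ℕ → ℕ) (k : ℕ) : Measurable (windowParam d k) := by
  refine measurable_from_prod_countable_right fun N => ?_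
  have h : Measurable fun z : ℕ → ℝ => fun i : Fin (d N) => z i :=
    measurable_pi_lambda _ fun i => measurable_pi_apply (i : ℕ)
  exact (measurable_onWindow_ofFinset k).comp h

lemma exists_sum_windowLaw_eq_map (ψ : ∀ N, Fin (d N) → ℝ → ℂ)
    (h : ∀ N, IsOrthonormalFamily volume (ψ N)) :
    ∃ m : Measure (ℕ × (ℕ → ℝ)), SFinite m ∧ ∀ k,
      Measure.sum (fun N => windowLaw k (ψ N)) = m.map (windowParam d k) := by
  -- The d N points are padded with zeros to an infinite sequence; the label N records how many
  -- entries count as points. The same measure then serves all windows.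
  let pad : ∀ N, (Fin (d N) → ℝ) → ℕ × (ℕ → ℝ) := fun N x =>
    (N, fun i => if hi : i < d N then x ⟨i, hi⟩ else 0)
  have hpad : ∀ N, Measurable (pad N) := fun N => by
    refine measurable_const.prodMk (measurable_pi_lambda _ fun i => ?_)
    by_cases hi : i < d N
    · simp only [hi, dif_pos]
      exact measurable_pi_apply _
    · simp only [hi, dif_neg, not_false_eq_true]
      exact measurable_const
  have hfin : ∀ N, SFinite ((finiteLaw volume (ψ N)).map (pad N)) := fun N => by
    have := isProbabilityMeasure_finiteLaw (h N)
    infer_instance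
  refine ⟨Measure.sum fun N => (finiteLaw volume (ψ N)).map (pad N), inferInstance, fun k => ?_⟩
  rw [Measure.map_sum (measurable_windowParam d k).aemeasurable]
  congr 1
  ext N : 1
  rw [Measure.map_map (measurable_windowParam d k) (hpad N), windowLaw]
  congr 1
  ext x : 1
  simp [windowParam, pad]

lemma measure_eq_of_integral_eq {S : Type*} [MeasurableSpace S] {ν ν' : Measure S}
    [IsFiniteMeasure ν] [IsFiniteMeasure ν']
    (h : ∀ F : S → ℂ, Measurable F → (∃ c : ℝ, ∀ x, ‖F x‖ ≤ c) →
      ∫ x, F x ∂ν = ∫ x, F x ∂ν') : ν = ν' := by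
  ext A hA
  have h1 := h (A.indicator fun _ => 1) (measurable_const.indicator hA)
    ⟨1, fun x => by by_cases hx : x ∈ A <;> simp [hx]⟩
  rw [integral_indicator_const _ hA, integral_indicator_const _ hA] at h1
  have h2 : ν.real A = ν'.real A := by simpa using h1
  exact (ENNReal.toReal_eq_toReal_iff' (measure_ne_top _ _) (measure_ne_top _ _)).1 h2

/-- The limit laws inherit consistency under restriction from the finite rank laws, by uniqueness of
limits of integrals of bounded functions. They can therefore be glued. -/
theorem IsFiniteRankApprox.exists_window_limit (h : IsFiniteRankApprox ψ K) :
    ∃ P : Measure (Conf ℝ), IsProbabilityMeasure P ∧ ∀ k, ∀ F : Conf ℝ → ℂ, Measurable F →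
      (∃ c : ℝ, ∀ x, ‖F x‖ ≤ c) →
        Tendsto (fun N => ∫ X, F X ∂(windowLaw k (ψ N))) atTop
          (𝓝 (∫ X, F (X.onWindow k) ∂P)) := by
  choose ν hν hac hlim using h.exists_limit_windowLaw
  obtain ⟨m, hm, hsum⟩ := exists_sum_windowLaw_eq_map ψ h.orthonormal
  have hl : ∀ k, ∃ l : Measure (ℕ × (ℕ → ℝ)), IsProbabilityMeasure l ∧
      ν k = l.map (windowParam d k) := fun k =>
    exists_eq_map_of_absolutelyContinuous (measurable_windowParam d k) (hsum k ▸ hac k)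
  choose l hl1 hl2 using hl
  have hcons : ∀ k, (ν (k + 1)).map (Conf.onWindow k) = ν k := by
    intro k
    have := Measure.isProbabilityMeasure_map (μ := ν (k + 1))
      (Conf.measurable_onWindow k).aemeasurable
    refine measure_eq_of_integral_eq fun F hF hc => ?_
    have h1 := hlim (k + 1) (F ∘ Conf.onWindow k) (hF.comp (Conf.measurable_onWindow k))
      (hc.imp fun c hc x => hc _)
    rw [integral_map (Conf.measurable_onWindow k).aemeasurable hF.aestronglyMeasurable]
    refine tendsto_nhds_unique h1 ((hlim k F hF hc).congr fun N => ?_)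
    rw [← map_onWindow_windowLaw (Nat.le_succ k), integral_map
      (Conf.measurable_onWindow k).aemeasurable hF.aestronglyMeasurable]
    rfl
  -- The window 0 is empty, so the gluing chain starts deterministically at the empty configuration.
  have h0 : ν 0 = Measure.dirac (Conf.ofFinset (fun i : Empty => i.elim) ∅) := by
    have hz : ∀ X : Conf ℝ, X.onWindow 0 = Conf.ofFinset (fun i : Empty => i.elim) ∅ := by
      intro X
      refine Subtype.ext ?_
      simp [Conf.onWindow, Conf.restrict, window_zero, Conf.ofFinset]
    refine measure_eq_of_integral_eq fun F hF hc => ?_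
    refine tendsto_nhds_unique (hlim 0 F hF hc) (tendsto_const_nhds.congr fun N => ?_)
    have := isProbabilityMeasure_finiteLaw (h.orthonormal N)
    rw [windowLaw, integral_map (measurable_onWindow_ofFinset 0).aemeasurable
      hF.aestronglyMeasurable, integral_dirac' _ _ hF.stronglyMeasurable]
    simp [hz]
  obtain ⟨P, hP, hPk⟩ := exists_measure_of_onWindow ν l (measurable_windowParam d) hl2 hcons h0
  refine ⟨P, hP, fun k F hF hc => ?_⟩
  rw [← integral_map (Conf.measurable_onWindow k).aemeasurable hF.aestronglyMeasurable, hPk]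
  exact hlim k F hF hc

end LimitProcess

end

noncomputable section

/-! ### Sums over tuples of distinct points -/

section TupleSums

variable {E : Type*} [TopologicalSpace E] [MeasurableSpace E]

/-- A configuration is finite and labelled on a set of finite mass. -/
lemma Conf.exists_restrict_eq_ofFinset (X : Conf E) {W : Set E} (hW : MeasurableSet W)
    (hX : X.1 W ≠ ∞) : ∃ (m : ℕ) (y : Fin m → E), (∀ i, y i ∈ W) ∧
      Conf.restrict W hW X = Conf.ofFinset y Finset.univ := by
  obtain ⟨X, ⟨ι, hι, x, rfl⟩, hc⟩ := X
  have h1 : ∑' i, W.indicator (1 : E → ℝ≥0∞) (x i) ≠ ∞ := by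
    have h := hX
    simp only [Measure.sum_apply _ hW, Measure.dirac_apply' _ hW] at h
    exact h
  have hfin : {i | x i ∈ W}.Finite := by
    refine (ENNReal.finite_const_le_of_tsum_ne_top h1 one_ne_zero).subset fun i hi => ?_
    have hi' : x i ∈ W := hi
    simp [hi']
  have := hfin.fintype
  let e := Fintype.equivFin {i | x i ∈ W}
  refine ⟨_, fun j => x (e.symm j), fun j => (e.symm j).2, Subtype.ext (Measure.ext fun s hs => ?_)⟩
  simp only [Conf.restrict, Conf.ofFinset, Measure.restrict_apply hs, Measure.finsetSum_apply,
    Measure.sum_apply _ (hs.inter hW), Measure.dirac_apply' _ hs,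
    Measure.dirac_apply' _ (hs.inter hW)]
  rw [e.symm.sum_comp fun i : {i | x i ∈ W} => s.indicator (1 : E → ℝ≥0∞) (x i), ← tsum_fintype (L := .unconditional _),
    tsum_subtype {i | x i ∈ W} fun i => s.indicator (1 : E → ℝ≥0∞) (x i)]
  refine tsum_congr fun i => ?_
  by_cases h1 : x i ∈ W <;> by_cases h2 : x i ∈ s <;> simp [h1, h2]

lemma Conf.ofFinset_apply_univ {m : ℕ} (y : Fin m → E) :
    (Conf.ofFinset y Finset.univ).1 univ = m := by
  simp [Conf.ofFinset]

variable [MeasurableSingletonClass E]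

open Classical in
lemma Conf.ofFinset_apply_singleton {ι : Type} [Fintype ι] (y : ι → E) (a : E) :
    (Conf.ofFinset y Finset.univ).1 {a} = (Finset.univ.filter fun i => y i = a).card := by
  simp only [Conf.ofFinset, Measure.finsetSum_apply,
    Measure.dirac_apply' _ (measurableSet_singleton a), Set.indicator_apply, mem_singleton_iff,
    Pi.one_apply]
  rw [Finset.sum_boole]

lemma Conf.points_ofFinset {ι : Type} [Fintype ι] (y : ι → E) :
    (Conf.ofFinset y Finset.univ).points = range y := by
  classical
  ext a
  rw [Conf.points, mem_ofPred_eq, Conf.ofFinset_apply_singleton]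
  simp [Finset.filter_eq_empty_iff]

lemma Conf.isSimple_ofFinset_iff {ι : Type} [Fintype ι] (y : ι → E) :
    (Conf.ofFinset y Finset.univ).IsSimple ↔ Function.Injective y := by
  classical
  simp only [Conf.IsSimple, Conf.ofFinset_apply_singleton]
  constructor
  · intro h i j hij
    have h1 : (Finset.univ.filter fun k => y k = y j).card ≤ 1 := by exact_mod_cast h (y j)
    exact Finset.card_le_one.1 h1 i (by simp [hij]) j (by simp)
  · intro h a
    have h1 : (Finset.univ.filter fun k => y k = a).card ≤ 1 :=
      Finset.card_le_one.2 fun i hi j hj => h (by simp_all)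
    exact_mod_cast h1

lemma Conf.IsSimple.restrict {E : Type*} [TopologicalSpace E] [MeasurableSpace E]
    {X : Conf E} (hX : X.IsSimple) {W : Set E} (hW : MeasurableSet W) :
    (Conf.restrict W hW X).IsSimple := fun x =>
  (Measure.restrict_apply_le _ _).trans (hX x)

lemma Conf.points_restrict (X : Conf E) {W : Set E} (hW : MeasurableSet W) :
    (Conf.restrict W hW X).points = X.points ∩ W := by
  ext a
  simp only [Conf.points, Conf.restrict, mem_ofPred_eq, mem_inter_iff,
    Measure.restrict_apply (measurableSet_singleton a)]
  by_cases h : a ∈ W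
  · rw [inter_eq_self_of_subset_left (by simpa using h)]
    simp [h]
  · simp [h]

lemma Conf.sumDistinct_eq_tsum_indicator {E : Type*} [TopologicalSpace E] [MeasurableSpace E]
    (X : Conf E) (n : ℕ) (f : (Fin n → E) → ℂ) :
    X.sumDistinct n f =
      ∑' x, {x : Fin n → E | Function.Injective x ∧ ∀ i, x i ∈ X.points}.indicator f x :=
  tsum_subtype {x : Fin n → E | Function.Injective x ∧ ∀ i, x i ∈ X.points} f

lemma Conf.sumDistinct_restrict (X : Conf E) {W : Set E} (hW : MeasurableSet W) {n : ℕ}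
    {f : (Fin n → E) → ℂ} (hf : ∀ x, f x ≠ 0 → ∀ i, x i ∈ W) :
    (Conf.restrict W hW X).sumDistinct n f = X.sumDistinct n f := by
  classical
  rw [Conf.sumDistinct_eq_tsum_indicator, Conf.sumDistinct_eq_tsum_indicator]
  refine tsum_congr fun x => ?_
  simp only [Conf.points_restrict, Set.indicator_apply, mem_ofPred_eq, mem_inter_iff]
  by_cases hx : f x = 0
  · simp [hx]
  · have := hf x hx
    simp [this]

lemma Conf.sumDistinct_ofFinset {m : ℕ} {y : Fin m → E} (hy : Function.Injective y) {n : ℕ}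
    (f : (Fin n → E) → ℂ) :
    (Conf.ofFinset y Finset.univ).sumDistinct n f = ∑ e : Fin n ↪ Fin m, f (y ∘ e) := by
  rw [Conf.sumDistinct, ← tsum_fintype (L := .unconditional _)]
  let g : (Fin n ↪ Fin m) → {x : Fin n → E // Function.Injective x ∧
      ∀ i, x i ∈ (Conf.ofFinset y Finset.univ).points} := fun e =>
    ⟨y ∘ e, hy.comp e.injective, fun i => by
      rw [Conf.points_ofFinset]; exact mem_range_self _⟩
  have hg : Function.Bijective g := by
    constructor
    · intro e e' h
      ext i
      have := congrFun (congrArg Subtype.val h) i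
      exact congrArg Fin.val (hy this)
    · rintro ⟨x, hx, hx'⟩
      rw [Conf.points_ofFinset] at hx'
      choose e he using hx'
      refine ⟨⟨e, fun i j hij => hx ?_⟩, Subtype.ext (funext he)⟩
      rw [← he i, ← he j, hij]
  exact ((Equiv.ofBijective g hg).tsum_eq fun x => f x.1).symm

lemma pi_sum_dirac {E : Type*} [MeasurableSpace E] {m n : ℕ} (y : Fin m → E) :
    (Measure.pi fun _ : Fin n => ∑ i, Measure.dirac (y i)) =
      ∑ e : Fin n → Fin m, Measure.dirac (y ∘ e) := by
  classical
  refine Measure.pi_eq fun s hs => ?_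
  simp only [Measure.finsetSum_apply]
  rw [Finset.prod_univ_sum, Fintype.piFinset_univ]
  refine Finset.sum_congr rfl fun e _ => ?_
  rw [Measure.dirac_apply' _ (MeasurableSet.univ_pi hs)]
  simp only [Measure.dirac_apply' _ (hs _), Set.indicator_apply, Pi.one_apply]
  rw [Finset.prod_ite_zero]
  simp [Set.mem_pi]

/-- The sum of `f` over tuples of distinct points of a finite configuration, as an integral. -/
def tupleSum {n : ℕ} (f : (Fin n → E) → ℂ) (X : Conf E) : ℂ :=
  ∫ x, {x | Function.Injective x}.indicator f x ∂(Measure.pi fun _ => X.1)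

/-- The product of the point measures is the sum of point masses over all label maps, and since the
points are distinct the indicator keeps exactly the injective maps. -/
lemma tupleSum_ofFinset {m : ℕ} {y : Fin m → E} (hy : Function.Injective y) {n : ℕ}
    (f : (Fin n → E) → ℂ) :
    tupleSum f (Conf.ofFinset y Finset.univ) = ∑ e : Fin n ↪ Fin m, f (y ∘ e) := by
  classical
  rw [tupleSum, Conf.ofFinset, pi_sum_dirac, integral_finsetSum_measure]
  · simp only [integral_dirac]
    have h1 : ∀ e : Fin n → Fin m, {x : Fin n → E | Function.Injective x}.indicator f (y ∘ e) =
        if Function.Injective e then f (y ∘ e) else 0 := fun e => by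
      simp only [Set.indicator_apply, mem_ofPred_eq, hy.of_comp_iff]
    simp only [h1]
    rw [← Finset.sum_filter]
    symm
    refine Finset.sum_bij (fun e _ => (e : Fin n → Fin m)) ?_ ?_ ?_ ?_
    · intro e _
      simpa using e.injective
    · intro e _ e' _ h
      exact DFunLike.coe_injective h
    · intro e he
      exact ⟨⟨e, (Finset.mem_filter.1 he).2⟩, Finset.mem_univ _, rfl⟩
    · intro e _
      rfl
  · intro e _
    exact integrable_dirac (by finiteness)

lemma measurable_pi_conf {E : Type*} [MeasurableSpace E] {n : ℕ} {Ω : Type*} [MeasurableSpace Ω] {κ : Ω → Measure E}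
    (hκ : ∀ s, MeasurableSet s → Measurable fun ω => κ ω s) [∀ ω, IsFiniteMeasure (κ ω)] :
    Measurable fun ω => (Measure.pi fun _ : Fin n => κ ω) := by
  refine Measurable.measure_of_isPiSystem generateFrom_pi.symm isPiSystem_pi ?_ ?_
  · rintro _ ⟨s, hs, rfl⟩
    simp only [Measure.pi_pi]
    exact Finset.measurable_prod _ fun i _ => hκ _ (hs i (mem_univ i))
  · simp only [Measure.pi_univ]
    exact Finset.measurable_prod _ fun i _ => hκ _ MeasurableSet.univ

end TupleSums

/-! ### Measurability of tuple sums over the points in a window. -/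

section TupleSumsOnWindows

lemma measurableSet_injective (n : ℕ) : MeasurableSet {x : Fin n → ℝ | Function.Injective x} := by
  have : {x : Fin n → ℝ | Function.Injective x} =
      ⋂ i, ⋂ j, {x : Fin n → ℝ | x i = x j → i = j} := by
    ext x
    simp [Function.Injective]
  rw [this]
  refine MeasurableSet.iInter fun i => MeasurableSet.iInter fun j => ?_
  by_cases hij : i = j
  · simp [hij]
  · simp only [hij, imp_false]
    exact (measurableSet_eq_fun (measurable_pi_apply i) (measurable_pi_apply j)).compl

instance (k : ℕ) (X : Conf ℝ) : IsFiniteMeasure (X.onWindow k).1 := by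
  refine ⟨?_⟩
  rw [Conf.onWindow_apply _ _ MeasurableSet.univ, univ_inter]
  exact (measure_mono Ioc_subset_Icc_self).trans_lt (X.2.2 _ isCompact_Icc)

/-- The integral form of the sum pays off here: on a window the product measure is a measurable
function of the configuration, so integration against it is measurable. -/
lemma measurable_tupleSum_onWindow (k : ℕ) {n : ℕ} {f : (Fin n → ℝ) → ℂ} (hf : Measurable f) :
    Measurable fun X : Conf ℝ => tupleSum f (X.onWindow k) := by
  let κ : ProbabilityTheory.Kernel (Conf ℝ) (Fin n → ℝ) :=
    ⟨fun X => Measure.pi fun _ => (X.onWindow k).1, measurable_pi_conf fun s hs =>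
      (Conf.measurable_apply hs).comp (Conf.measurable_onWindow k)⟩
  exact ((hf.indicator (measurableSet_injective n)).stronglyMeasurable.integral_kernel
    (κ := κ)).measurable

lemma Conf.exists_onWindow_eq_ofFinset (X : Conf ℝ) (k : ℕ) :
    ∃ (m : ℕ) (y : Fin m → ℝ), (∀ i, y i ∈ window k) ∧
      X.onWindow k = Conf.ofFinset y Finset.univ := by
  refine X.exists_restrict_eq_ofFinset (measurableSet_window k) ?_
  exact ((measure_mono Ioc_subset_Icc_self).trans_lt (X.2.2 _ isCompact_Icc)).ne

lemma sumDistinct_eq_tupleSum {X : Conf ℝ} {k : ℕ} (hX : (X.onWindow k).IsSimple) {n : ℕ}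
    {f : (Fin n → ℝ) → ℂ} (hf : ∀ x, f x ≠ 0 → ∀ i, x i ∈ window k) :
    X.sumDistinct n f = tupleSum f (X.onWindow k) := by
  obtain ⟨m, y, hy, h⟩ := X.exists_onWindow_eq_ofFinset k
  have hinj : Function.Injective y := (Conf.isSimple_ofFinset_iff y).1 (h ▸ hX)
  rw [← Conf.sumDistinct_restrict X (measurableSet_window k) hf]
  change (X.onWindow k).sumDistinct n f = _
  rw [h, Conf.sumDistinct_ofFinset hinj, tupleSum_ofFinset hinj]

end TupleSumsOnWindows

end

noncomputable section

/-! ### Correlation functions of the limit process -/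

section LimitCorrelations

open scoped Topology
open Filter

/-- Coincidence of two coordinates defines a proper subspace, which is a null set, and the law is
absolutely continuous. -/
lemma ae_injective_finiteLaw {d : ℕ} (ψ : Fin d → ℝ → ℂ) :
    ∀ᵐ x ∂(finiteLaw volume ψ), Function.Injective x := by
  have hac : finiteLaw volume ψ ≪ (Measure.pi fun _ => volume) :=
    (Measure.smul_absolutelyContinuous).trans (withDensity_absolutelyContinuous _ _)
  refine hac.ae_le ?_
  have h1 : ∀ i j : Fin d, i ≠ j → ∀ᵐ x : Fin d → ℝ ∂(Measure.pi fun _ => volume),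
      x i ≠ x j := by
    intro i j hij
    let s : Submodule ℝ (Fin d → ℝ) :=
      LinearMap.ker ((LinearMap.proj i : (Fin d → ℝ) →ₗ[ℝ] ℝ) - LinearMap.proj j)
    have hs : s ≠ ⊤ := by
      intro h
      have h2 : (Pi.single i 1 : Fin d → ℝ) ∈ s := h ▸ Submodule.mem_top
      simp [s, LinearMap.mem_ker, hij.symm] at h2
    have h3 := Measure.addHaar_submodule (volume : Measure (Fin d → ℝ)) s hs
    rw [← volume_pi]
    have h4 : ∀ᵐ x, x ∉ (s : Set (Fin d → ℝ)) := measure_eq_zero_iff_ae_notMem.1 h3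
    filter_upwards [h4] with x hx h
    exact hx (by simp [s, LinearMap.mem_ker, h])
  have h2 : ∀ᵐ x : Fin d → ℝ ∂(Measure.pi fun _ => volume), ∀ i j : Fin d, i ≠ j → x i ≠ x j :=
    ae_all_iff.2 fun i => ae_all_iff.2 fun j => by
      by_cases hij : i = j
      · exact ae_of_all _ fun x h => absurd hij h
      · filter_upwards [h1 i j hij] with x hx _ using hx
  filter_upwards [h2] with x hx i j hij
  by_contra h
  exact hx i j h hij

lemma isSimple_onWindow_ofFinset {d : ℕ} {x : Fin d → ℝ} (hx : Function.Injective x) (k : ℕ) :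
    ((Conf.ofFinset x Finset.univ).onWindow k).IsSimple :=
  ((Conf.isSimple_ofFinset_iff x).2 hx).restrict _

variable {k n : ℕ} {f : (Fin n → ℝ) → ℂ} {c : ℝ}

lemma tupleSum_onWindow_ofFinset {d : ℕ} {x : Fin d → ℝ} (hx : Function.Injective x)
    (hsupp : ∀ x, f x ≠ 0 → ∀ i, x i ∈ window k) :
    tupleSum f ((Conf.ofFinset x Finset.univ).onWindow k) = ∑ e : Fin n ↪ Fin d, f (x ∘ e) := by
  rw [← sumDistinct_eq_tupleSum (isSimple_onWindow_ofFinset hx k) hsupp,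
    Conf.sumDistinct_ofFinset hx]

lemma integral_tupleSum_windowLaw {d : ℕ} {ψ : Fin d → ℝ → ℂ}
    (hψ : IsOrthonormalFamily volume ψ) (hf : Measurable f) (hc : ∀ x, ‖f x‖ ≤ c)
    (hsupp : ∀ x, f x ≠ 0 → ∀ i, x i ∈ window k) :
    Integrable (fun X : Conf ℝ => tupleSum f (X.onWindow k)) (windowLaw k ψ) ∧
      ∫ X, tupleSum f (X.onWindow k) ∂(windowLaw k ψ) =
        ∫ x, (kernelDet (finiteKernel ψ) x).re • f x ∂(Measure.pi fun _ => volume) := by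
  have := isProbabilityMeasure_finiteLaw hψ
  have hm := measurable_tupleSum_onWindow k hf
  have hg : Measurable fun x : Fin d → ℝ => (Conf.ofFinset x Finset.univ).onWindow k :=
    measurable_onWindow_ofFinset k
  have hae : ∀ᵐ x ∂(finiteLaw volume ψ),
      tupleSum f (((Conf.ofFinset x Finset.univ).onWindow k).onWindow k) =
        ∑ e : Fin n ↪ Fin d, f (x ∘ e) := by
    filter_upwards [ae_injective_finiteLaw ψ] with x hx
    rw [Conf.onWindow_onWindow le_rfl, tupleSum_onWindow_ofFinset hx hsupp]
  constructor
  · rw [windowLaw, integrable_map_measure hm.aestronglyMeasurable hg.aemeasurable]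
    refine Integrable.of_bound (hm.comp hg).aestronglyMeasurable
      (∑ _e : Fin n ↪ Fin d, c) ?_
    filter_upwards [hae] with x hx
    rw [Function.comp_apply, hx]
    exact norm_sum_le_of_le _ fun e _ => hc _
  · rw [windowLaw, integral_map hg.aemeasurable hm.aestronglyMeasurable, integral_congr_ae hae]
    exact integral_sum_embedding_finiteLaw hψ hf.stronglyMeasurable hc

/-- The indicator function of tuples in a window. -/
def windowIndicator (k n : ℕ) : (Fin n → ℝ) → ℂ := (univ.pi fun _ => window k).indicator 1

lemma measurable_windowIndicator (k n : ℕ) : Measurable (windowIndicator k n) :=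
  measurable_one.indicator (MeasurableSet.univ_pi fun _ => measurableSet_window k)

lemma norm_windowIndicator_le (k n : ℕ) (x) : ‖windowIndicator k n x‖ ≤ 1 := by
  classical
  rw [windowIndicator, Set.indicator_apply]
  split_ifs <;> simp

lemma windowIndicator_supp (k n : ℕ) (x) (hx : windowIndicator k n x ≠ 0) (i) :
    x i ∈ window k := by
  have := Set.mem_of_indicator_ne_zero hx
  exact this i (mem_univ i)

lemma tupleSum_windowIndicator {X : Conf ℝ} {m : ℕ} {y : Fin m → ℝ}
    (hy : Function.Injective y) (hyk : ∀ i, y i ∈ window k)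
    (hX : X.onWindow k = Conf.ofFinset y Finset.univ) (n : ℕ) :
    tupleSum (windowIndicator k n) (X.onWindow k) = m.descFactorial n := by
  rw [hX, tupleSum_ofFinset hy]
  have : ∀ e : Fin n ↪ Fin m, windowIndicator k n (y ∘ e) = 1 := fun e => by
    have h : y ∘ e ∈ univ.pi fun _ => window k := fun i _ => hyk _
    rw [windowIndicator, indicator_of_mem h, Pi.one_apply]
  simp [this, Fintype.card_embedding_eq]

lemma norm_tupleSum_onWindow_le {X : Conf ℝ} (hX : (X.onWindow k).IsSimple)
    (hc : ∀ x, ‖f x‖ ≤ c) :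
    ‖tupleSum f (X.onWindow k)‖ ≤ c * (tupleSum (windowIndicator k n) (X.onWindow k)).re := by
  obtain ⟨m, y, hyk, h⟩ := X.exists_onWindow_eq_ofFinset k
  have hy : Function.Injective y := (Conf.isSimple_ofFinset_iff y).1 (h ▸ hX)
  rw [tupleSum_windowIndicator hy hyk h, h, tupleSum_ofFinset hy]
  refine (norm_sum_le_of_le _ fun e _ => hc _).trans ?_
  simp [Fintype.card_embedding_eq, mul_comm]

/-- The falling factorial of order n + 1 has the extra factor m - n, which is at least M/2. Thus the
part of an n-th factorial moment coming from more than M points is O(1/M) times the next factorial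
moment. -/
lemma pow_le_descFactorial_div {m M n : ℕ} (hM : 2 * n + 2 ≤ M) (hm : M < m) :
    (m.descFactorial n : ℝ) ≤ 2 / M * m.descFactorial (n + 1) := by
  have hM0 : (0 : ℝ) < M := by exact_mod_cast (by omega : 0 < M)
  rw [Nat.descFactorial_succ, Nat.cast_mul, ← mul_assoc]
  refine le_mul_of_one_le_left (Nat.cast_nonneg _) ?_
  rw [div_mul_eq_mul_div, le_div_iff₀ hM0, one_mul]
  have : M ≤ 2 * (m - n) := by omega
  exact_mod_cast this

lemma norm_tupleSum_onWindow_le_of_lt {X : Conf ℝ} (hX : (X.onWindow k).IsSimple)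
    (hc0 : 0 ≤ c) (hc : ∀ x, ‖f x‖ ≤ c) {M : ℕ} (hM : 2 * n + 2 ≤ M)
    (hlt : (M : ℝ≥0∞) < (X.onWindow k).1 univ) :
    ‖tupleSum f (X.onWindow k)‖ ≤
      c * (2 / M * (tupleSum (windowIndicator k (n + 1)) (X.onWindow k)).re) := by
  refine (norm_tupleSum_onWindow_le hX hc).trans (mul_le_mul_of_nonneg_left ?_ hc0)
  obtain ⟨m, y, hyk, h⟩ := X.exists_onWindow_eq_ofFinset k
  have hy : Function.Injective y := (Conf.isSimple_ofFinset_iff y).1 (h ▸ hX)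
  rw [tupleSum_windowIndicator hy hyk h, tupleSum_windowIndicator hy hyk h]
  rw [h, Conf.ofFinset_apply_univ] at hlt
  have hlt' : M < m := by exact_mod_cast hlt
  simpa using pow_le_descFactorial_div hM hlt'

lemma norm_tupleSum_onWindow_le_pow (X : Conf ℝ) (hc0 : 0 ≤ c) (hc : ∀ x, ‖f x‖ ≤ c) {M : ℕ}
    (hM : (X.onWindow k).1 univ ≤ M) : ‖tupleSum f (X.onWindow k)‖ ≤ c * M ^ n := by
  refine (norm_integral_le_of_norm_le_const (ae_of_all _ fun x =>
    (norm_indicator_le_norm_self _ _).trans (hc x))).trans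
    (mul_le_mul_of_nonneg_left ?_ hc0)
  rw [Measure.real, Measure.pi_univ]
  simp only [Finset.prod_const, Finset.card_univ, Fintype.card_fin, ENNReal.toReal_pow]
  refine pow_le_pow_left₀ ENNReal.toReal_nonneg ?_ _
  exact ENNReal.toReal_le_of_le_ofReal (by positivity) (by simpa using hM)

lemma norm_integral_corr_windowIndicator_le {d : ℕ} {ψ : Fin d → ℝ → ℂ}
    (hψ : ∀ x, (finiteKernel ψ x x).re ≤ 1) (k n : ℕ) :
    ‖∫ x, (kernelDet (finiteKernel ψ) x).re • windowIndicator k n x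
      ∂(Measure.pi fun _ => volume)‖ ≤ volume.real (window k) ^ n := by
  have h1 : ∀ x, (kernelDet (finiteKernel ψ) x).re • windowIndicator k n x =
      (univ.pi fun _ => window k).indicator
        (fun x : Fin n → ℝ => ((kernelDet (finiteKernel ψ) x).re : ℂ)) x := by
    intro x
    by_cases hx : x ∈ univ.pi fun _ : Fin n => window k
    · simp [windowIndicator, indicator_of_mem hx]
    · simp only [windowIndicator, indicator_of_notMem hx, smul_zero]
  simp only [h1]
  rw [integral_indicator (MeasurableSet.univ_pi fun _ => measurableSet_window k),
    ← (pi_real_univ_pi (volume_window_ne_top k) n).2, ← one_mul (Measure.real _ _)]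
  refine norm_setIntegral_le_of_norm_le_const
    (pi_real_univ_pi (volume_window_ne_top k) n).1.lt_top fun x _ => ?_
  rw [Complex.norm_real]
  exact (Complex.abs_re_le_norm _).trans (norm_kernelDet_finiteKernel_le hψ x)

lemma ae_isSimple_windowLaw (k : ℕ) {d : ℕ} (ψ : Fin d → ℝ → ℂ) {S : Set (Conf ℝ)}
    (hS : MeasurableSet S)
    (h : ∀ (m : ℕ) (y : Fin m → ℝ), Function.Injective y → Conf.ofFinset y Finset.univ ∈ S) :
    ∀ᵐ X ∂(windowLaw k ψ), X ∈ S := by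
  rw [windowLaw, ae_map_iff (p := fun X => X ∈ S) (measurable_onWindow_ofFinset k).aemeasurable hS]
  filter_upwards [ae_injective_finiteLaw ψ] with x hx
  obtain ⟨m, y, -, hy⟩ := (Conf.ofFinset x Finset.univ).exists_onWindow_eq_ofFinset k
  rw [hy]
  exact h m y ((Conf.isSimple_ofFinset_iff y).1 (hy ▸ isSimple_onWindow_ofFinset hx k))

/-- Configurations whose points are separated by the cells of some mesh. -/
def separatedConf : Set (Conf ℝ) :=
  ⋃ m : ℕ, ⋂ j : ℤ, {X | X.1 (Ico (j / (m + 1) : ℝ) ((j + 1) / (m + 1))) ≤ 1}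

lemma measurableSet_separatedConf : MeasurableSet separatedConf :=
  MeasurableSet.iUnion fun _ => MeasurableSet.iInter fun _ =>
    measurableSet_le (Conf.measurable_apply measurableSet_Ico) measurable_const

lemma isSimple_of_mem_separatedConf {X : Conf ℝ} (hX : X ∈ separatedConf) : X.IsSimple := by
  obtain ⟨m, hm⟩ := mem_iUnion.1 hX
  intro x
  have h := mem_iInter.1 hm ⌊x * (m + 1)⌋
  refine (measure_mono ?_).trans h
  have hm : (0 : ℝ) < m + 1 := by positivity
  rintro _ rfl
  rw [mem_Ico, div_le_iff₀ hm, lt_div_iff₀ hm]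
  exact ⟨Int.floor_le _, Int.lt_floor_add_one _⟩

lemma ofFinset_mem_separatedConf {m : ℕ} {y : Fin m → ℝ} (hy : Function.Injective y) :
    Conf.ofFinset y Finset.univ ∈ separatedConf := by
  classical
  have h1 : ∃ ε : ℝ, 0 < ε ∧ ∀ i j, i ≠ j → ε ≤ |y i - y j| := by
    have hfin : (Set.range fun p : {p : Fin m × Fin m // p.1 ≠ p.2} =>
      |y p.1.1 - y p.1.2|).Finite := Set.finite_range _
    obtain ⟨ε, hε, h⟩ : ∃ ε > 0, ∀ r ∈ Set.range fun p : {p : Fin m × Fin m // p.1 ≠ p.2} =>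
        |y p.1.1 - y p.1.2|, ε ≤ r := by
      rcases (Set.range fun p : {p : Fin m × Fin m // p.1 ≠ p.2} =>
        |y p.1.1 - y p.1.2|).eq_empty_or_nonempty with he | hne
      · exact ⟨1, one_pos, by simp [he]⟩
      · obtain ⟨r, ⟨p, rfl⟩, hr⟩ := Set.exists_min_image _ id hfin hne
        exact ⟨_, abs_pos.2 (sub_ne_zero.2 fun h => p.2 (hy h)), hr⟩
    exact ⟨ε, hε, fun i j hij => h _ ⟨⟨(i, j), hij⟩, rfl⟩⟩
  obtain ⟨ε, hε, h⟩ := h1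
  -- A mesh finer than the minimal distance ε puts at most one point in each cell.
  obtain ⟨M, hM⟩ := exists_nat_one_div_lt hε
  refine mem_iUnion.2 ⟨M, mem_iInter.2 fun j => ?_⟩
  have hM0 : (0 : ℝ) < M + 1 := by positivity
  simp only [mem_ofPred_eq, Conf.ofFinset, Measure.finsetSum_apply,
    Measure.dirac_apply' _ measurableSet_Ico, Set.indicator_apply, Pi.one_apply]
  rw [Finset.sum_boole]
  have : (Finset.univ.filter fun i => y i ∈
      Ico (j / (M + 1) : ℝ) ((j + 1) / (M + 1))).card ≤ 1 := by
    refine Finset.card_le_one.2 fun a ha b hb => ?_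
    by_contra hab
    simp only [Finset.mem_filter, Finset.mem_univ, true_and, mem_Ico] at ha hb
    have h2 := h a b hab
    have h3 : |y a - y b| ≤ 1 / (M + 1) := by
      rw [abs_le]
      rw [add_div] at ha hb
      constructor <;> linarith
    linarith
  exact_mod_cast this

end LimitCorrelations

end

noncomputable section

/-! ### Existence of the determinantal process -/

section Existence

open scoped Topology
open Filter

variable {d : ℕ → ℕ} {ψ : ∀ N, Fin (d N) → ℝ → ℂ} {K : ℝ → ℝ → ℂ}

/-- The configurations with at most `M` points in a window. -/
def countLE (k M : ℕ) : Set (Conf ℝ) := {X | (X.onWindow k).1 univ ≤ M}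

lemma measurableSet_countLE (k M : ℕ) : MeasurableSet (countLE k M) :=
  measurableSet_le ((Conf.measurable_apply MeasurableSet.univ).comp (Conf.measurable_onWindow k))
    measurable_const

lemma aecover_countLE (P : Measure (Conf ℝ)) (k : ℕ) : AECover P atTop (countLE k) := by
  refine ⟨ae_of_all _ fun X => ?_, measurableSet_countLE k⟩
  obtain ⟨M, hM⟩ := ENNReal.exists_nat_gt (measure_ne_top (X.onWindow k).1 univ)
  filter_upwards [eventually_ge_atTop M] with M' hM'
  exact hM.le.trans (by exact_mod_cast hM')

variable {P : Measure (Conf ℝ)} [IsProbabilityMeasure P]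

/-- `separatedConf` is a measurable set of simple configurations that contains every configuration
of finitely many distinct points. Its indicator is a bounded test function with integral 1 under
each approximating law, hence also in the limit. -/
lemma ae_isSimple_of_limit (h : IsFiniteRankApprox ψ K)
    (hP : ∀ k, ∀ F : Conf ℝ → ℂ, Measurable F → (∃ c : ℝ, ∀ x, ‖F x‖ ≤ c) →
      Tendsto (fun N => ∫ X, F X ∂(windowLaw k (ψ N))) atTop (𝓝 (∫ X, F (X.onWindow k) ∂P))) :
    ∀ᵐ X ∂P, ∀ k, (X.onWindow k).IsSimple := by
  refine ae_all_iff.2 fun k => ?_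
  have h1 := hP k (separatedConf.indicator 1)
    (measurable_one.indicator measurableSet_separatedConf) ⟨1, fun X => by
      by_cases hX : X ∈ separatedConf <;> simp [hX]⟩
  have h2 : ∀ N, ∫ X, separatedConf.indicator (1 : Conf ℝ → ℂ) X ∂(windowLaw k (ψ N)) = 1 := by
    intro N
    have := isProbabilityMeasure_windowLaw k (h.orthonormal N)
    have h3 : ∀ᵐ X ∂(windowLaw k (ψ N)), separatedConf.indicator (1 : Conf ℝ → ℂ) X = 1 := by
      filter_upwards [ae_isSimple_windowLaw k (ψ N) measurableSet_separatedConf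
        fun m y hy => ofFinset_mem_separatedConf hy] with X hX
      simp [hX]
    rw [integral_congr_ae h3]
    simp
  simp only [h2] at h1
  have h3 := tendsto_nhds_unique h1 tendsto_const_nhds
  have hm : MeasurableSet (Conf.onWindow k ⁻¹' separatedConf) :=
    Conf.measurable_onWindow k measurableSet_separatedConf
  have h4 : ∀ X : Conf ℝ, separatedConf.indicator (1 : Conf ℝ → ℂ) (X.onWindow k) =
      (Conf.onWindow k ⁻¹' separatedConf).indicator (fun _ => 1) X := fun X => rfl
  simp only [h4] at h3
  rw [integral_indicator_const _ hm] at h3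
  have h5 : P.real (Conf.onWindow k ⁻¹' separatedConf) = 1 := by
    have : (P.real (Conf.onWindow k ⁻¹' separatedConf) : ℂ) = 1 := by simpa using h3
    exact_mod_cast this
  have h6 : P (Conf.onWindow k ⁻¹' separatedConf) = 1 := by
    rw [← ENNReal.toReal_eq_one_iff]; exact h5
  filter_upwards [(prob_compl_eq_zero_iff hm).2 h6 |> measure_eq_zero_iff_ae_notMem.1] with X hX
  exact isSimple_of_mem_separatedConf (by simpa using hX)

lemma ae_isSimple_onWindow_windowLaw (k : ℕ) {d : ℕ} (ψ : Fin d → ℝ → ℂ) :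
    ∀ᵐ X ∂(windowLaw k ψ), (X.onWindow k).IsSimple := by
  filter_upwards [ae_isSimple_windowLaw k ψ measurableSet_separatedConf
    fun m y hy => ofFinset_mem_separatedConf hy] with X hX
  exact (isSimple_of_mem_separatedConf hX).restrict _

variable {k n : ℕ} {f : (Fin n → ℝ) → ℂ} {c : ℝ}

/-- The integrand is dominated by c times the number of n-tuples of distinct points in the window,
whose mean is at most vol^n because the correlation functions are at most 1. -/
lemma integral_norm_tupleSum_le {d : ℕ} {ψ : Fin d → ℝ → ℂ}
    (hψ : IsOrthonormalFamily volume ψ) (hψ1 : ∀ x, (finiteKernel ψ x x).re ≤ 1)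
    (hf : Measurable f) (hc0 : 0 ≤ c) (hc : ∀ x, ‖f x‖ ≤ c)
    (hsupp : ∀ x, f x ≠ 0 → ∀ i, x i ∈ window k) :
    ∫ X, ‖tupleSum f (X.onWindow k)‖ ∂(windowLaw k ψ) ≤ c * volume.real (window k) ^ n := by
  obtain ⟨hi, -⟩ := integral_tupleSum_windowLaw hψ hf hc hsupp
  obtain ⟨hi1, he1⟩ := integral_tupleSum_windowLaw hψ (measurable_windowIndicator k n)
    (norm_windowIndicator_le k n) (windowIndicator_supp k n)
  calc _ ≤ ∫ X, c * (tupleSum (windowIndicator k n) (X.onWindow k)).re ∂(windowLaw k ψ) := by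
        refine integral_mono_ae hi.norm (hi1.re.const_mul c) ?_
        filter_upwards [ae_isSimple_onWindow_windowLaw k ψ] with X hX
        exact norm_tupleSum_onWindow_le hX hc
    _ = c * (∫ X, tupleSum (windowIndicator k n) (X.onWindow k) ∂(windowLaw k ψ)).re := by
        rw [integral_const_mul]
        congr 1
        exact integral_re hi1
    _ ≤ _ := by
        refine mul_le_mul_of_nonneg_left ?_ hc0
        rw [he1]
        exact (Complex.re_le_norm _).trans (norm_integral_corr_windowIndicator_le hψ1 k n)

/-- The error of truncating to at most M points. The bound is the same for all approximating
kernels, which is what permits the exchange of limits in `IsFiniteRankApprox.integral_tupleSum`. -/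
lemma norm_integral_tupleSum_sub_le {d : ℕ} {ψ : Fin d → ℝ → ℂ}
    (hψ : IsOrthonormalFamily volume ψ) (hψ1 : ∀ x, (finiteKernel ψ x x).re ≤ 1)
    (hf : Measurable f) (hc0 : 0 ≤ c) (hc : ∀ x, ‖f x‖ ≤ c)
    (hsupp : ∀ x, f x ≠ 0 → ∀ i, x i ∈ window k) {M : ℕ} (hM : 2 * n + 2 ≤ M) :
    ‖∫ X, (countLE k M).indicator (fun X => tupleSum f (X.onWindow k)) X ∂(windowLaw k ψ) -
      ∫ X, tupleSum f (X.onWindow k) ∂(windowLaw k ψ)‖ ≤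
        c * (2 / M * volume.real (window k) ^ (n + 1)) := by
  obtain ⟨hi, -⟩ := integral_tupleSum_windowLaw hψ hf hc hsupp
  obtain ⟨hi1, he1⟩ := integral_tupleSum_windowLaw hψ (measurable_windowIndicator k (n + 1))
    (norm_windowIndicator_le k (n + 1)) (windowIndicator_supp k (n + 1))
  rw [← integral_sub (hi.indicator (measurableSet_countLE k M)) hi]
  calc _ ≤ ∫ X, c * (2 / M * (tupleSum (windowIndicator k (n + 1)) (X.onWindow k)).re)
        ∂(windowLaw k ψ) := by
        refine norm_integral_le_of_norm_le ((hi1.re.const_mul _).const_mul c) ?_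
        filter_upwards [ae_isSimple_onWindow_windowLaw k ψ] with X hX
        by_cases hXM : X ∈ countLE k M
        · rw [indicator_of_mem hXM, sub_self, norm_zero]
          refine mul_nonneg hc0 (mul_nonneg (by positivity) ?_)
          have := (norm_nonneg _).trans (norm_tupleSum_onWindow_le hX
            (norm_windowIndicator_le k (n + 1)))
          simpa using this
        · rw [indicator_of_notMem hXM, zero_sub, norm_neg]
          exact norm_tupleSum_onWindow_le_of_lt hX hc0 hc hM (not_le.1 hXM)
    _ = c * (2 / M * (∫ X, tupleSum (windowIndicator k (n + 1)) (X.onWindow k)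
        ∂(windowLaw k ψ)).re) := by
        rw [integral_const_mul, integral_const_mul]
        congr 2
        exact integral_re hi1
    _ ≤ _ := by
        refine mul_le_mul_of_nonneg_left (mul_le_mul_of_nonneg_left ?_ (by positivity)) hc0
        rw [he1]
        exact (Complex.re_le_norm _).trans (norm_integral_corr_windowIndicator_le hψ1 k (n + 1))

lemma IsFiniteRankApprox.integrable_corr (h : IsFiniteRankApprox ψ K) (hf : Measurable f)
    (hc : ∀ x, ‖f x‖ ≤ c) (hsupp : ∀ x, f x ≠ 0 → ∀ i, x i ∈ window k) :
    Integrable f (Measure.pi fun _ => volume) ∧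
    Integrable (fun x => f x * kernelDet K x) (Measure.pi fun _ => volume) ∧
    Tendsto (fun N => ∫ x, (kernelDet (finiteKernel (ψ N)) x).re • f x
      ∂(Measure.pi fun _ => volume)) atTop
      (𝓝 (∫ x, f x * kernelDet K x ∂(Measure.pi fun _ => volume))) := by
  have hind : (univ.pi fun _ => window k).indicator f = f := by
    refine indicator_eq_self.2 fun x hx i _ => hsupp x hx i
  have hfi : Integrable f (Measure.pi fun _ => volume) := by
    rw [← hind, integrable_indicator_iff (MeasurableSet.univ_pi fun _ => measurableSet_window k)]
    exact IntegrableOn.of_bound (pi_real_univ_pi (volume_window_ne_top k) n).1.lt_top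
      hf.aestronglyMeasurable c (ae_of_all _ hc)
  refine ⟨hfi, ?_, ?_⟩
  · exact hfi.mul_bdd (c := 1) (measurable_kernelDet h.measurable_kernel).aestronglyMeasurable
      (ae_of_all _ h.norm_kernelDet_le)
  · refine tendsto_integral_of_dominated_convergence (fun x => ‖f x‖) (fun N => ?_) hfi.norm
      (fun N => ae_of_all _ fun x => ?_) (ae_of_all _ fun x => ?_)
    · exact ((Complex.measurable_re.comp (measurable_kernelDet
        (measurable_finiteKernel (h.orthonormal N).measurable))).smul hf).aestronglyMeasurable
    · rw [norm_smul]
      exact mul_le_of_le_one_left (norm_nonneg _) ((Complex.abs_re_le_norm _).trans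
        (norm_kernelDet_finiteKernel_le (h.diag_le_one N) x))
    · rw [← h.kernelDet_eq_re x, mul_comm, ← Complex.real_smul]
      exact ((Complex.continuous_re.tendsto _).comp (h.tendsto_kernelDet x)).smul_const _

/-- Convergence of the laws is available for bounded functions only, while tuple sums are unbounded.
Truncate to at most M points, let the rank index N tend to infinity, and then let M tend to infinity
using the uniform O(1/M) error. -/
lemma IsFiniteRankApprox.integral_tupleSum (h : IsFiniteRankApprox ψ K)
    (hP : ∀ k, ∀ F : Conf ℝ → ℂ, Measurable F → (∃ c : ℝ, ∀ x, ‖F x‖ ≤ c) →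
      Tendsto (fun N => ∫ X, F X ∂(windowLaw k (ψ N))) atTop (𝓝 (∫ X, F (X.onWindow k) ∂P)))
    (hf : Measurable f) (hc0 : 0 ≤ c) (hc : ∀ x, ‖f x‖ ≤ c)
    (hsupp : ∀ x, f x ≠ 0 → ∀ i, x i ∈ window k) :
    Integrable (fun X : Conf ℝ => tupleSum f (X.onWindow k)) P ∧
      ∫ X, tupleSum f (X.onWindow k) ∂P =
        ∫ x, f x * kernelDet K x ∂(Measure.pi fun _ => volume) := by
  set T : Conf ℝ → ℂ := fun X => tupleSum f (X.onWindow k) with hT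
  have hTm : Measurable T := measurable_tupleSum_onWindow k hf
  have hTw : ∀ X : Conf ℝ, T (X.onWindow k) = T X := fun X => by
    simp only [hT, Conf.onWindow_onWindow le_rfl]
  have hmem : ∀ M (X : Conf ℝ), X.onWindow k ∈ countLE k M ↔ X ∈ countLE k M := fun M X => by
    simp only [countLE, mem_ofPred_eq, Conf.onWindow_onWindow le_rfl]
  have hbd : ∀ M, ∀ X, ‖(countLE k M).indicator T X‖ ≤ c * M ^ n := by
    intro M X
    by_cases hX : X ∈ countLE k M
    · rw [indicator_of_mem hX]
      exact norm_tupleSum_onWindow_le_pow X hc0 hc hX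
    · rw [indicator_of_notMem hX, norm_zero]
      positivity
  have hindm : ∀ M, Measurable ((countLE k M).indicator T) := fun M =>
    hTm.indicator (measurableSet_countLE k M)
  have hindw : ∀ M (X : Conf ℝ), (countLE k M).indicator T (X.onWindow k) =
      (countLE k M).indicator T X := fun M X => by
    by_cases hX : X ∈ countLE k M
    · rw [indicator_of_mem hX, indicator_of_mem ((hmem M X).2 hX), hTw]
    · rw [indicator_of_notMem hX, indicator_of_notMem (mt (hmem M X).1 hX)]
  have hint : Integrable T P := by
    -- The events of at most M points exhaust the space, and the truncated absolute moments are
    -- bounded independently of M, again by passing to the limit in N.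
    refine (aecover_countLE P k).integrable_of_integral_norm_bounded
      (c * volume.real (window k) ^ n) (fun M => ?_) (Eventually.of_forall fun M => ?_)
    · rw [← integrable_indicator_iff (measurableSet_countLE k M)]
      exact Integrable.of_bound (hindm M).aestronglyMeasurable _ (ae_of_all _ (hbd M))
    · have h1 := hP k (fun X => (‖(countLE k M).indicator T X‖ : ℝ))
        (Complex.measurable_ofReal.comp (hindm M).norm) ⟨c * M ^ n, fun X => by
          rw [Complex.norm_real, norm_norm]; exact hbd M X⟩
      have h2 := (Complex.continuous_re.tendsto _).comp h1
      have h3 : (∫ X, ((‖(countLE k M).indicator T (X.onWindow k)‖ : ℝ) : ℂ) ∂P).re =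
          ∫ X in countLE k M, ‖T X‖ ∂P := by
        simp only [hindw]
        rw [integral_complex_ofReal, Complex.ofReal_re, ← integral_indicator (measurableSet_countLE k M)]
        refine integral_congr_ae (ae_of_all _ fun X => ?_)
        exact norm_indicator_eq_indicator_norm _ _
      rw [h3] at h2
      refine le_of_tendsto' h2 fun N => ?_
      have hi := (integral_tupleSum_windowLaw (h.orthonormal N) hf hc hsupp).1
      rw [Function.comp_apply, integral_complex_ofReal, Complex.ofReal_re]
      refine le_trans ?_ (integral_norm_tupleSum_le (h.orthonormal N) (h.diag_le_one N) hf hc0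
        hc hsupp)
      refine integral_mono_of_nonneg (ae_of_all _ fun X => norm_nonneg _) hi.norm
        (ae_of_all _ fun X => norm_indicator_le_norm_self _ _)
  refine ⟨hint, ?_⟩
  obtain ⟨-, -, hlim⟩ := h.integrable_corr hf hc hsupp
  have hM : ∀ M, 2 * n + 2 ≤ M → ‖∫ X in countLE k M, T X ∂P -
      ∫ x, f x * kernelDet K x ∂(Measure.pi fun _ => volume)‖ ≤
        c * (2 / M * volume.real (window k) ^ (n + 1)) := by
    intro M hM
    have h1 := hP k ((countLE k M).indicator T) (hindm M) ⟨_, hbd M⟩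
    simp only [hindw] at h1
    rw [integral_indicator (measurableSet_countLE k M)] at h1
    refine le_of_tendsto' (h1.sub hlim).norm fun N => ?_
    rw [← (integral_tupleSum_windowLaw (h.orthonormal N) hf hc hsupp).2]
    exact norm_integral_tupleSum_sub_le (h.orthonormal N) (h.diag_le_one N) hf hc0 hc hsupp hM
  refine tendsto_nhds_unique ((aecover_countLE P k).integral_tendsto_of_countably_generated hint)
    (tendsto_iff_norm_sub_tendsto_zero.2 ?_)
  refine squeeze_zero' (Eventually.of_forall fun M => norm_nonneg _)
    (eventually_atTop.2 ⟨_, hM⟩) ?_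
  have h5 : Tendsto (fun M : ℕ => (2 : ℝ) / M) atTop (𝓝 0) :=
    tendsto_const_div_atTop_nhds_zero_nat 2
  simpa using (h5.mul_const (volume.real (window k) ^ (n + 1))).const_mul c

/-- A limit of kernels of projections of finite rank is the kernel of a determinantal point
process. -/
theorem IsFiniteRankApprox.exists_isDeterminantal (h : IsFiniteRankApprox ψ K) :
    ∃ P : PointProcess ℝ, IsDeterminantal volume K P := by
  obtain ⟨P, hP, hlim⟩ := h.exists_window_limit
  have hs := ae_isSimple_of_limit h hlim
  refine ⟨⟨P, hP⟩, ⟨?_, ?_⟩⟩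
  · change ∀ᵐ X ∂P, X.IsSimple
    filter_upwards [hs] with X hX x
    obtain ⟨k, hk⟩ := exists_subset_window (Bornology.isBounded_singleton (x := x))
    have h1 := hX k x
    rwa [Conf.onWindow_apply _ _ (measurableSet_singleton x),
      inter_eq_self_of_subset_left hk] at h1
  · rintro n - f hf hfc ⟨c, hc⟩
    have hc0 : 0 ≤ c := (norm_nonneg _).trans (hc 0)
    obtain ⟨R, hR⟩ := hfc.isCompact.isBounded.subset_closedBall 0
    obtain ⟨k, hk⟩ := exists_subset_window (Metric.isBounded_closedBall (x := (0 : ℝ)) (r := R))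
    have hsupp : ∀ x, f x ≠ 0 → ∀ i, x i ∈ window k := fun x hx i => hk (by
      have h1 := hR (subset_tsupport f hx)
      rw [mem_closedBall_zero_iff] at h1 ⊢
      exact (norm_le_pi_norm x i).trans h1)
    obtain ⟨h1, h2⟩ := h.integral_tupleSum hlim hf hc0 hc hsupp
    have h3 : (fun X : Conf ℝ => X.sumDistinct n f) =ᵐ[P] fun X => tupleSum f (X.onWindow k) := by
      filter_upwards [hs] with X hX using sumDistinct_eq_tupleSum (hX k) hsupp
    refine ⟨h1.congr h3.symm, (h.integrable_corr hf hc hsupp).2.1, ?_⟩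
    exact (integral_congr_ae h3).trans h2

end Existence

end

noncomputable section

/-! ### The Fourier transform on `L¹ ∩ L²` -/

section Plancherel

open Filter
open scoped ComplexConjugate ContDiff Topology

/-- On `L¹ ∩ L²`, the `L²` Fourier transform is given by the Fourier integral. -/
theorem coeFn_fourier_toLp {f : ℝ → ℂ} (h1 : Integrable f) (h2 : MemLp f 2) :
    ((𝓕 (h2.toLp f) : Lp ℂ 2 (volume : Measure ℝ)) : ℝ → ℂ) =ᵐ[volume] 𝓕 f := by
  have hcont : Continuous (𝓕 f) :=
    VectorFourier.fourierIntegral_continuous Real.continuous_fourierChar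
      (by exact continuous_inner) h1
  refine ae_eq_of_integral_contDiff_smul_eq
    ((Lp.memLp (𝓕 (h2.toLp f) : Lp ℂ 2 (volume : Measure ℝ))).locallyIntegrable (by norm_num))
    hcont.locallyIntegrable fun g hg hgs => ?_
  have hGs : HasCompactSupport fun x => (g x : ℂ) := hgs.comp_left (g := fun t : ℝ => (t : ℂ)) rfl
  have hG : ContDiff ℝ ∞ fun x => (g x : ℂ) := Complex.ofRealCLM.contDiff.comp hg
  set G : SchwartzMap ℝ ℂ := hGs.toSchwartzMap hG with hGdef
  have hGa : ∀ x, G x = (g x : ℂ) := fun x => rfl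
  -- As a tempered distribution, the L² transform of f acts on g by pairing f with 𝓕 g. The
  -- multiplication formula for integrable functions identifies this with the pairing of 𝓕 f and g.
  have e := congrArg (fun T : TemperedDistribution ℝ ℂ => T G)
    (Lp.fourier_toTemperedDistribution_eq (h2.toLp f))
  simp only [TemperedDistribution.fourier_apply, Lp.toTemperedDistribution_apply] at e
  have e1 : ∀ h : ℝ → ℂ, ∫ x, g x • h x = ∫ x, G x • h x := fun h => by
    refine integral_congr_ae (Eventually.of_forall fun x => ?_)
    simp [hGa]
  rw [e1, e1, ← e]
  have e2 : ∫ x, (𝓕 G) x • (h2.toLp f) x = ∫ x, (𝓕 G) x • f x := by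
    refine integral_congr_ae ?_
    filter_upwards [h2.coeFn_toLp] with x hx
    rw [hx]
  rw [e2, SchwartzMap.fourier_coe]
  have := VectorFourier.integral_fourierIntegral_smul_eq_flip (f := G) (g := f)
    (μ := volume) (ν := volume) (L := innerₗ ℝ) Real.continuous_fourierChar
    (by exact continuous_inner) G.integrable h1
  rw [flip_innerₗ] at this
  exact this

theorem continuous_fourier_of_integrable {f : ℝ → ℂ} (h1 : Integrable f) : Continuous (𝓕 f) :=
  VectorFourier.fourierIntegral_continuous Real.continuous_fourierChar
    (by exact continuous_inner) h1

theorem memLp_two_fourier {f : ℝ → ℂ} (h1 : Integrable f) (h2 : MemLp f 2) :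
    MemLp (𝓕 f) 2 :=
  (memLp_congr_ae (coeFn_fourier_toLp h1 h2)).1 (Lp.memLp _)

/-- Parseval's identity for functions in `L¹ ∩ L²`. -/
theorem integral_conj_fourier_mul {f g : ℝ → ℂ} (hf1 : Integrable f) (hf2 : MemLp f 2)
    (hg1 : Integrable g) (hg2 : MemLp g 2) :
    ∫ x, conj (𝓕 f x) * 𝓕 g x = ∫ x, conj (f x) * g x := by
  have h := Lp.inner_fourier_eq (hf2.toLp f) (hg2.toLp g)
  rw [L2.inner_def, L2.inner_def] at h
  simp only [RCLike.inner_apply'] at h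
  calc ∫ x, conj (𝓕 f x) * 𝓕 g x
      = ∫ x, conj ((𝓕 (hf2.toLp f) : Lp ℂ 2 (volume : Measure ℝ)) x) *
          (𝓕 (hg2.toLp g) : Lp ℂ 2 (volume : Measure ℝ)) x := by
        refine integral_congr_ae ?_
        filter_upwards [coeFn_fourier_toLp hf1 hf2, coeFn_fourier_toLp hg1 hg2] with x h1 h2
        rw [h1, h2]
    _ = ∫ x, conj (hf2.toLp f x) * hg2.toLp g x := h
    _ = _ := by
        refine integral_congr_ae ?_
        filter_upwards [hf2.coeFn_toLp, hg2.coeFn_toLp] with x h1 h2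
        rw [h1, h2]

theorem integrable_conj_fourier_mul {f g : ℝ → ℂ} (hf1 : Integrable f) (hf2 : MemLp f 2)
    (hg1 : Integrable g) (hg2 : MemLp g 2) :
    Integrable fun x => conj (𝓕 f x) * 𝓕 g x :=
  MemLp.integrable_mul (memLp_two_fourier hf1 hf2).star (memLp_two_fourier hg1 hg2)

/-- The Fourier transform of an indicator function as an integral. -/
theorem fourier_indicator_eq {M : Set ℝ} (hM : MeasurableSet M) (f : ℝ → ℂ) (x : ℝ) :
    𝓕 (M.indicator f) x = ∫ t in M, Complex.exp (↑(-2 * Real.pi * (t * x)) * Complex.I) * f t := by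
  rw [Real.fourier_eq', ← integral_indicator hM]
  congr 1
  ext t
  by_cases ht : t ∈ M
  · simp only [indicator_of_mem ht, smul_eq_mul, RCLike.inner_apply, conj_trivial]
    rw [mul_comm t x]
  · simp [indicator_of_notMem ht]

theorem integral_norm_sq_fourier_indicator {M : Set ℝ} (hM : MeasurableSet M)
    (hf : volume M ≠ ⊤) :
    ∫ x, ‖𝓕 (M.indicator fun _ => (1 : ℂ)) x‖ ^ 2 = volume.real M := by
  have h1 : Integrable (M.indicator fun _ => (1 : ℂ)) :=
    (integrable_indicator_iff hM).2 (integrableOn_const hf)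
  have h2 : MemLp (M.indicator fun _ => (1 : ℂ)) 2 := memLp_indicator_const 2 hM 1 (Or.inr hf)
  have e := integral_conj_fourier_mul h1 h2 h1 h2
  have e1 : ∀ z : ℂ, conj z * z = ((‖z‖ ^ 2 : ℝ) : ℂ) := fun z => by
    rw [mul_comm, Complex.mul_conj, Complex.normSq_eq_norm_sq]
  simp only [e1] at e
  rw [integral_complex_ofReal, integral_complex_ofReal] at e
  rw [Complex.ofReal_injective e]
  have : (fun x => ‖M.indicator (fun _ => (1 : ℂ)) x‖ ^ 2) = M.indicator fun _ => (1 : ℝ) := by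
    ext x
    by_cases hx : x ∈ M <;> simp [hx]
  rw [this, integral_indicator hM]
  simp

theorem integrable_norm_sq_fourier_indicator {M : Set ℝ} (hM : MeasurableSet M)
    (hf : volume M ≠ ⊤) :
    Integrable fun x => ‖𝓕 (M.indicator fun _ => (1 : ℂ)) x‖ ^ 2 := by
  have h1 : Integrable (M.indicator fun _ => (1 : ℂ)) :=
    (integrable_indicator_iff hM).2 (integrableOn_const hf)
  have h2 : MemLp (M.indicator fun _ => (1 : ℂ)) 2 := memLp_indicator_const 2 hM 1 (Or.inr hf)
  have := memLp_two_fourier h1 h2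
  exact (memLp_two_iff_integrable_sq_norm this.1).1 this

end Plancherel

/-! ### The kernel K_M as Gram kernel of exponentials, and its finite rank approximation. -/

section Approximation

open Filter
open scoped ComplexConjugate Topology

/-- An orthonormal family in a separable inner product space is countable. -/
theorem Orthonormal.countable_of_separable {H ι : Type*} [NormedAddCommGroup H]
    [InnerProductSpace ℂ H] [TopologicalSpace.SeparableSpace H] {b : ι → H}
    (hb : Orthonormal ℂ b) : Countable ι := by
  have hd : Set.PairwiseDisjoint (univ : Set ι) fun i => Metric.ball (b i) (1 / 2) := by
    -- Distinct orthonormal vectors are at distance √2 > 1, so balls of radius 1/2 around them are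
    -- disjoint.
    intro i _ j _ hij
    refine Metric.ball_disjoint_ball ?_
    have h : ‖b i - b j‖ ^ 2 = 2 := by
      rw [@norm_sub_sq ℂ, hb.1 i, hb.1 j, hb.2 hij]
      norm_num
    rw [dist_eq_norm]
    nlinarith [norm_nonneg (b i - b j)]
  have := hd.countable_of_isOpen (fun i _ => Metric.isOpen_ball)
    (fun i _ => ⟨b i, Metric.mem_ball_self (by norm_num)⟩)
  exact countable_univ_iff.1 this

variable {M : Set ℝ}

/-- The exponential `t ↦ e^{2πixt}` as an element of `L²(M)`. -/
def expLp (M : Set ℝ) [IsFiniteMeasure (volume.restrict M)] (x : ℝ) :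
    Lp ℂ 2 (volume.restrict M) :=
  MemLp.toLp (fun t : ℝ => Complex.exp (↑(2 * Real.pi * (t * x)) * Complex.I))
    (MemLp.of_bound (by fun_prop) 1 (Eventually.of_forall fun t => by
      rw [Complex.norm_exp_ofReal_mul_I]))

variable [IsFiniteMeasure (volume.restrict M)]

theorem conj_exp_ofReal_mul_I (s : ℝ) :
    conj (Complex.exp ((s : ℂ) * Complex.I)) = Complex.exp (↑(-s) * Complex.I) := by
  rw [← Complex.exp_conj]
  simp

theorem inner_expLp (hM : MeasurableSet M) (x : ℝ) (f : Lp ℂ 2 (volume.restrict M)) :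
    inner ℂ (expLp M x) f = 𝓕 (M.indicator f) x := by
  rw [L2.inner_def, fourier_indicator_eq hM]
  refine integral_congr_ae ?_
  filter_upwards [MemLp.coeFn_toLp (μ := volume.restrict M) (p := 2)
    (f := fun t : ℝ => Complex.exp (↑(2 * Real.pi * (t * x)) * Complex.I))
    (MemLp.of_bound (by fun_prop) 1 (Eventually.of_forall fun t => by
      rw [Complex.norm_exp_ofReal_mul_I]))] with t ht
  rw [expLp, ht, RCLike.inner_apply', conj_exp_ofReal_mul_I]
  congr 4
  ring

/-- This makes Parseval's identity in any Hilbert basis of L²(M) an expansion of K_M into rank one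
kernels. -/
theorem inner_expLp_expLp (hM : MeasurableSet M) (x y : ℝ) :
    inner ℂ (expLp M x) (expLp M y) = fourierKernel M x y := by
  rw [fourierKernel, inner_expLp hM, fourier_indicator_eq hM, fourier_indicator_eq hM]
  refine integral_congr_ae ?_
  filter_upwards [MemLp.coeFn_toLp (μ := volume.restrict M) (p := 2)
    (f := fun t : ℝ => Complex.exp (↑(2 * Real.pi * (t * y)) * Complex.I))
    (MemLp.of_bound (by fun_prop) 1 (Eventually.of_forall fun t => by
      rw [Complex.norm_exp_ofReal_mul_I]))] with t ht
  rw [expLp, ht, ← Complex.exp_add, mul_one]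
  congr 1
  push_cast
  ring

theorem memLp_indicator_coeFn {M : Set ℝ} (hM : MeasurableSet M)
    (f : Lp ℂ 2 (volume.restrict M)) :
    MemLp (M.indicator f) 2 :=
  (memLp_indicator_iff_restrict hM).2 (Lp.memLp f)

theorem integrable_indicator_coeFn (hM : MeasurableSet M) (f : Lp ℂ 2 (volume.restrict M)) :
    Integrable (M.indicator f) :=
  (integrable_indicator_iff hM).2 ((Lp.memLp f).integrable (by norm_num))

/-- The kernel `K_M` is a limit of finite rank projection kernels. -/
theorem exists_isFiniteRankApprox_fourierKernel (hM : MeasurableSet M) (h1 : volume M ≤ 1) :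
    ∃ (d : ℕ → ℕ) (ψ : ∀ N, Fin (d N) → ℝ → ℂ), IsFiniteRankApprox ψ (fourierKernel M) := by
  classical
  obtain ⟨w, b, -⟩ := exists_hilbertBasis ℂ (Lp ℂ 2 (volume.restrict M))
  have : Fact ((1 : ℝ≥0∞) ≤ 2) := ⟨by norm_num⟩
  have : Fact ((2 : ℝ≥0∞) ≠ ∞) := ⟨by norm_num⟩
  have : Countable w := b.orthonormal.countable_of_separable
  -- The basis is countable, so convergence along finite subsets can be followed along a sequence of
  -- them.
  obtain ⟨s, hs⟩ := Filter.exists_seq_tendsto (atTop : Filter (Finset w))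
  -- The basis vectors are extended by zero and Fourier transformed; by Parseval they stay
  -- orthonormal, now in L²(ℝ).
  set ψ : ∀ N, Fin (s N).card → ℝ → ℂ := fun N k =>
    𝓕 (M.indicator (b ((s N).equivFin.symm k))) with hψ
  have hsum : ∀ N x y, finiteKernel (ψ N) x y =
      ∑ i ∈ s N, inner ℂ (expLp M x) (b i) * inner ℂ (b i) (expLp M y) := by
    intro N x y
    rw [finiteKernel, ← Finset.sum_coe_sort (s N), ← (s N).equivFin.symm.sum_comp]
    refine Finset.sum_congr rfl fun k _ => ?_
    rw [inner_expLp hM, ← inner_conj_symm (b _) (expLp M y), inner_expLp hM]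
  refine ⟨fun N => (s N).card, ψ, ⟨fun N => ⟨fun k => ?_, fun k l => ?_, fun k l => ?_⟩,
    fun N x => ?_, fun x y => ?_⟩⟩
  · exact (continuous_fourier_of_integrable (integrable_indicator_coeFn hM _)).measurable
  · exact integrable_conj_fourier_mul (integrable_indicator_coeFn hM _)
      (memLp_indicator_coeFn hM _) (integrable_indicator_coeFn hM _) (memLp_indicator_coeFn hM _)
  · rw [integral_conj_fourier_mul (integrable_indicator_coeFn hM _)
      (memLp_indicator_coeFn hM _) (integrable_indicator_coeFn hM _) (memLp_indicator_coeFn hM _)]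
    have e : (fun x => conj (M.indicator (b ((s N).equivFin.symm k)) x) *
        M.indicator (b ((s N).equivFin.symm l)) x) = M.indicator fun x =>
          conj (b ((s N).equivFin.symm k) x) * b ((s N).equivFin.symm l) x := by
      ext x
      by_cases hx : x ∈ M <;> simp [hx]
    rw [e, integral_indicator hM]
    have h := orthonormal_iff_ite.1 b.orthonormal ((s N).equivFin.symm k) ((s N).equivFin.symm l)
    rw [L2.inner_def] at h
    simp only [RCLike.inner_apply'] at h
    rw [h]
    simp
  · rw [hsum]
    -- Bessel's inequality bounds the diagonal by the squared norm of the exponential, which is m(M)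
    -- ≤ 1.
    have hb := b.orthonormal.sum_inner_products_le (s := s N) (expLp M x)
    have e : ∀ i, inner ℂ (expLp M x) (b i) * inner ℂ (b i) (expLp M x) =
        ((‖inner ℂ (b i) (expLp M x)‖ ^ 2 : ℝ) : ℂ) := fun i => by
      rw [← inner_conj_symm (expLp M x), mul_comm, Complex.mul_conj, Complex.normSq_eq_norm_sq]
    simp only [e]
    rw [← Complex.ofReal_sum, Complex.ofReal_re]
    refine hb.trans ?_
    rw [← @inner_self_eq_norm_sq ℂ, inner_expLp_expLp hM, fourierKernel, sub_self,
      fourier_indicator_eq hM]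
    simp only [mul_zero, Complex.ofReal_zero, zero_mul, Complex.exp_zero, mul_one]
    simp only [integral_const, measureReal_restrict_apply_univ]
    simp only [Complex.real_smul, mul_one, RCLike.re_to_complex, Complex.ofReal_re]
    exact ENNReal.toReal_le_of_le_ofReal zero_le_one (by simpa using h1)
  · simp only [hsum, ← inner_expLp_expLp hM]
    exact (b.hasSum_inner_mul_inner (expLp M x) (expLp M y)).comp hs

end Approximation

/-- Determinantal point processes with kernel `K_M` exist. -/
theorem exists_isDeterminantal_fourierKernel {M : Set ℝ} (hM : MeasurableSet M)
    (h1 : volume M ≤ 1) : ∃ P : PointProcess ℝ, IsDeterminantal volume (fourierKernel M) P := by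
  have : IsFiniteMeasure (volume.restrict M) :=
    ⟨by rw [Measure.restrict_apply_univ]; exact h1.trans_lt ENNReal.one_lt_top⟩
  obtain ⟨d, ψ, h⟩ := exists_isFiniteRankApprox_fourierKernel hM h1
  exact h.exists_isDeterminantal

end

noncomputable section

/-! ### First and second moments of linear statistics -/

section LinearStatistics

open Filter
open scoped ComplexConjugate Topology

/-- Measurable functions with compact support and values in `[0, 1]`. -/
structure IsTestFunction (φ : ℝ → ℝ) : Prop where
  measurable : Measurable φ
  hasCompactSupport : HasCompactSupport φ
  nonneg : ∀ x, 0 ≤ φ x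
  le_one : ∀ x, φ x ≤ 1

lemma IsTestFunction.norm_le_one {φ : ℝ → ℝ} (h : IsTestFunction φ) (x : ℝ) : ‖φ x‖ ≤ 1 := by
  rw [Real.norm_of_nonneg (h.nonneg x)]
  exact h.le_one x

lemma IsTestFunction.sq {φ : ℝ → ℝ} (h : IsTestFunction φ) :
    IsTestFunction fun x => φ x ^ 2 where
  measurable := h.measurable.pow_const 2
  hasCompactSupport := h.hasCompactSupport.comp_left (g := fun t : ℝ => t ^ 2) (by simp)
  nonneg x := sq_nonneg _
  le_one x := pow_le_one₀ (h.nonneg x) (h.le_one x)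

lemma IsTestFunction.integrable {φ : ℝ → ℝ} (h : IsTestFunction φ) {μ : Measure ℝ}
    (hμ : ∀ K : Set ℝ, IsCompact K → μ K < ⊤) : Integrable φ μ := by
  have hs : Function.support φ ⊆ tsupport φ := subset_tsupport φ
  rw [← integrableOn_iff_integrable_of_support_subset hs]
  exact Measure.integrableOn_of_bounded (M := 1) (hμ _ h.hasCompactSupport).ne
    h.measurable.aestronglyMeasurable (Eventually.of_forall h.norm_le_one)

lemma IsTestFunction.integrable_volume {φ : ℝ → ℝ} (h : IsTestFunction φ) :
    Integrable φ := h.integrable fun _ hK => hK.measure_lt_top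

lemma IsTestFunction.integrable_conf {φ : ℝ → ℝ} (h : IsTestFunction φ) (X : Conf ℝ) :
    Integrable φ X.1 := h.integrable X.2.2

/-- The linear statistic of `φ`. -/
def linearStatistic (φ : ℝ → ℝ) (X : Conf ℝ) : ℝ := ∫ x, φ x ∂X.1

lemma linearStatistic_eq_sum {φ : ℝ → ℝ} {k : ℕ} (hφ : Function.support φ ⊆ window k)
    {X : Conf ℝ} {m : ℕ} {y : Fin m → ℝ} (h : X.onWindow k = Conf.ofFinset y Finset.univ) :
    linearStatistic φ X = ∑ i, φ (y i) := by
  rw [linearStatistic, ← setIntegral_eq_integral_of_forall_compl_eq_zero (s := window k)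
    (fun x hx => by_contra fun h => hx (hφ h))]
  have e : X.1.restrict (window k) = ∑ i, Measure.dirac (y i) := congrArg Subtype.val h
  rw [e, integral_finsetSum_measure]
  · simp
  · intro i _
    exact integrable_dirac (by simp)

lemma Conf.IsSimple.sumDistinct_one {X : Conf ℝ} (hX : X.IsSimple) {φ : ℝ → ℝ}
    (hc : HasCompactSupport φ) :
    X.sumDistinct 1 (fun x => (φ (x 0) : ℂ)) = linearStatistic φ X := by
  obtain ⟨k, hk⟩ := exists_subset_window hc.isCompact.isBounded
  obtain ⟨m, y, -, h⟩ := X.exists_onWindow_eq_ofFinset k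
  have hinj : Function.Injective y := (Conf.isSimple_ofFinset_iff y).1
    (h ▸ hX.restrict (measurableSet_window k))
  have hφ := (subset_tsupport φ).trans hk
  rw [linearStatistic_eq_sum hφ h, ← Conf.sumDistinct_restrict X (measurableSet_window k),
    ← Conf.onWindow, h, Conf.sumDistinct_ofFinset hinj,
    ← Equiv.uniqueEmbeddingEquivResult.symm.sum_comp]
  · push_cast
    rfl
  · intro x hx i
    rw [Subsingleton.elim i 0]
    exact hφ (by simpa using hx)

/-- The square of the sum runs over all ordered pairs of points; removing the diagonal pairs removes
the sum of the squares. -/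
lemma Conf.IsSimple.sumDistinct_two {X : Conf ℝ} (hX : X.IsSimple) {φ : ℝ → ℝ}
    (hc : HasCompactSupport φ) :
    X.sumDistinct 2 (fun x => (φ (x 0) * φ (x 1) : ℂ)) =
      (linearStatistic φ X ^ 2 - linearStatistic (fun x => φ x ^ 2) X : ℝ) := by
  classical
  obtain ⟨k, hk⟩ := exists_subset_window hc.isCompact.isBounded
  obtain ⟨m, y, -, h⟩ := X.exists_onWindow_eq_ofFinset k
  have hinj : Function.Injective y := (Conf.isSimple_ofFinset_iff y).1
    (h ▸ hX.restrict (measurableSet_window k))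
  have hφ := (subset_tsupport φ).trans hk
  rw [linearStatistic_eq_sum hφ h, linearStatistic_eq_sum (φ := fun x => φ x ^ 2)
    (fun x hx => hφ (by simpa using hx)) h,
    ← Conf.sumDistinct_restrict X (measurableSet_window k),
    ← Conf.onWindow, h, Conf.sumDistinct_ofFinset hinj]
  · let E : (Fin 2 ↪ Fin m) ≃ {p : Fin m × Fin m // p.1 ≠ p.2} :=
      { toFun := fun e => ⟨(e 0, e 1), fun h => by simpa using e.injective h⟩
        invFun := fun p => ⟨![p.1.1, p.1.2], fun i j hij => by
          have := p.2
          fin_cases i <;> fin_cases j <;> simp_all [eq_comm]⟩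
        left_inv := fun e => by
          ext i
          fin_cases i <;> rfl
        right_inv := fun p => rfl }
    have e1 : ∑ e : Fin 2 ↪ Fin m, ((φ ((y ∘ e) 0) : ℂ) * (φ ((y ∘ e) 1) : ℂ)) =
        ∑ p : {p : Fin m × Fin m // p.1 ≠ p.2}, ((φ (y p.1.1) : ℂ) * (φ (y p.1.2) : ℂ)) :=
      Fintype.sum_equiv E _ _ fun e => rfl
    rw [e1, ← Finset.sum_subtype (Finset.univ.filter fun p : Fin m × Fin m => p.1 ≠ p.2)
      (fun p => by simp) (fun p : Fin m × Fin m => ((φ (y p.1) : ℂ) * (φ (y p.2) : ℂ)))]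
    have e2 := Finset.sum_filter_add_sum_filter_not Finset.univ
      (fun p : Fin m × Fin m => p.1 ≠ p.2) (fun p => ((φ (y p.1) : ℂ) * (φ (y p.2) : ℂ)))
    have e3 : ∑ p ∈ Finset.univ.filter (fun p : Fin m × Fin m => ¬ p.1 ≠ p.2),
        ((φ (y p.1) : ℂ) * (φ (y p.2) : ℂ)) = ∑ i, (φ (y i) : ℂ) ^ 2 := by
      rw [Finset.sum_filter, Fintype.sum_prod_type]
      refine Finset.sum_congr rfl fun i _ => ?_
      simp [sq]
    rw [e3, Fintype.sum_prod_type] at e2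
    rw [eq_sub_of_add_eq e2]
    push_cast
    rw [sq, Finset.sum_mul_sum]
  · intro x hx i
    have h0 : φ (x 0) ≠ 0 := fun h => hx (by simp [h])
    have h1 : φ (x 1) ≠ 0 := fun h => hx (by simp [h])
    fin_cases i
    · exact hφ h0
    · exact hφ h1

variable {K : ℝ → ℝ → ℂ} {P : PointProcess ℝ}

/-- The first moment of a linear statistic. -/
lemma IsDeterminantal.integral_linearStatistic (hP : IsDeterminantal volume K P) {φ : ℝ → ℝ}
    (hφ : IsTestFunction φ) :
    Integrable (linearStatistic φ) (P : Measure (Conf ℝ)) ∧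
      ((∫ X, linearStatistic φ X ∂(P : Measure (Conf ℝ)) : ℝ) : ℂ) =
        ∫ x, (φ x : ℂ) * K x x := by
  have hc : HasCompactSupport fun x : Fin 1 → ℝ => (φ (x 0) : ℂ) := by
    refine HasCompactSupport.intro (isCompact_univ_pi fun _ => hφ.hasCompactSupport.isCompact)
      fun x hx => ?_
    have : x 0 ∉ tsupport φ := fun h => hx fun i _ => by rwa [Subsingleton.elim i 0]
    simp [image_eq_zero_of_notMem_tsupport this]
  obtain ⟨h1, -, h3⟩ := hP.correlation 1 le_rfl (fun x => (φ (x 0) : ℂ))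
    (Complex.measurable_ofReal.comp (hφ.measurable.comp (measurable_pi_apply 0))) hc
    ⟨1, fun x => by simpa using hφ.norm_le_one (x 0)⟩
  have hae : (fun X : Conf ℝ => X.sumDistinct 1 fun x => (φ (x 0) : ℂ)) =ᵐ[(P : Measure (Conf ℝ))]
      fun X => ((linearStatistic φ X : ℝ) : ℂ) := by
    filter_upwards [hP.simple] with X hX
    exact hX.sumDistinct_one hφ.hasCompactSupport
  rw [integrable_congr hae] at h1
  rw [integral_congr_ae hae, integral_complex_ofReal] at h3
  refine ⟨by simpa using h1.re, h3.trans ?_⟩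
  rw [← (measurePreserving_funUnique volume (Fin 1)).integral_comp'
    (g := fun x => (φ x : ℂ) * K x x)]
  simp only [Matrix.det_fin_one, Matrix.of_apply]
  rfl

/-- The second moment of a linear statistic. -/
lemma IsDeterminantal.integral_linearStatistic_sq (hP : IsDeterminantal volume K P) {φ : ℝ → ℝ}
    (hφ : IsTestFunction φ) :
    Integrable (fun X => linearStatistic φ X ^ 2) (P : Measure (Conf ℝ)) ∧
      ((∫ X, linearStatistic φ X ^ 2 ∂(P : Measure (Conf ℝ)) : ℝ) : ℂ) =
        (∫ x, ((φ x ^ 2 : ℝ) : ℂ) * K x x) +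
        ∫ p : ℝ × ℝ, ((φ p.1 : ℂ) * φ p.2) * (K p.1 p.1 * K p.2 p.2 - K p.1 p.2 * K p.2 p.1) := by
  have hc : HasCompactSupport fun x : Fin 2 → ℝ => (φ (x 0) * φ (x 1) : ℂ) := by
    refine HasCompactSupport.intro (isCompact_univ_pi fun _ => hφ.hasCompactSupport.isCompact)
      fun x hx => ?_
    by_contra h
    refine hx fun i _ => ?_
    fin_cases i
    · exact subset_tsupport φ fun h0 => h (by
        have h0 : φ (x 0) = 0 := h0
        simp [h0])
    · exact subset_tsupport φ fun h0 => h (by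
        have h0 : φ (x 1) = 0 := h0
        simp [h0])
  obtain ⟨h1, -, h3⟩ := hP.correlation 2 (by norm_num) (fun x => (φ (x 0) * φ (x 1) : ℂ))
    ((Complex.measurable_ofReal.comp (hφ.measurable.comp (measurable_pi_apply 0))).mul
      (Complex.measurable_ofReal.comp (hφ.measurable.comp (measurable_pi_apply 1)))) hc
    ⟨1, fun x => by
      rw [norm_mul]
      exact mul_le_one₀ (by simpa using hφ.norm_le_one (x 0)) (norm_nonneg _)
        (by simpa using hφ.norm_le_one (x 1))⟩
  obtain ⟨g1, g2⟩ := hP.integral_linearStatistic hφ.sq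
  have hae : (fun X : Conf ℝ => X.sumDistinct 2 fun x => (φ (x 0) * φ (x 1) : ℂ))
      =ᵐ[(P : Measure (Conf ℝ))]
      fun X => ((linearStatistic φ X ^ 2 - linearStatistic (fun x => φ x ^ 2) X : ℝ) : ℂ) := by
    filter_upwards [hP.simple] with X hX
    exact hX.sumDistinct_two hφ.hasCompactSupport
  rw [integrable_congr hae] at h1
  rw [integral_congr_ae hae, integral_complex_ofReal] at h3
  have h1' : Integrable (fun X => linearStatistic φ X ^ 2 -
      linearStatistic (fun x => φ x ^ 2) X) (P : Measure (Conf ℝ)) := h1.re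
  have h4 : Integrable (fun X => linearStatistic φ X ^ 2) (P : Measure (Conf ℝ)) := by
    refine (h1'.add g1).congr (Eventually.of_forall fun X => ?_)
    simp
  refine ⟨h4, ?_⟩
  rw [integral_sub h4 g1] at h3
  have h5 : ((∫ X, linearStatistic φ X ^ 2 ∂(P : Measure (Conf ℝ)) : ℝ) : ℂ) =
      ((∫ X, linearStatistic (fun x => φ x ^ 2) X ∂(P : Measure (Conf ℝ)) : ℝ) : ℂ) +
      ∫ x : Fin 2 → ℝ, (φ (x 0) * φ (x 1) : ℂ) *
        (Matrix.of fun i j => K (x i) (x j)).det ∂(Measure.pi fun _ => volume) := by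
    rw [← h3]
    push_cast
    ring
  rw [h5, g2, Measure.volume_eq_prod, ← (measurePreserving_finTwoArrow (volume : Measure ℝ)).integral_comp'
    (g := fun p : ℝ × ℝ => ((φ p.1 : ℂ) * φ p.2) *
      (K p.1 p.1 * K p.2 p.2 - K p.1 p.2 * K p.2 p.1))]
  simp only [Matrix.det_fin_two, Matrix.of_apply]
  rfl

end LinearStatistics

end

noncomputable section

/-! ### The variance of a linear statistic -/

section Variance

open Filter
open scoped ComplexConjugate Topology

/-- Half the squared `L²` modulus of continuity, `½ ∫ (φ(x) - φ(x - u))² dx`. -/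
def shiftEnergy (φ : ℝ → ℝ) (u : ℝ) : ℝ := (1 / 2) * ∫ x, (φ x - φ (x - u)) ^ 2

/-- The Fourier transform of the indicator function of `M`. -/
def indicatorFourier (M : Set ℝ) (u : ℝ) : ℂ := 𝓕 (M.indicator fun _ => (1 : ℂ)) u

variable {φ : ℝ → ℝ}

lemma shiftEnergy_nonneg (φ : ℝ → ℝ) (u : ℝ) : 0 ≤ shiftEnergy φ u :=
  mul_nonneg (by norm_num) (integral_nonneg fun _ => sq_nonneg _)

lemma IsTestFunction.comp_sub (h : IsTestFunction φ) (u : ℝ) :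
    IsTestFunction fun x => φ (x - u) where
  measurable := h.measurable.comp (measurable_id.sub_const u)
  hasCompactSupport := h.hasCompactSupport.comp_homeomorph (Homeomorph.subRight u)
  nonneg _ := h.nonneg _
  le_one _ := h.le_one _

lemma IsTestFunction.mul {ψ : ℝ → ℝ} (h : IsTestFunction φ) (h' : IsTestFunction ψ) :
    IsTestFunction fun x => φ x * ψ x where
  measurable := h.measurable.mul h'.measurable
  hasCompactSupport := h.hasCompactSupport.mul_right
  nonneg x := mul_nonneg (h.nonneg x) (h'.nonneg x)
  le_one x := mul_le_one₀ (h.le_one x) (h'.nonneg x) (h'.le_one x)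

lemma IsTestFunction.shiftEnergy_eq (h : IsTestFunction φ) (u : ℝ) :
    shiftEnergy φ u = (∫ x, φ x ^ 2) - ∫ x, φ x * φ (x - u) := by
  have i1 := h.sq.integrable_volume
  have i2 := (h.comp_sub u).sq.integrable_volume
  have i3 := (h.mul (h.comp_sub u)).integrable_volume
  have e : ∀ x, (φ x - φ (x - u)) ^ 2 = φ x ^ 2 + φ (x - u) ^ 2 - 2 * (φ x * φ (x - u)) :=
    fun x => by ring
  simp only [shiftEnergy, e]
  have i12 : Integrable fun x => φ x ^ 2 + φ (x - u) ^ 2 := i1.add i2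
  rw [integral_sub i12 (i3.const_mul 2), integral_add i1 i2, integral_const_mul,
    integral_sub_right_eq_self (fun x => φ x ^ 2) u]
  ring

lemma IsTestFunction.shiftEnergy_le (h : IsTestFunction φ) (u : ℝ) :
    shiftEnergy φ u ≤ ∫ x, φ x ^ 2 := by
  rw [h.shiftEnergy_eq]
  linarith [integral_nonneg (f := fun x => φ x * φ (x - u)) (μ := volume)
    fun x => mul_nonneg (h.nonneg x) (h.nonneg _)]

lemma IsTestFunction.measurable_shiftEnergy (h : IsTestFunction φ) :
    Measurable (shiftEnergy φ) := by
  have : Measurable fun p : ℝ × ℝ => (φ p.2 - φ (p.2 - p.1)) ^ 2 :=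
    ((h.measurable.comp measurable_snd).sub
      (h.measurable.comp (measurable_snd.sub measurable_fst))).pow_const 2
  exact (this.stronglyMeasurable.integral_prod_right (ν := volume)).measurable.const_mul (1 / 2)

variable {M : Set ℝ}

lemma integrable_indicator_one (hM : MeasurableSet M) (hf : volume M ≠ ⊤) :
    Integrable (M.indicator fun _ => (1 : ℂ)) :=
  (integrable_indicator_iff hM).2 (integrableOn_const hf)

lemma continuous_indicatorFourier (hM : MeasurableSet M) (hf : volume M ≠ ⊤) :
    Continuous (indicatorFourier M) :=
  continuous_fourier_of_integrable (integrable_indicator_one hM hf)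

lemma indicatorFourier_zero (hM : MeasurableSet M) :
    indicatorFourier M 0 = volume.real M := by
  simp [indicatorFourier, fourier_indicator_eq hM]

lemma indicatorFourier_neg (hM : MeasurableSet M) (u : ℝ) :
    indicatorFourier M (-u) = conj (indicatorFourier M u) := by
  rw [indicatorFourier, indicatorFourier, fourier_indicator_eq hM, fourier_indicator_eq hM,
    ← integral_conj]
  congr 1
  ext t
  rw [map_mul, conj_exp_ofReal_mul_I, map_one]
  congr 4
  ring

lemma norm_indicatorFourier_le (hM : MeasurableSet M) (u : ℝ) :
    ‖indicatorFourier M u‖ ≤ volume.real M := by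
  rw [indicatorFourier, fourier_indicator_eq hM]
  refine (norm_integral_le_integral_norm _).trans ?_
  simp only [mul_one, Complex.norm_exp_ofReal_mul_I]
  simp

lemma fourierKernel_self (hM : MeasurableSet M) (x : ℝ) :
    fourierKernel M x x = volume.real M := by
  rw [fourierKernel, sub_self]
  exact indicatorFourier_zero hM

lemma fourierKernel_mul_swap (hM : MeasurableSet M) (x y : ℝ) :
    fourierKernel M x y * fourierKernel M y x = ((‖indicatorFourier M (x - y)‖ ^ 2 : ℝ) : ℂ) := by
  have : fourierKernel M y x = conj (indicatorFourier M (x - y)) := by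
    rw [← indicatorFourier_neg hM, neg_sub]
    rfl
  rw [this, ← Complex.normSq_eq_norm_sq, ← Complex.mul_conj]
  rfl

/-- The mean of a linear statistic. -/
lemma integral_linearStatistic_fourierKernel {P : PointProcess ℝ} (hM : MeasurableSet M)
    (hP : IsDeterminantal volume (fourierKernel M) P) (hφ : IsTestFunction φ) :
    ∫ X, linearStatistic φ X ∂(P : Measure (Conf ℝ)) = volume.real M * ∫ x, φ x := by
  have h := (hP.integral_linearStatistic hφ).2
  simp only [fourierKernel_self hM] at h
  rw [integral_mul_const, integral_complex_ofReal] at h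
  have h' : ((∫ X, linearStatistic φ X ∂(P : Measure (Conf ℝ)) : ℝ) : ℂ) =
      ((volume.real M * ∫ x, φ x : ℝ) : ℂ) := by
    rw [h]
    push_cast
    ring
  exact Complex.ofReal_injective h'

lemma integrable_mul_norm_sq_indicatorFourier (hM : MeasurableSet M) (hf : volume M ≠ ⊤)
    (hφ : IsTestFunction φ) : Integrable fun p : ℝ × ℝ =>
      (φ p.1 * φ p.2) * ‖indicatorFourier M (p.1 - p.2)‖ ^ 2 := by
  refine (hφ.integrable_volume.mul_prod hφ.integrable_volume).mul_bdd (c := volume.real M ^ 2)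
    ?_ (Eventually.of_forall fun p => ?_)
  · exact (((continuous_indicatorFourier hM hf).comp
      (continuous_fst.sub continuous_snd)).norm.pow 2).aestronglyMeasurable
  · rw [norm_pow, norm_norm]
    exact pow_le_pow_left₀ (norm_nonneg _) (norm_indicatorFourier_le hM _) 2

lemma integral_mul_norm_sq_indicatorFourier (hM : MeasurableSet M) (hf : volume M ≠ ⊤)
    (hφ : IsTestFunction φ) :
    ∫ p : ℝ × ℝ, (φ p.1 * φ p.2) * ‖indicatorFourier M (p.1 - p.2)‖ ^ 2 =
      ∫ u, ‖indicatorFourier M u‖ ^ 2 * ∫ x, φ x * φ (x - u) := by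
  have hD : Integrable fun u => ‖indicatorFourier M u‖ ^ 2 :=
    integrable_norm_sq_fourier_indicator hM hf
  -- The substitution u = x - y.
  have e1 : ∀ x, ∫ y, (φ x * φ y) * ‖indicatorFourier M (x - y)‖ ^ 2 =
      ∫ u, (φ x * φ (x - u)) * ‖indicatorFourier M u‖ ^ 2 := fun x => by
    rw [← integral_sub_left_eq_self
      (fun y => (φ x * φ y) * ‖indicatorFourier M (x - y)‖ ^ 2) volume x]
    simp
  have hi : Integrable (Function.uncurry fun x u : ℝ =>
      (φ x * φ (x - u)) * ‖indicatorFourier M u‖ ^ 2) (volume.prod volume) := by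
    have h1 := (hφ.integrable_volume.mul_prod hD).mul_bdd (c := 1)
      (g := fun p : ℝ × ℝ => φ (p.1 - p.2))
      (hφ.measurable.comp (measurable_fst.sub measurable_snd)).aestronglyMeasurable
      (Eventually.of_forall fun p => hφ.norm_le_one _)
    refine h1.congr (Eventually.of_forall fun p => ?_)
    simp only [Function.uncurry]
    ring
  rw [Measure.volume_eq_prod, integral_prod _
    (integrable_mul_norm_sq_indicatorFourier hM hf hφ)]
  simp only [e1]
  rw [integral_integral_swap hi]
  congr 1
  ext u
  rw [integral_mul_const, mul_comm]

/-- The variance of a linear statistic of a determinantal process with kernel `K_M`. -/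
theorem integral_linearStatistic_sub_sq {P : PointProcess ℝ} (hM : MeasurableSet M)
    (hf : volume M ≠ ⊤) (hP : IsDeterminantal volume (fourierKernel M) P)
    (hφ : IsTestFunction φ) :
    Integrable (fun X => (linearStatistic φ X - volume.real M * ∫ x, φ x) ^ 2)
        (P : Measure (Conf ℝ)) ∧
      ∫ X, (linearStatistic φ X - volume.real M * ∫ x, φ x) ^ 2 ∂(P : Measure (Conf ℝ)) =
        ∫ u, ‖indicatorFourier M u‖ ^ 2 * shiftEnergy φ u := by
  obtain ⟨i1, -⟩ := hP.integral_linearStatistic hφ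
  have m1 := integral_linearStatistic_fourierKernel hM hP hφ
  obtain ⟨i2, m2⟩ := hP.integral_linearStatistic_sq hφ
  have hD : Integrable fun u => ‖indicatorFourier M u‖ ^ 2 :=
    integrable_norm_sq_fourier_indicator hM hf
  set c := volume.real M
  have e : ∀ X : Conf ℝ, (linearStatistic φ X - c * ∫ x, φ x) ^ 2 = linearStatistic φ X ^ 2 -
      2 * (c * ∫ x, φ x) * linearStatistic φ X + (c * ∫ x, φ x) ^ 2 := fun X => by ring
  have hi := (i2.sub (i1.const_mul (2 * (c * ∫ x, φ x)))).add
    (integrable_const (μ := (P : Measure (Conf ℝ))) ((c * ∫ x, φ x) ^ 2))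
  refine ⟨hi.congr (Eventually.of_forall fun X => (e X).symm), ?_⟩
  have m3 : ∫ X, linearStatistic φ X ^ 2 ∂(P : Measure (Conf ℝ)) =
      c * (∫ x, φ x ^ 2) + ((c * ∫ x, φ x) ^ 2 -
        ∫ u, ‖indicatorFourier M u‖ ^ 2 * ∫ x, φ x * φ (x - u)) := by
    have e1 : ∀ p : ℝ × ℝ, ((φ p.1 : ℂ) * φ p.2) * (fourierKernel M p.1 p.1 *
        fourierKernel M p.2 p.2 - fourierKernel M p.1 p.2 * fourierKernel M p.2 p.1) =
        ((c ^ 2 * (φ p.1 * φ p.2) - (φ p.1 * φ p.2) * ‖indicatorFourier M (p.1 - p.2)‖ ^ 2 : ℝ)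
          : ℂ) := fun p => by
      rw [fourierKernel_mul_swap hM, fourierKernel_self hM, fourierKernel_self hM]
      push_cast
      ring
    simp only [e1] at m2
    simp only [fourierKernel_self hM] at m2
    rw [integral_complex_ofReal, integral_mul_const, integral_complex_ofReal] at m2
    have m4 : ∫ X, linearStatistic φ X ^ 2 ∂(P : Measure (Conf ℝ)) = (∫ x, φ x ^ 2) * c +
        ∫ p : ℝ × ℝ, (c ^ 2 * (φ p.1 * φ p.2) -
          (φ p.1 * φ p.2) * ‖indicatorFourier M (p.1 - p.2)‖ ^ 2) := by
      exact_mod_cast m2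
    have hpp : Integrable fun p : ℝ × ℝ => φ p.1 * φ p.2 :=
      hφ.integrable_volume.mul_prod hφ.integrable_volume
    rw [m4, integral_sub (hpp.const_mul _)
      (integrable_mul_norm_sq_indicatorFourier hM hf hφ), integral_const_mul,
      integral_mul_norm_sq_indicatorFourier hM hf hφ]
    have : ∫ p : ℝ × ℝ, φ p.1 * φ p.2 = (∫ x, φ x) * ∫ x, φ x := integral_prod_mul φ φ
    rw [this]
    ring
  -- By Plancherel ∫ |χ̂_M|² = m(M) = K_M(x, x). The diagonal term m(M) ∫ φ² can thus be written as
  -- an integral against |χ̂_M|², and subtracting the autocorrelation term leaves the shift energy.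
  have m5 : ∫ u, ‖indicatorFourier M u‖ ^ 2 * shiftEnergy φ u =
      c * (∫ x, φ x ^ 2) - ∫ u, ‖indicatorFourier M u‖ ^ 2 * ∫ x, φ x * φ (x - u) := by
    simp only [hφ.shiftEnergy_eq, mul_sub]
    rw [integral_sub (hD.mul_const _), integral_mul_const]
    · congr 2
      exact integral_norm_sq_fourier_indicator hM hf
    · have hm : Measurable fun u => ∫ x, φ x * φ (x - u) := by
        have : (fun u => ∫ x, φ x * φ (x - u)) = fun u => (∫ x, φ x ^ 2) - shiftEnergy φ u := by
          ext u
          rw [hφ.shiftEnergy_eq]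
          ring
        rw [this]
        exact hφ.measurable_shiftEnergy.const_sub _
      refine hD.mul_bdd (c := ∫ x, φ x ^ 2) hm.aestronglyMeasurable
        (Eventually.of_forall fun u => ?_)
      rw [Real.norm_of_nonneg (integral_nonneg fun x => mul_nonneg (hφ.nonneg x) (hφ.nonneg _))]
      have h1 := shiftEnergy_nonneg φ u
      rw [hφ.shiftEnergy_eq] at h1
      linarith
  simp only [e]
  have i3 : Integrable (fun X => linearStatistic φ X ^ 2 -
      2 * (c * ∫ x, φ x) * linearStatistic φ X) (P : Measure (Conf ℝ)) := i2.sub (i1.const_mul _)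
  rw [integral_add i3 (integrable_const _),
    integral_sub i2 (i1.const_mul _), integral_const_mul, m1, m3, m5]
  simp only [integral_const, probReal_univ, smul_eq_mul]
  ring

/-- A variance bound when `χ̂_M` is the sum of a part decaying like `1/u` and a part with small
`L²` norm. -/
theorem integral_norm_sq_mul_shiftEnergy_le {A : ℝ} {D : Set ℝ} (hD : MeasurableSet D)
    (hDf : volume D ≠ ⊤) (hM : MeasurableSet M) (hf : volume M ≠ ⊤) (hφ : IsTestFunction φ)
    (hq : Integrable fun u => shiftEnergy φ u / u ^ 2)
    (hle : ∀ u, u ≠ 0 → ‖indicatorFourier M u‖ ≤ A / |u| + ‖indicatorFourier D u‖) :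
    ∫ u, ‖indicatorFourier M u‖ ^ 2 * shiftEnergy φ u ≤
      2 * A ^ 2 * (∫ u, shiftEnergy φ u / u ^ 2) + 2 * volume.real D * ∫ x, φ x ^ 2 := by
  have iD : Integrable fun u => ‖indicatorFourier D u‖ ^ 2 :=
    integrable_norm_sq_fourier_indicator hD hDf
  have iM : Integrable fun u => ‖indicatorFourier M u‖ ^ 2 :=
    integrable_norm_sq_fourier_indicator hM hf
  have vD : ∫ u, ‖indicatorFourier D u‖ ^ 2 = volume.real D :=
    integral_norm_sq_fourier_indicator hD hDf
  have hb : ∀ {g : ℝ → ℝ}, Integrable g → Integrable fun u => g u * shiftEnergy φ u := fun hg =>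
    hg.mul_bdd (c := ∫ x, φ x ^ 2) hφ.measurable_shiftEnergy.aestronglyMeasurable
      (Eventually.of_forall fun u => by
        rw [Real.norm_of_nonneg (shiftEnergy_nonneg φ u)]
        exact hφ.shiftEnergy_le u)
  rw [← vD, ← integral_const_mul, ← integral_const_mul 2, ← integral_mul_const, ← integral_add]
  · refine integral_mono_ae (hb iM) ((hq.const_mul _).add ((iD.const_mul _).mul_const _)) ?_
    have h0 : ∀ᵐ u : ℝ, u ≠ 0 := by simp [ae_iff]
    filter_upwards [h0] with u hu
    have h1 := shiftEnergy_nonneg φ u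
    have h2 := hφ.shiftEnergy_le u
    -- The inequality (a + b)² ≤ 2a² + 2b². The first part is paired with the H^{1/2} energy. The
    -- second only needs the bound of the shift energy by ∫ φ², because Plancherel evaluates its
    -- integral to m(D).
    have h3 : ‖indicatorFourier M u‖ ^ 2 ≤ 2 * (A ^ 2 / u ^ 2) +
        2 * ‖indicatorFourier D u‖ ^ 2 := by
      have h4 := pow_le_pow_left₀ (norm_nonneg _) (hle u hu) 2
      have h5 : (A / |u|) ^ 2 = A ^ 2 / u ^ 2 := by rw [div_pow, sq_abs]
      nlinarith [sq_nonneg (A / |u| - ‖indicatorFourier D u‖)]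
    calc ‖indicatorFourier M u‖ ^ 2 * shiftEnergy φ u
        ≤ (2 * (A ^ 2 / u ^ 2) + 2 * ‖indicatorFourier D u‖ ^ 2) * shiftEnergy φ u :=
          mul_le_mul_of_nonneg_right h3 h1
      _ = 2 * A ^ 2 * (shiftEnergy φ u / u ^ 2) +
          2 * ‖indicatorFourier D u‖ ^ 2 * shiftEnergy φ u := by ring
      _ ≤ _ := by gcongr
  · exact hq.const_mul _
  · exact (iD.const_mul _).mul_const _

end Variance

end

noncomputable section

/-! ### A criterion for number rigidity -/

section RigidityCriterion

open Filter
open scoped Topology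

lemma measurable_restrict_sigmaAlgebraOn {S : Set ℝ} (hS : MeasurableSet S) :
    Measurable[sigmaAlgebraOn S] fun X : Conf ℝ => X.1.restrict S := by
  refine @Measure.measurable_of_measurable_coe _ _ _ (sigmaAlgebraOn S) _ fun s hs => ?_
  simp only [Measure.restrict_apply hs]
  have h : MeasurableSpace.comap (numPoints (s ∩ S)) inferInstance ≤ sigmaAlgebraOn S :=
    le_iSup₂_of_le (s ∩ S) (hs.inter hS) (le_iSup_of_le inter_subset_right le_rfl)
  exact (comap_measurable (numPoints (s ∩ S))).mono h le_rfl

lemma IsTestFunction.measurable_setIntegral {φ : ℝ → ℝ} (hφ : IsTestFunction φ) {S : Set ℝ}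
    (hS : MeasurableSet S) :
    Measurable[sigmaAlgebraOn S] fun X : Conf ℝ => ∫ x in S, φ x ∂X.1 := by
  have e : (fun X : Conf ℝ => ∫ x in S, φ x ∂X.1) =
      fun X => (∫⁻ x, ENNReal.ofReal (φ x) ∂(X.1.restrict S)).toReal := by
    ext X
    exact integral_eq_lintegral_of_nonneg_ae (Eventually.of_forall hφ.nonneg)
      hφ.measurable.aestronglyMeasurable
  rw [e]
  exact ENNReal.measurable_toReal.comp ((Measure.measurable_lintegral
    (ENNReal.measurable_ofReal.comp hφ.measurable)).comp (measurable_restrict_sigmaAlgebraOn hS))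

/-- If centred linear statistics of test functions that are `1` on growing intervals tend to zero
almost surely, then the process is number rigid. -/
theorem numberRigid_of_tendsto {P : PointProcess ℝ} {φ : ℕ → ℝ → ℝ} {c : ℕ → ℝ}
    (hφ : ∀ n, IsTestFunction (φ n)) (h1 : ∀ (n : ℕ) (x : ℝ), |x| ≤ n → φ n x = 1)
    (hc : ∀ᵐ X ∂(P : Measure (Conf ℝ)),
      Tendsto (fun n => linearStatistic (φ n) X - c n) atTop (𝓝 0)) :
    NumberRigid P := by
  intro B hB
  have hBm := hB.measurableSet
  -- A predictor of #_B using only the points outside `B`. Once φ n = 1 on `B`, the expression under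
  -- `ofReal` is #_B minus the centred linear statistic.
  let T : ℕ → Conf ℝ → ℝ≥0∞ := fun n X => ENNReal.ofReal (c n - ∫ x in Bᶜ, φ n x ∂X.1)
  have hT : ∀ n, Measurable[sigmaAlgebraOn Bᶜ] (T n) := fun n =>
    ENNReal.measurable_ofReal.comp (((hφ n).measurable_setIntegral hBm.compl).const_sub (c n))
  have hlim : Measurable[sigmaAlgebraOn Bᶜ] fun X => limsup (fun n => T n X) atTop :=
    Measurable.limsup hT
  -- The limsup is measurable with respect to the outside on all configurations; equality with #_B
  -- holds only almost surely, hence the completion.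
  refine Measurable.eventuallyMeasurable_of_eventuallyEq hlim ?_
  filter_upwards [hc] with X hX
  refine (Tendsto.limsup_eq ?_).symm
  have hBX : X.1 B ≠ ⊤ := (X.2.2 B hB).ne
  obtain ⟨R, hR⟩ := hB.isBounded.subset_closedBall 0
  obtain ⟨N, hN⟩ := exists_nat_ge R
  have e : ∀ n, N ≤ n → linearStatistic (φ n) X = X.1.real B + ∫ x in Bᶜ, φ n x ∂X.1 := by
    intro n hn
    rw [linearStatistic, ← integral_add_compl hBm ((hφ n).integrable_conf X),
      setIntegral_congr_fun hBm (g := fun _ => (1 : ℝ)) fun x hx => h1 n x ?_]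
    · simp
    · have := hR hx
      rw [mem_closedBall_zero_iff, Real.norm_eq_abs] at this
      exact this.trans (hN.trans (by exact_mod_cast hn))
  have h2 : Tendsto (fun n => c n - ∫ x in Bᶜ, φ n x ∂X.1) atTop (𝓝 (X.1.real B)) := by
    have h3 : Tendsto (fun n => X.1.real B - (linearStatistic (φ n) X - c n)) atTop
        (𝓝 (X.1.real B - 0)) := tendsto_const_nhds.sub hX
    rw [sub_zero] at h3
    refine h3.congr' ?_
    filter_upwards [eventually_ge_atTop N] with n hn
    rw [e n hn]
    ring
  have h4 := (ENNReal.continuous_ofReal.tendsto _).comp h2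
  rw [measureReal_def, ENNReal.ofReal_toReal hBX] at h4
  exact h4

/-- A sequence of random variables with summable second moments tends to zero almost surely. -/
lemma ae_tendsto_zero_of_summable_integral_sq {Ω : Type*} [MeasurableSpace Ω] {μ : Measure Ω}
    {f : ℕ → Ω → ℝ} (hf : ∀ n, Integrable (fun ω => f n ω ^ 2) μ) {b : ℕ → ℝ}
    (hb : Summable b) (hle : ∀ n, ∫ ω, f n ω ^ 2 ∂μ ≤ b n) :
    ∀ᵐ ω ∂μ, Tendsto (fun n => f n ω) atTop (𝓝 0) := by
  have hm : ∀ n, AEMeasurable (fun ω => ENNReal.ofReal (f n ω ^ 2)) μ := fun n =>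
    (hf n).aemeasurable.ennreal_ofReal
  -- The expected sum of the squares is finite, so the squares are almost surely summable.
  have h1 : ∫⁻ ω, ∑' n, ENNReal.ofReal (f n ω ^ 2) ∂μ ≠ ∞ := by
    rw [lintegral_tsum hm]
    refine ne_top_of_le_ne_top hb.tsum_ofReal_ne_top (ENNReal.tsum_le_tsum fun n => ?_)
    rw [← ofReal_integral_eq_lintegral_ofReal (hf n) (Eventually.of_forall fun _ => sq_nonneg _)]
    exact ENNReal.ofReal_le_ofReal (hle n)
  filter_upwards [ae_lt_top' (AEMeasurable.tsum hm) h1] with ω hω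
  have h2 := ENNReal.tendsto_atTop_zero_of_tsum_ne_top hω.ne
  have h3 := (ENNReal.tendsto_toReal (ENNReal.zero_ne_top)).comp h2
  have h4 : Tendsto (fun n => f n ω ^ 2) atTop (𝓝 0) := by
    refine h3.congr fun n => ?_
    exact ENNReal.toReal_ofReal (sq_nonneg _)
  have h5 := (Real.continuous_sqrt.tendsto 0).comp h4
  rw [Real.sqrt_zero] at h5
  refine (tendsto_zero_iff_abs_tendsto_zero _).2 (h5.congr fun n => ?_)
  exact Real.sqrt_sq_eq_abs _

/-- Number rigidity from a summable sequence of variance bounds. -/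
theorem numberRigid_of_summable {M : Set ℝ} (hM : MeasurableSet M) (hf : volume M ≠ ⊤)
    {φ : ℕ → ℝ → ℝ} (hφ : ∀ n, IsTestFunction (φ n))
    (h1 : ∀ (n : ℕ) (x : ℝ), |x| ≤ n → φ n x = 1) {b : ℕ → ℝ} (hb : Summable b)
    (hle : ∀ n, ∫ u, ‖indicatorFourier M u‖ ^ 2 * shiftEnergy (φ n) u ≤ b n)
    (P : PointProcess ℝ) (hP : IsDeterminantal volume (fourierKernel M) P) : NumberRigid P := by
  have h := fun n => integral_linearStatistic_sub_sq hM hf hP (hφ n)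
  exact numberRigid_of_tendsto hφ h1 (ae_tendsto_zero_of_summable_integral_sq
    (fun n => (h n).1) hb fun n => (h n).2.trans_le (hle n))

end RigidityCriterion

end

noncomputable section

/-! ### Test functions of small `H^{1/2}` energy -/

section TestFunctions

open Filter
open scoped Topology

/-- The tent-shaped cutoff that is `1` on `[-r, r]` and vanishes outside `[-2r, 2r]`. -/
def cutoff (r x : ℝ) : ℝ := max 0 (min 1 (2 - |x| / r))

lemma cutoff_nonneg (r x : ℝ) : 0 ≤ cutoff r x := le_max_left _ _

lemma cutoff_le_one (r x : ℝ) : cutoff r x ≤ 1 := max_le zero_le_one (min_le_left _ _)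

lemma continuous_cutoff (r : ℝ) : Continuous (cutoff r) := by
  unfold cutoff
  fun_prop

variable {r : ℝ}

lemma cutoff_eq_one (hr : 0 < r) {x : ℝ} (hx : |x| ≤ r) : cutoff r x = 1 := by
  have : |x| / r ≤ 1 := (div_le_one hr).2 hx
  rw [cutoff, min_eq_left (by linarith), max_eq_right zero_le_one]

lemma cutoff_eq_zero (hr : 0 < r) {x : ℝ} (hx : 2 * r ≤ |x|) : cutoff r x = 0 := by
  have : 2 ≤ |x| / r := (le_div_iff₀ hr).2 hx
  rw [cutoff, max_eq_left]
  exact (min_le_right _ _).trans (by linarith)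

lemma abs_cutoff_sub_le (hr : 0 < r) (x y : ℝ) : |cutoff r x - cutoff r y| ≤ |x - y| / r := by
  have h1 : |cutoff r x - cutoff r y| ≤ |min 1 (2 - |x| / r) - min 1 (2 - |y| / r)| := by
    simpa [cutoff] using abs_max_sub_max_le_max 0 (min 1 (2 - |x| / r)) 0 (min 1 (2 - |y| / r))
  have h2 : |min 1 (2 - |x| / r) - min 1 (2 - |y| / r)| ≤ |(2 - |x| / r) - (2 - |y| / r)| := by
    simpa using abs_min_sub_min_le_max 1 (2 - |x| / r) 1 (2 - |y| / r)
  refine (h1.trans h2).trans ?_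
  have e : (2 - |x| / r) - (2 - |y| / r) = (|y| - |x|) / r := by ring
  rw [e, abs_div, abs_of_pos hr, abs_sub_comm x y]
  exact div_le_div_of_nonneg_right (abs_abs_sub_abs_le y x) hr.le

lemma abs_cutoff_sub_le_one (r x y : ℝ) : |cutoff r x - cutoff r y| ≤ 1 := by
  rw [abs_le]
  constructor <;> linarith [cutoff_nonneg r x, cutoff_nonneg r y, cutoff_le_one r x,
    cutoff_le_one r y]

/-- The set outside of which `cutoff r x - cutoff r (x - u)` vanishes. -/
def cutoffShiftSupport (r u : ℝ) : Set ℝ :=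
  Icc (-(2 * r)) (2 * r) ∪ Icc (u - 2 * r) (u + 2 * r)

lemma measurableSet_cutoffShiftSupport (r u : ℝ) : MeasurableSet (cutoffShiftSupport r u) :=
  measurableSet_Icc.union measurableSet_Icc

lemma volume_cutoffShiftSupport_le (hr : 0 < r) (u : ℝ) :
    volume (cutoffShiftSupport r u) ≤ ENNReal.ofReal (8 * r) := by
  refine (measure_union_le _ _).trans ?_
  rw [Real.volume_Icc, Real.volume_Icc, ← ENNReal.ofReal_add (by linarith) (by linarith)]
  exact ENNReal.ofReal_le_ofReal (by linarith)

lemma cutoff_sub_eq_zero (hr : 0 < r) {u x : ℝ} (hx : x ∉ cutoffShiftSupport r u) :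
    cutoff r x - cutoff r (x - u) = 0 := by
  rw [cutoffShiftSupport, mem_union, not_or, mem_Icc, mem_Icc] at hx
  rw [cutoff_eq_zero hr, cutoff_eq_zero hr, sub_zero]
  · by_contra! h
    rw [abs_lt] at h
    exact hx.2 ⟨by linarith, by linarith⟩
  · by_contra! h
    rw [abs_lt] at h
    exact hx.1 ⟨by linarith, by linarith⟩

/-- A bound for the increments of `cutoff r` over the distance `u`. -/
def cutoffModulus (r u : ℝ) : ℝ := min 1 (|u| / r)

lemma cutoffModulus_nonneg (hr : 0 < r) (u : ℝ) : 0 ≤ cutoffModulus r u :=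
  le_min zero_le_one (by positivity)

/-- The support of the first factor alone is kept. It is applied with r the smaller of the two
scales, and a support of size O(r) is what makes the two scales nearly orthogonal. -/
lemma abs_cutoff_sub_mul_le {s : ℝ} (hr : 0 < r) (hs : 0 < s) (u x : ℝ) :
    |cutoff r x - cutoff r (x - u)| * |cutoff s x - cutoff s (x - u)| ≤
      (cutoffShiftSupport r u).indicator
        (fun _ => cutoffModulus r u * cutoffModulus s u) x := by
  have h : ∀ {r : ℝ}, 0 < r → |cutoff r x - cutoff r (x - u)| ≤ cutoffModulus r u := fun hr =>
    le_min (abs_cutoff_sub_le_one _ _ _) (by simpa using abs_cutoff_sub_le hr x (x - u))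
  by_cases hx : x ∈ cutoffShiftSupport r u
  · rw [indicator_of_mem hx]
    exact mul_le_mul (h hr) (h hs) (abs_nonneg _) (cutoffModulus_nonneg hr u)
  · rw [indicator_of_notMem hx, cutoff_sub_eq_zero hr hx, abs_zero, zero_mul]

/-- With y = u²/(rs), the product of moduli is at most min(1, y) ≤ 2y/(1 + y). After division by u²
this is a Cauchy profile of width |q| = √(rs), whose integral is of order √(r/s). -/
lemma cutoffModulus_mul_le {s q : ℝ} (hr : 0 < r) (hs : 0 < s) (hq : q ^ 2 = r * s) (u : ℝ) :
    8 * r * (cutoffModulus r u * cutoffModulus s u) ≤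
      u ^ 2 * (16 / s * (1 + (u / q) ^ 2)⁻¹) := by
  set y := u ^ 2 / (r * s) with hy
  have hy0 : 0 ≤ y := by positivity
  have h1 : cutoffModulus r u * cutoffModulus s u ≤ 1 :=
    mul_le_one₀ (min_le_left _ _) (cutoffModulus_nonneg hs u) (min_le_left _ _)
  have h2 : cutoffModulus r u * cutoffModulus s u ≤ y := by
    have h3 : cutoffModulus r u * cutoffModulus s u ≤ |u| / r * (|u| / s) :=
      mul_le_mul (min_le_right _ _) (min_le_right _ _) (cutoffModulus_nonneg hs u) (by positivity)
    refine h3.trans_eq ?_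
    rw [hy, div_mul_div_comm, abs_mul_abs_self, sq]
  have e1 : (u / q) ^ 2 = y := by rw [div_pow, hq]
  have e2 : u ^ 2 = y * (r * s) := by rw [hy, div_mul_cancel₀ _ (by positivity)]
  rw [e1, e2, ← mul_assoc (y * (r * s)), ← div_eq_mul_inv, le_div_iff₀ (by positivity)]
  have e3 : y * (r * s) * (16 / s) = 8 * r * (2 * y) := by
    field_simp
    ring
  rw [e3, mul_assoc (8 * r)]
  refine mul_le_mul_of_nonneg_left ?_ (by positivity)
  nlinarith [mul_le_mul_of_nonneg_right h1 hy0]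

/-- The doubled sum over k ≤ l counts each mixed term as often as the square does and each diagonal
term once more. -/
lemma sq_sum_range_le {d : ℕ → ℝ} (m : ℕ) :
    (∑ k ∈ Finset.range m, d k) ^ 2 ≤
      2 * ∑ l ∈ Finset.range m, ∑ k ∈ Finset.range (l + 1), d k * d l := by
  induction m with
  | zero => simp
  | succ m ih =>
    rw [Finset.sum_range_succ, Finset.sum_range_succ _ m, ← Finset.sum_mul,
      Finset.sum_range_succ d m]
    nlinarith [sq_nonneg (d m)]

lemma sum_range_four_pow_le (l : ℕ) : ∑ k ∈ Finset.range (l + 1), (4 : ℝ) ^ k ≤ 2 * 4 ^ l := by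
  induction l with
  | zero => simp
  | succ l ih =>
    rw [Finset.sum_range_succ, pow_succ]
    have : (0 : ℝ) ≤ 4 ^ l := by positivity
    linarith

/-- The average of cutoffs at `m` geometrically growing scales. -/
def averagedCutoff (R : ℝ) (m : ℕ) (x : ℝ) : ℝ :=
  (1 / (m : ℝ)) * ∑ k ∈ Finset.range m, cutoff (R * 16 ^ k) x

variable {R : ℝ} {m : ℕ}

lemma averagedCutoff_eq_one (hR : 0 < R) (hm : 0 < m) {x : ℝ} (hx : |x| ≤ R) :
    averagedCutoff R m x = 1 := by
  have : ∀ k ∈ Finset.range m, cutoff (R * 16 ^ k) x = 1 := fun k _ =>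
    cutoff_eq_one (by positivity) (hx.trans (le_mul_of_one_le_right hR.le
      (one_le_pow₀ (by norm_num))))
  rw [averagedCutoff, Finset.sum_congr rfl this]
  have : (m : ℝ) ≠ 0 := by positivity
  simp [this]

lemma isTestFunction_averagedCutoff (hR : 0 < R) (hm : 0 < m) :
    IsTestFunction (averagedCutoff R m) where
  measurable := ((continuous_finsetSum _ fun k _ =>
    continuous_cutoff (R * 16 ^ k)).const_mul _).measurable
  hasCompactSupport := by
    refine HasCompactSupport.intro (isCompact_Icc (a := -(2 * (R * 16 ^ m)))
      (b := 2 * (R * 16 ^ m))) fun x hx => ?_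
    have hx' : 2 * (R * 16 ^ m) ≤ |x| := by
      by_contra! h
      rw [abs_lt] at h
      exact hx ⟨h.1.le, h.2.le⟩
    have : ∀ k ∈ Finset.range m, cutoff (R * 16 ^ k) x = 0 := fun k hk => by
      refine cutoff_eq_zero (by positivity) (le_trans ?_ hx')
      have : (16 : ℝ) ^ k ≤ 16 ^ m :=
        pow_le_pow_right₀ (by norm_num) (Finset.mem_range.1 hk).le
      gcongr
    rw [averagedCutoff, Finset.sum_eq_zero this, mul_zero]
  nonneg x := mul_nonneg (by positivity) (Finset.sum_nonneg fun k _ => cutoff_nonneg _ _)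
  le_one x := by
    have h : ∑ k ∈ Finset.range m, cutoff (R * 16 ^ k) x ≤ m := by
      simpa using Finset.sum_le_card_nsmul (Finset.range m) (fun k => cutoff (R * 16 ^ k) x) 1
        fun k _ => cutoff_le_one _ _
    rw [averagedCutoff, one_div_mul_eq_div]
    exact (div_le_one (by positivity)).2 h

lemma shiftEnergy_averagedCutoff_le (hR : 0 < R) (hm : 0 < m) (u : ℝ) :
    shiftEnergy (averagedCutoff R m) u ≤ u ^ 2 * ((1 / (m : ℝ) ^ 2) *
      ∑ l ∈ Finset.range m, ∑ k ∈ Finset.range (l + 1),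
        16 / (R * 16 ^ l) * (1 + (u / (R * 4 ^ (k + l))) ^ 2)⁻¹) := by
  have hr : ∀ k, 0 < R * (16 : ℝ) ^ k := fun k => by positivity
  set d : ℕ → ℝ → ℝ := fun k x => cutoff (R * 16 ^ k) x - cutoff (R * 16 ^ k) (x - u) with hd
  set I : ℕ → ℕ → ℝ → ℝ := fun k l => (cutoffShiftSupport (R * 16 ^ k) u).indicator
    (fun _ => cutoffModulus (R * 16 ^ k) u * cutoffModulus (R * 16 ^ l) u) with hI
  have hIi : ∀ k l, Integrable (I k l) := fun k l =>
    (integrable_indicator_iff (measurableSet_cutoffShiftSupport _ _)).2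
      (integrableOn_const ((volume_cutoffShiftSupport_le (hr k) u).trans_lt
        ENNReal.ofReal_lt_top).ne)
  have hIint : ∀ k l, ∫ x, I k l x ≤
      u ^ 2 * (16 / (R * 16 ^ l) * (1 + (u / (R * 4 ^ (k + l))) ^ 2)⁻¹) := fun k l => by
    rw [integral_indicator (measurableSet_cutoffShiftSupport _ _), setIntegral_const, smul_eq_mul]
    refine le_trans (mul_le_mul_of_nonneg_right (ENNReal.toReal_le_of_le_ofReal
      (mul_nonneg (by norm_num) (hr k).le) (volume_cutoffShiftSupport_le (hr k) u))
      (mul_nonneg (cutoffModulus_nonneg (hr k) u) (cutoffModulus_nonneg (hr l) u))) ?_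
    refine cutoffModulus_mul_le (hr k) (hr l) ?_ u
    -- The geometric mean of R 16^k and R 16^l is R 4^(k+l); the scale ratio is a perfect square so
    -- that no roots appear.
    have : (16 : ℝ) = 4 ^ 2 := by norm_num
    rw [this, mul_pow, ← pow_mul, ← pow_mul, ← pow_mul]
    ring
  have hpt : ∀ x, (averagedCutoff R m x - averagedCutoff R m (x - u)) ^ 2 ≤
      (2 / (m : ℝ) ^ 2) * ∑ l ∈ Finset.range m, ∑ k ∈ Finset.range (l + 1), I k l x := fun x => by
    have e : averagedCutoff R m x - averagedCutoff R m (x - u) =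
        (1 / (m : ℝ)) * ∑ k ∈ Finset.range m, d k x := by
      rw [averagedCutoff, averagedCutoff, ← mul_sub, ← Finset.sum_sub_distrib]
    rw [e, mul_pow]
    have h1 : (∑ k ∈ Finset.range m, d k x) ^ 2 ≤
        2 * ∑ l ∈ Finset.range m, ∑ k ∈ Finset.range (l + 1), I k l x := by
      refine (sq_sum_range_le m).trans (mul_le_mul_of_nonneg_left ?_ (by norm_num))
      refine Finset.sum_le_sum fun l _ => Finset.sum_le_sum fun k _ => ?_
      refine (le_abs_self _).trans ?_
      rw [abs_mul]
      exact abs_cutoff_sub_mul_le (hr k) (hr l) u x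
    calc (1 / (m : ℝ)) ^ 2 * (∑ k ∈ Finset.range m, d k x) ^ 2 ≤ (1 / (m : ℝ)) ^ 2 *
          (2 * ∑ l ∈ Finset.range m, ∑ k ∈ Finset.range (l + 1), I k l x) := by gcongr
      _ = _ := by ring
  have hint : Integrable fun x =>
      (2 / (m : ℝ) ^ 2) * ∑ l ∈ Finset.range m, ∑ k ∈ Finset.range (l + 1), I k l x :=
    (integrable_finsetSum _ fun l _ => integrable_finsetSum _ fun k _ => hIi k l).const_mul _
  have h2 : ∫ x, (averagedCutoff R m x - averagedCutoff R m (x - u)) ^ 2 ≤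
      (2 / (m : ℝ) ^ 2) * ∑ l ∈ Finset.range m, ∑ k ∈ Finset.range (l + 1),
        u ^ 2 * (16 / (R * 16 ^ l) * (1 + (u / (R * 4 ^ (k + l))) ^ 2)⁻¹) := by
    refine (integral_mono_of_nonneg (Eventually.of_forall fun x => sq_nonneg _) hint
      (Eventually.of_forall hpt)).trans ?_
    rw [integral_const_mul, integral_finsetSum _ fun l _ =>
      integrable_finsetSum _ fun k _ => hIi k l]
    refine mul_le_mul_of_nonneg_left (Finset.sum_le_sum fun l _ => ?_) (by positivity)
    rw [integral_finsetSum _ fun k _ => hIi k l]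
    exact Finset.sum_le_sum fun k _ => hIint k l
  rw [shiftEnergy]
  refine (mul_le_mul_of_nonneg_left h2 (by norm_num)).trans_eq ?_
  simp only [← Finset.mul_sum]
  ring

lemma integrable_inv_one_add_div_sq {q : ℝ} (hq : 0 < q) :
    Integrable fun u : ℝ => (1 + (u / q) ^ 2)⁻¹ :=
  integrable_inv_one_add_sq.comp_div hq.ne'

lemma integral_inv_one_add_div_sq {q : ℝ} (hq : 0 < q) :
    ∫ u : ℝ, (1 + (u / q) ^ 2)⁻¹ = q * Real.pi := by
  rw [Measure.integral_comp_div (fun u : ℝ => (1 + u ^ 2)⁻¹) q, integral_univ_inv_one_add_sq,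
    abs_of_pos hq, smul_eq_mul]

/-- Scales k ≤ l interact with strength O(4^(k-l)), so the double sum is O(m) and the factor 1/m²
leaves O(1/m). The bound is independent of R by scale invariance of the energy. -/
lemma integral_shiftEnergy_averagedCutoff_le (hR : 0 < R) (hm : 0 < m) :
    Integrable (fun u => shiftEnergy (averagedCutoff R m) u / u ^ 2) ∧
      ∫ u, shiftEnergy (averagedCutoff R m) u / u ^ 2 ≤ 32 * Real.pi / m := by
  set g : ℝ → ℝ := fun u => (1 / (m : ℝ) ^ 2) *
      ∑ l ∈ Finset.range m, ∑ k ∈ Finset.range (l + 1),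
        16 / (R * 16 ^ l) * (1 + (u / (R * 4 ^ (k + l))) ^ 2)⁻¹ with hg
  have hi : ∀ k l : ℕ, Integrable fun u : ℝ =>
      16 / (R * 16 ^ l) * (1 + (u / (R * 4 ^ (k + l))) ^ 2)⁻¹ := fun k l =>
    (integrable_inv_one_add_div_sq (by positivity)).const_mul _
  have hgi : Integrable g :=
    (integrable_finsetSum _ fun l _ => integrable_finsetSum _ fun k _ => hi k l).const_mul _
  have hg0 : ∀ u, 0 ≤ g u := fun u =>
    mul_nonneg (by positivity) (Finset.sum_nonneg fun l _ => Finset.sum_nonneg fun k _ =>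
      mul_nonneg (by positivity) (inv_nonneg.2 (by positivity)))
  have hle : ∀ u, shiftEnergy (averagedCutoff R m) u / u ^ 2 ≤ g u := fun u => by
    -- At u = 0 the quotient is 0 by the convention for division by zero.
    rcases eq_or_ne u 0 with rfl | hu
    · rw [zero_pow two_ne_zero, div_zero]
      exact hg0 0
    · rw [div_le_iff₀ (by positivity), mul_comm]
      exact shiftEnergy_averagedCutoff_le hR hm u
  have h0 : ∀ u, 0 ≤ shiftEnergy (averagedCutoff R m) u / u ^ 2 := fun u =>
    div_nonneg (shiftEnergy_nonneg _ u) (sq_nonneg u)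
  have hmeas : Measurable fun u => shiftEnergy (averagedCutoff R m) u / u ^ 2 :=
    (isTestFunction_averagedCutoff hR hm).measurable_shiftEnergy.div (measurable_id.pow_const 2)
  have hint : Integrable fun u => shiftEnergy (averagedCutoff R m) u / u ^ 2 :=
    hgi.mono' hmeas.aestronglyMeasurable (Eventually.of_forall fun u => by
      rw [Real.norm_of_nonneg (h0 u)]
      exact hle u)
  refine ⟨hint, (integral_mono hint hgi hle).trans ?_⟩
  have hm' : (0 : ℝ) < m := by exact_mod_cast hm
  rw [hg, integral_const_mul, integral_finsetSum _ fun l _ =>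
    integrable_finsetSum _ fun k _ => hi k l]
  have h1 : ∀ l ∈ Finset.range m, ∫ u, ∑ k ∈ Finset.range (l + 1),
      16 / (R * 16 ^ l) * (1 + (u / (R * 4 ^ (k + l))) ^ 2)⁻¹ ≤ 32 * Real.pi := fun l _ => by
    rw [integral_finsetSum _ fun k _ => hi k l]
    have h2 : ∀ k ∈ Finset.range (l + 1),
        ∫ u, 16 / (R * 16 ^ l) * (1 + (u / (R * 4 ^ (k + l))) ^ 2)⁻¹ =
          16 * Real.pi / 4 ^ l * 4 ^ k := fun k _ => by
      rw [integral_const_mul, integral_inv_one_add_div_sq (by positivity), pow_add,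
        show (16 : ℝ) = 4 * 4 by norm_num, mul_pow]
      field_simp
    rw [Finset.sum_congr rfl h2, ← Finset.mul_sum]
    calc 16 * Real.pi / 4 ^ l * ∑ k ∈ Finset.range (l + 1), (4 : ℝ) ^ k
        ≤ 16 * Real.pi / 4 ^ l * (2 * 4 ^ l) := by
          have := Real.pi_pos
          gcongr
          exact sum_range_four_pow_le l
      _ = 32 * Real.pi := by
          field_simp
          ring
  calc 1 / (m : ℝ) ^ 2 * ∑ l ∈ Finset.range m, ∫ u, ∑ k ∈ Finset.range (l + 1),
        16 / (R * 16 ^ l) * (1 + (u / (R * 4 ^ (k + l))) ^ 2)⁻¹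
      ≤ 1 / (m : ℝ) ^ 2 * (m * (32 * Real.pi)) := by
        refine mul_le_mul_of_nonneg_left ?_ (by positivity)
        simpa using Finset.sum_le_card_nsmul (Finset.range m) _ _ h1
    _ = 32 * Real.pi / m := by
        field_simp

/-- Test functions equal to `1` on a given interval can have arbitrarily small energy. -/
theorem exists_isTestFunction_integral_shiftEnergy_le (R : ℝ) {ε : ℝ} (hε : 0 < ε) :
    ∃ φ, IsTestFunction φ ∧ (∀ x, |x| ≤ R → φ x = 1) ∧
      Integrable (fun u => shiftEnergy φ u / u ^ 2) ∧ ∫ u, shiftEnergy φ u / u ^ 2 ≤ ε := by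
  obtain ⟨m, hm⟩ := exists_nat_gt (32 * Real.pi / ε)
  have hm0 : (0 : ℝ) < m := lt_trans (by have := Real.pi_pos; positivity) hm
  -- The given R may be nonpositive, whereas the scale of the cutoffs must be positive.
  have hR : (0 : ℝ) < max R 1 := lt_max_of_lt_right one_pos
  have hm' : 0 < m := by exact_mod_cast hm0
  obtain ⟨h1, h2⟩ := integral_shiftEnergy_averagedCutoff_le hR hm'
  refine ⟨averagedCutoff (max R 1) m, isTestFunction_averagedCutoff hR hm',
    fun x hx => averagedCutoff_eq_one hR hm' (hx.trans (le_max_left _ _)), h1, h2.trans ?_⟩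
  rw [div_le_iff₀ hm0]
  rw [div_lt_iff₀ hε] at hm
  linarith

end TestFunctions

end

noncomputable section

/-! ### Generalized Cantor sets -/

section CantorSets

open Filter
open scoped Topology

/-- The common length of the intervals of the `n`-th stage. -/
def cantorLength (α : ℕ → ℝ) : ℕ → ℝ
  | 0 => 1
  | n + 1 => cantorLength α n * (1 - α (n + 1)) / 2

/-- The left endpoints of the intervals of the `n`-th stage. -/
def cantorLeft (α : ℕ → ℝ) : ℕ → Finset ℝ
  | 0 => {0}
  | n + 1 => cantorLeft α n ∪
      (cantorLeft α n).image fun a => a + (cantorLength α n - cantorLength α (n + 1))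

lemma cantorIntervals_eq (α : ℕ → ℝ) (n : ℕ) :
    cantorIntervals α n = (fun a => (a, a + cantorLength α n)) '' (cantorLeft α n) := by
  induction n with
  | zero => simp [cantorIntervals, cantorLeft, cantorLength]
  | succ n ih =>
    rw [cantorIntervals, ih, biUnion_image, cantorLeft, Finset.coe_union, Finset.coe_image,
      image_union, image_image]
    have e : ∀ a : ℝ, ({(a, (a + (a + cantorLength α n)) / 2 -
          α (n + 1) * ((a + cantorLength α n) - a) / 2),
        ((a + (a + cantorLength α n)) / 2 + α (n + 1) * ((a + cantorLength α n) - a) / 2,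
          a + cantorLength α n)} : Set (ℝ × ℝ)) =
        {(a, a + cantorLength α (n + 1))} ∪ {(a + (cantorLength α n - cantorLength α (n + 1)),
          a + (cantorLength α n - cantorLength α (n + 1)) + cantorLength α (n + 1))} := fun a => by
      rw [← insert_eq, cantorLength]
      congr 2
      · ring_nf
      · congr 1
        · ring
        · ring
    simp only [e, iUnion_union_distrib]
    congr 1
    · ext p
      simp [eq_comm]
    · ext p
      simp [eq_comm]

lemma cantorStage_eq (α : ℕ → ℝ) (n : ℕ) :
    cantorStage α n = ⋃ a ∈ cantorLeft α n, Icc a (a + cantorLength α n) := by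
  rw [cantorStage, cantorIntervals_eq, biUnion_image]
  rfl

lemma measurableSet_cantorStage (α : ℕ → ℝ) (n : ℕ) : MeasurableSet (cantorStage α n) := by
  rw [cantorStage_eq]
  exact Finset.measurableSet_biUnion _ fun _ _ => measurableSet_Icc

lemma measurableSet_generalizedCantorSet (α : ℕ → ℝ) :
    MeasurableSet (generalizedCantorSet α) :=
  MeasurableSet.iInter fun n => measurableSet_cantorStage α n

lemma cantorStage_zero (α : ℕ → ℝ) : cantorStage α 0 = Icc 0 1 := by
  simp [cantorStage, cantorIntervals]

variable {α : ℕ → ℝ}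

lemma cantorLength_pos (hα : ∀ n, 1 ≤ n → 0 < α n ∧ α n < 1) (n : ℕ) :
    0 < cantorLength α n := by
  induction n with
  | zero => exact one_pos
  | succ n ih =>
    have := (hα (n + 1) (by omega)).2
    exact div_pos (mul_pos ih (by linarith)) two_pos

lemma cantorLength_succ_lt (hα : ∀ n, 1 ≤ n → 0 < α n ∧ α n < 1) (n : ℕ) :
    2 * cantorLength α (n + 1) < cantorLength α n := by
  have h1 := (hα (n + 1) (by omega)).1
  have h2 := cantorLength_pos hα n
  rw [cantorLength]
  nlinarith

lemma cantorStage_succ_subset (hα : ∀ n, 1 ≤ n → 0 < α n ∧ α n < 1) (n : ℕ) :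
    cantorStage α (n + 1) ⊆ cantorStage α n := by
  have h1 := cantorLength_succ_lt hα n
  have h2 := cantorLength_pos hα (n + 1)
  rw [cantorStage_eq, cantorStage_eq]
  refine iUnion₂_subset fun a ha => ?_
  rw [cantorLeft, Finset.mem_union, Finset.mem_image] at ha
  rcases ha with ha | ⟨b, hb, rfl⟩
  · exact (Icc_subset_Icc_right (by linarith)).trans
      (subset_biUnion_of_mem (u := fun a => Icc a (a + cantorLength α n)) ha)
  · exact (Icc_subset_Icc (by linarith) (by linarith)).trans
      (subset_biUnion_of_mem (u := fun a => Icc a (a + cantorLength α n)) hb)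

lemma antitone_cantorStage (hα : ∀ n, 1 ≤ n → 0 < α n ∧ α n < 1) : Antitone (cantorStage α) :=
  antitone_nat_of_succ_le (cantorStage_succ_subset hα)

/-- Write ℓ_n for the length at stage n. Children of different parents move by at most ℓ_n - ℓ_{n+1}
relative to each other, so a distance greater than ℓ_n stays greater than ℓ_{n+1}. The two children
of one parent are ℓ_n - ℓ_{n+1} > ℓ_{n+1} apart. -/
lemma cantorLength_lt_abs_sub (hα : ∀ n, 1 ≤ n → 0 < α n ∧ α n < 1) (n : ℕ)
    {a b : ℝ} (ha : a ∈ cantorLeft α n) (hb : b ∈ cantorLeft α n) (hab : a ≠ b) : cantorLength α n < |a - b| := by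
  induction n generalizing a b with
  | zero =>
    rw [cantorLeft, Finset.mem_singleton] at ha hb
    exact absurd (ha.trans hb.symm) hab
  | succ n ih =>
    have h1 := cantorLength_succ_lt hα n
    have h2 := cantorLength_pos hα (n + 1)
    have key : ∀ {a b s t : ℝ}, a ∈ cantorLeft α n → b ∈ cantorLeft α n →
        (s = 0 ∨ s = cantorLength α n - cantorLength α (n + 1)) →
        (t = 0 ∨ t = cantorLength α n - cantorLength α (n + 1)) → a + s ≠ b + t →
        cantorLength α (n + 1) < |(a + s) - (b + t)| := by
      intro a b s t ha hb hs ht hne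
      rw [lt_abs]
      rcases eq_or_ne a b with rfl | hab
      · rcases hs with rfl | rfl <;> rcases ht with rfl | rfl
        · exact absurd rfl hne
        · right; linarith
        · left; linarith
        · exact absurd rfl hne
      · rcases lt_abs.1 (ih ha hb hab) with h | h
        · left
          rcases hs with rfl | rfl <;> rcases ht with rfl | rfl <;> linarith
        · right
          rcases hs with rfl | rfl <;> rcases ht with rfl | rfl <;> linarith
    rw [cantorLeft, Finset.mem_union, Finset.mem_image] at ha hb
    rcases ha with ha | ⟨a, ha, rfl⟩ <;> rcases hb with hb | ⟨b, hb, rfl⟩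
    · simpa using key ha hb (Or.inl rfl) (Or.inl rfl) (by simpa using hab)
    · simpa using key ha hb (Or.inl rfl) (Or.inr rfl) (by simpa using hab)
    · simpa using key ha hb (Or.inr rfl) (Or.inl rfl) (by simpa using hab)
    · exact key ha hb (Or.inr rfl) (Or.inr rfl) hab

lemma card_cantorLeft (hα : ∀ n, 1 ≤ n → 0 < α n ∧ α n < 1) (n : ℕ) : (cantorLeft α n).card = 2 ^ n := by
  induction n with
  | zero => simp [cantorLeft]
  | succ n ih =>
    have h1 := cantorLength_succ_lt hα n
    have h2 := cantorLength_pos hα (n + 1)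
    rw [cantorLeft, Finset.card_union_of_disjoint,
      Finset.card_image_of_injective _ (add_left_injective _), ih, pow_succ, mul_two]
    rw [Finset.disjoint_left]
    intro a ha hb
    obtain ⟨b, hb', rfl⟩ := Finset.mem_image.1 hb
    have h3 := cantorLength_lt_abs_sub hα n ha hb' (by
      intro h
      linarith)
    rw [add_sub_cancel_left, abs_of_pos (by linarith)] at h3
    linarith

lemma pairwiseDisjoint_cantorStage (hα : ∀ n, 1 ≤ n → 0 < α n ∧ α n < 1)
    (n : ℕ) :
    (cantorLeft α n : Set ℝ).PairwiseDisjoint fun a => Icc a (a + cantorLength α n) := by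
  intro a ha b hb hab
  refine Set.disjoint_left.2 fun x hx hy => ?_
  have h := cantorLength_lt_abs_sub hα n ha hb hab
  rw [lt_abs] at h
  rcases h with h | h <;> linarith [hx.1, hx.2, hy.1, hy.2]

lemma volume_cantorStage (hα : ∀ n, 1 ≤ n → 0 < α n ∧ α n < 1) (n : ℕ) :
    volume (cantorStage α n) = ENNReal.ofReal (2 ^ n * cantorLength α n) := by
  rw [cantorStage_eq, measure_biUnion_finset (pairwiseDisjoint_cantorStage hα n)
    fun _ _ => measurableSet_Icc]
  simp only [Real.volume_Icc, add_sub_cancel_left, Finset.sum_const, card_cantorLeft hα,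
    nsmul_eq_mul]
  rw [ENNReal.ofReal_mul (by positivity)]
  congr 1
  rw [ENNReal.ofReal_pow two_pos.le]
  simp

end CantorSets

/-! ### Decay of the Fourier transforms of the stages. -/

section CantorFourier

open Filter
open scoped Topology

lemma integrableOn_exp_ofReal_mul_I {M : Set ℝ} (hf : volume M ≠ ⊤) (u : ℝ) :
    IntegrableOn (fun t : ℝ => Complex.exp (↑(-2 * Real.pi * (t * u)) * Complex.I) * 1) M :=
  Measure.integrableOn_of_bounded (M := 1) hf (by fun_prop)
    (Eventually.of_forall fun t => by
      rw [mul_one, Complex.norm_exp_ofReal_mul_I])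

lemma indicatorFourier_diff {M N : Set ℝ} (hM : MeasurableSet M) (hN : MeasurableSet N)
    (hf : volume M ≠ ⊤) (hNM : N ⊆ M) (u : ℝ) :
    indicatorFourier (M \ N) u = indicatorFourier M u - indicatorFourier N u := by
  rw [indicatorFourier, indicatorFourier, indicatorFourier, fourier_indicator_eq hM,
    fourier_indicator_eq hN, fourier_indicator_eq (hM.diff hN)]
  exact setIntegral_sdiff hN (integrableOn_exp_ofReal_mul_I hf u) hNM

lemma norm_indicatorFourier_Icc_le {a b : ℝ} (hab : a ≤ b) {u : ℝ} (hu : u ≠ 0) :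
    ‖indicatorFourier (Icc a b) u‖ ≤ 1 / |u| := by
  set c : ℂ := ↑(-2 * Real.pi * u) * Complex.I with hc
  have hpi := Real.pi_pos
  have hnc : ‖c‖ = 2 * Real.pi * |u| := by
    rw [hc, norm_mul, Complex.norm_I, Complex.norm_real, Real.norm_eq_abs, abs_mul, abs_mul,
      abs_neg, abs_two, abs_of_pos hpi, mul_one]
  have hu' : 0 < |u| := abs_pos.2 hu
  have hc0 : c ≠ 0 := by
    rw [← norm_pos_iff, hnc]
    positivity
  have hn : ∀ t : ℝ, ‖Complex.exp (c * t)‖ = 1 := fun t => by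
    rw [show c * t = ↑(-2 * Real.pi * u * t) * Complex.I by rw [hc]; push_cast; ring]
    exact Complex.norm_exp_ofReal_mul_I _
  have e : indicatorFourier (Icc a b) u = ∫ t in a..b, Complex.exp (c * t) := by
    rw [indicatorFourier, fourier_indicator_eq measurableSet_Icc, integral_Icc_eq_integral_Ioc,
      intervalIntegral.integral_of_le hab]
    congr 1
    ext t
    rw [mul_one, hc]
    congr 1
    push_cast
    ring
  rw [e, integral_exp_mul_complex hc0, norm_div, hnc]
  -- The integral of the exponential is at most 2/(2π|u|); π is only used through π ≥ 1.
  calc ‖Complex.exp (c * b) - Complex.exp (c * a)‖ / (2 * Real.pi * |u|)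
      ≤ 2 / (2 * 1 * |u|) := by
        gcongr
        · refine (norm_sub_le _ _).trans ?_
          rw [hn, hn]
          norm_num
        · linarith [Real.pi_gt_three]
    _ = 1 / |u| := by
        field_simp

/-- The stage is a disjoint union of 2^n intervals, each contributing at most 1/|u| whatever its
length. -/
lemma norm_indicatorFourier_cantorStage_le {α : ℕ → ℝ}
    (hα : ∀ n, 1 ≤ n → 0 < α n ∧ α n < 1) (n : ℕ) {u : ℝ} (hu : u ≠ 0) :
    ‖indicatorFourier (cantorStage α n) u‖ ≤ 2 ^ n / |u| := by
  rw [indicatorFourier, fourier_indicator_eq (measurableSet_cantorStage α n), cantorStage_eq,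
    integral_biUnion_finset _ (fun _ _ => measurableSet_Icc) (pairwiseDisjoint_cantorStage hα n)
      fun a _ => integrableOn_exp_ofReal_mul_I (by simp) u]
  have h : ∀ a ∈ cantorLeft α n, ‖∫ t in Icc a (a + cantorLength α n),
      Complex.exp (↑(-2 * Real.pi * (t * u)) * Complex.I) * 1‖ ≤ 1 / |u| := fun a _ => by
    rw [← fourier_indicator_eq measurableSet_Icc]
    exact norm_indicatorFourier_Icc_le (by linarith [cantorLength_pos hα n]) hu
  refine (norm_sum_le_of_le _ h).trans_eq ?_
  rw [Finset.sum_const, card_cantorLeft hα, nsmul_eq_mul]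
  push_cast
  ring

end CantorFourier

/-! ### Prescribing the measure of a generalized Cantor set and of its stages. -/

section CantorVolume

open Filter
open scoped Topology

/-- A sequence decreasing from `1` to `0` below prescribed positive bounds. -/
def gapSequence (η : ℕ → ℝ) : ℕ → ℝ
  | 0 => 1
  | n + 1 => min (gapSequence η n / 2) (η n)

lemma gapSequence_pos {η : ℕ → ℝ} (hη : ∀ n, 0 < η n) (n : ℕ) : 0 < gapSequence η n := by
  induction n with
  | zero => exact one_pos
  | succ n ih => exact lt_min (by linarith) (hη n)

lemma gapSequence_succ_lt {η : ℕ → ℝ} (hη : ∀ n, 0 < η n) (n : ℕ) :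
    gapSequence η (n + 1) < gapSequence η n :=
  (min_le_left _ _).trans_lt (by linarith [gapSequence_pos hη n])

lemma gapSequence_le (η : ℕ → ℝ) (n : ℕ) : gapSequence η n ≤ (1 / 2) ^ n := by
  induction n with
  | zero => simp [gapSequence]
  | succ n ih =>
    refine (min_le_left _ _).trans ?_
    rw [pow_succ]
    linarith

/-- There are generalized Cantor sets of any measure in `[0, 1)` whose stages approximate them
arbitrarily well. -/
theorem exists_cantor_volume {θ : ℝ} (hθ₀ : 0 ≤ θ) (hθ₁ : θ < 1) {η : ℕ → ℝ}
    (hη : ∀ n, 0 < η n) :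
    ∃ α : ℕ → ℝ, (∀ n, 1 ≤ n → 0 < α n ∧ α n < 1) ∧
      volume (generalizedCantorSet α) = ENNReal.ofReal θ ∧
      ∀ n, volume.real (cantorStage α (n + 1) \ generalizedCantorSet α) ≤ η n := by
  set w := gapSequence η with hw
  -- The intended measure of the n-th stage, decreasing from 1 to θ. The excess of stage n + 1 over
  -- the limit is (1 - θ) w (n + 1), which is at most η n.
  set v : ℕ → ℝ := fun n => θ + (1 - θ) * w n with hv
  have hv0 : ∀ n, 0 < v n := fun n => by
    have := mul_pos (sub_pos.2 hθ₁) (gapSequence_pos hη n)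
    exact add_pos_of_nonneg_of_pos hθ₀ this
  have hvlt : ∀ n, v (n + 1) < v n := fun n => by
    have := mul_lt_mul_of_pos_left (gapSequence_succ_lt hη n) (sub_pos.2 hθ₁)
    exact (add_lt_add_iff_left θ).2 this
  -- The n-th step multiplies the measure by 1 - α n, so this ratio turns v (n - 1) into v n. The
  -- value at n = 0 plays no role.
  set α : ℕ → ℝ := fun n => 1 - v n / v (n - 1) with hαdef
  have hα : ∀ n, 1 ≤ n → 0 < α n ∧ α n < 1 := by
    intro n hn
    obtain ⟨n, rfl⟩ := Nat.exists_eq_add_of_le' hn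
    have h1 : v (n + 1) / v n < 1 := (div_lt_one (hv0 n)).2 (hvlt n)
    have h2 : 0 < v (n + 1) / v n := div_pos (hv0 _) (hv0 _)
    simp only [hαdef, Nat.add_sub_cancel]
    constructor <;> linarith
  have hL : ∀ n, 2 ^ n * cantorLength α n = v n := by
    intro n
    induction n with
    | zero => simp [cantorLength, hv, hw, gapSequence]
    | succ n ih =>
      have h1 : 1 - α (n + 1) = v (n + 1) / v n := by simp [hαdef]
      have h2 := (hv0 n).ne'
      rw [cantorLength, h1, pow_succ]
      calc (2 : ℝ) ^ n * 2 * (cantorLength α n * (v (n + 1) / v n) / 2)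
          = (2 ^ n * cantorLength α n) * (v (n + 1) / v n) := by ring
        _ = v (n + 1) := by rw [ih, mul_div_cancel₀ _ h2]
  have hvol : ∀ n, volume (cantorStage α n) = ENNReal.ofReal (v n) := fun n => by
    rw [volume_cantorStage hα, hL]
  have hw0 : Tendsto w atTop (𝓝 0) :=
    squeeze_zero (fun n => (gapSequence_pos hη n).le) (gapSequence_le η)
      (tendsto_pow_atTop_nhds_zero_of_lt_one (by norm_num) (by norm_num))
  have hvt : Tendsto v atTop (𝓝 θ) := by
    simpa using (hw0.const_mul (1 - θ)).const_add θ
  have hC : volume (generalizedCantorSet α) = ENNReal.ofReal θ := by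
    have h1 := tendsto_measure_iInter_atTop (μ := (volume : Measure ℝ)) (s := cantorStage α)
      (fun n => (measurableSet_cantorStage α n).nullMeasurableSet) (antitone_cantorStage hα)
      ⟨0, by rw [hvol]; exact ENNReal.ofReal_ne_top⟩
    refine tendsto_nhds_unique h1 ?_
    simp only [Function.comp_def, hvol]
    exact (ENNReal.continuous_ofReal.tendsto θ).comp hvt
  refine ⟨α, hα, hC, fun n => ?_⟩
  rw [measureReal_sdiff (show generalizedCantorSet α ⊆ _ from iInter_subset _ (n + 1))
    (measurableSet_generalizedCantorSet α)
    (by rw [hvol]; exact ENNReal.ofReal_ne_top), measureReal_def, measureReal_def, hvol, hC,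
    ENNReal.toReal_ofReal (hv0 _).le, ENNReal.toReal_ofReal hθ₀]
  have h1 : w (n + 1) ≤ η n := min_le_right _ _
  have h2 := gapSequence_pos hη (n + 1)
  simp only [hv]
  nlinarith

end CantorVolume

end

/-! ### The main theorem -/

lemma norm_indicatorFourier_cantorSet_le {α : ℕ → ℝ}
    (hα : ∀ n, 1 ≤ n → 0 < α n ∧ α n < 1) (n : ℕ) {u : ℝ} (hu : u ≠ 0) :
    ‖indicatorFourier (generalizedCantorSet α) u‖ ≤ 2 ^ n / |u| +
      ‖indicatorFourier (cantorStage α n \ generalizedCantorSet α) u‖ := by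
  rw [indicatorFourier_diff (measurableSet_cantorStage α n) (measurableSet_generalizedCantorSet α)
    (by rw [volume_cantorStage hα]; exact ENNReal.ofReal_ne_top)
    (show generalizedCantorSet α ⊆ _ from iInter_subset _ n)]
  have h1 := norm_indicatorFourier_cantorStage_le hα n hu
  have h2 := norm_sub_norm_le (indicatorFourier (generalizedCantorSet α) u)
    (indicatorFourier (cantorStage α n) u)
  rw [norm_sub_rev] at h2
  linarith

/-- The transform of the complement differs in sign from that of the Cantor set up to the transform
of [0,1], which adds 1/|u|; the L² error set is unchanged. -/
lemma norm_indicatorFourier_cantorSet_compl_le {α : ℕ → ℝ}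
    (hα : ∀ n, 1 ≤ n → 0 < α n ∧ α n < 1) (n : ℕ) {u : ℝ} (hu : u ≠ 0) :
    ‖indicatorFourier (Icc 0 1 \ generalizedCantorSet α) u‖ ≤ (2 ^ n + 1) / |u| +
      ‖indicatorFourier (cantorStage α n \ generalizedCantorSet α) u‖ := by
  have hsub : generalizedCantorSet α ⊆ Icc 0 1 := by
    rw [← cantorStage_zero α]
    exact iInter_subset _ 0
  rw [indicatorFourier_diff measurableSet_Icc (measurableSet_generalizedCantorSet α)
    (by simp) hsub]
  have h1 := norm_indicatorFourier_cantorSet_le hα n hu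
  have h2 := norm_indicatorFourier_Icc_le zero_le_one hu
  have h3 := norm_sub_le (indicatorFourier (Icc 0 1) u)
    (indicatorFourier (generalizedCantorSet α) u)
  rw [add_div]
  linarith

theorem theorem1p2 (θ : ℝ) (hθ₀ : 0 ≤ θ) (hθ₁ : θ < 1) :
    ∃ C : Set ℝ, IsGeneralizedCantorSet C ∧ volume C = ENNReal.ofReal θ ∧
      (∃ P : PointProcess ℝ, IsDeterminantal volume (fourierKernel C) P) ∧
      (∀ P : PointProcess ℝ, IsDeterminantal volume (fourierKernel C) P → NumberRigid P) ∧
      (∃ P : PointProcess ℝ, IsDeterminantal volume (fourierKernel (Icc 0 1 \ C)) P) ∧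
      (∀ P : PointProcess ℝ,
        IsDeterminantal volume (fourierKernel (Icc 0 1 \ C)) P → NumberRigid P) := by
  have hA : ∀ n : ℕ, (0 : ℝ) < 2 ^ (n + 1) + 1 := fun n => by positivity
  -- The energy is chosen to absorb the square of the decay constant A = 2^(n+1) + 1, which serves
  -- stage n + 1 for both C and its complement. The functions φ n depend on no Cantor set and are
  -- fixed first.
  choose φ hφ hφ1 hφi hφE using fun n : ℕ => exists_isTestFunction_integral_shiftEnergy_le n
    (ε := (1 / 2) ^ n / (2 ^ (n + 1) + 1) ^ 2) (by positivity)
  have hS : ∀ n, 0 ≤ ∫ x, φ n x ^ 2 := fun n => integral_nonneg fun x => sq_nonneg _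
  -- The gap at stage n + 1 is made small relative to the already chosen ∫ φ n ²; the summand 1
  -- keeps the denominator positive.
  obtain ⟨α, hα, hvol, hgap⟩ := exists_cantor_volume hθ₀ hθ₁
    (η := fun n => (1 / 2) ^ n / (1 + ∫ x, φ n x ^ 2)) fun n => by
      have := hS n
      positivity
  set C := generalizedCantorSet α with hC
  have hCm : MeasurableSet C := measurableSet_generalizedCantorSet α
  have hIm : MeasurableSet (Icc 0 1 \ C) := measurableSet_Icc.diff hCm
  have hC1 : volume C ≤ 1 := by
    rw [hvol]
    exact ENNReal.ofReal_le_one.2 hθ₁.le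
  have hI1 : volume (Icc 0 1 \ C) ≤ 1 := (measure_mono sdiff_subset).trans (by simp)
  have hDm : ∀ n, MeasurableSet (cantorStage α n \ C) := fun n =>
    (measurableSet_cantorStage α n).diff hCm
  have hDf : ∀ n, volume (cantorStage α n \ C) ≠ ⊤ := fun n =>
    ne_top_of_le_ne_top (by rw [volume_cantorStage hα]; exact ENNReal.ofReal_ne_top)
      (measure_mono sdiff_subset)
  -- The variance bound 2 A² · energy + 2 m(D) ∫ φ² contributes 2 (1/2)^n from each of its two
  -- terms.
  have hb : Summable fun n : ℕ => 4 * (1 / 2 : ℝ) ^ n :=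
    (summable_geometric_of_lt_one (by norm_num) (by norm_num)).mul_left 4
  have hvar : ∀ M : Set ℝ, MeasurableSet M → volume M ≤ 1 →
      (∀ (n : ℕ) (u : ℝ), u ≠ 0 → ‖indicatorFourier M u‖ ≤ (2 ^ (n + 1) + 1) / |u| +
        ‖indicatorFourier (cantorStage α (n + 1) \ C) u‖) →
      ∀ P : PointProcess ℝ, IsDeterminantal volume (fourierKernel M) P → NumberRigid P := by
    intro M hM hM1 hle
    have hMf : volume M ≠ ⊤ := ne_top_of_le_ne_top ENNReal.one_ne_top hM1
    refine numberRigid_of_summable hM hMf hφ hφ1 hb fun n => ?_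
    refine (integral_norm_sq_mul_shiftEnergy_le (hDm (n + 1)) (hDf (n + 1)) hM hMf (hφ n)
      (hφi n) (hle n)).trans ?_
    have h1 : (2 ^ (n + 1) + 1) ^ 2 * (∫ u, shiftEnergy (φ n) u / u ^ 2) ≤ (1 / 2) ^ n := by
      rw [mul_comm, ← le_div_iff₀ (pow_pos (hA n) 2)]
      exact hφE n
    have h2 : volume.real (cantorStage α (n + 1) \ C) * ∫ x, φ n x ^ 2 ≤ (1 / 2) ^ n := by
      have h3 := hS n
      have h4 := (le_div_iff₀ (by linarith)).1 (hgap n)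
      have h5 : 0 ≤ volume.real (cantorStage α (n + 1) \ C) := measureReal_nonneg
      linarith
    linarith
  refine ⟨C, ⟨α, hα, rfl⟩, hvol, exists_isDeterminantal_fourierKernel hCm hC1,
    hvar C hCm hC1 fun n u hu => ?_, exists_isDeterminantal_fourierKernel hIm hI1,
    hvar _ hIm hI1 fun n u hu => norm_indicatorFourier_cantorSet_compl_le hα (n + 1) hu⟩
  -- For C itself the constant 2^(n+1) suffices; it is enlarged by 1 to match the common form.
  refine (norm_indicatorFourier_cantorSet_le hα (n + 1) hu).trans ?_
  gcongr
  linarith
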